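/- **Conventions.** Let $n\ge 0$ be an integer and let $q\in\mathbb C$, $q\neq 0$, with $q^{2k}\ne 1$ for $1\le k\le n$; write $q^{z}=\exp(z\log q)$ with the principal logarithm. Let $\mathfrak h^*=\mathbb C^n$ with standard basis $\omega(i)=e_i$, put $\underline 1=(1,\dots,1)$, let $M$ be the field of meromorphic functions on $\mathbb C^n$ and $(T_\alpha f)(\lambda)=f(\lambda+\alpha)$. Put $$h_0(\lambda)=\frac{q^{-1}-q}{q^{-2\lambda}-1},\quad g(\lambda)=\frac{(q^{-2\lambda}-q^{-2})(q^{-2\lambda}-q^{2})}{(q^{-2\lambda}-1)^2},\quad h(\lambda)=q\,\frac{q^{-2\lambda}-q^{-2}}{q^{-2\lambda}-1},$$ and let $R(\lambda)(v_a\otimes v_b)=\sum_{x,y}R^{ab}_{xy}(\lambda)\,v_x\otimes v_y$ be the $R$-matrix $$R(\lambda)=q\sum_a E_{aa}\otimes E_{aa}+\sum_{a<b}E_{aa}\otimes E_{bb}+\sum_{a>b}g(\lambda_a-\lambda_b)E_{aa}\otimes E_{bb}+\sum_{a\ne b}h_0(\lambda_a-\lambda_b)E_{ba}\otimes E_{ab}.$$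 **$\mathfrak h$-Hopf algebroids.** An $\mathfrak h$-algebra is a unital associative complex algebra $A=\bigoplus_{\alpha,\beta\in\mathfrak h^*}A_{\alpha\beta}$, bigraded, with two algebra embeddings (moment maps) $\mu_l,\mu_r:M\to A_{00}$ such that $\mu_l(f)a=a\mu_l(T_\alpha f)$ and $\mu_r(f)a=a\mu_r(T_\beta f)$ for $a\in A_{\alpha\beta}$. Morphisms are algebra homomorphisms preserving the bigrading and the moment maps. The matrix tensor product $A\tilde\otimes B$ has $(A\tilde\otimes B)_{\alpha\beta}=\bigoplus_\gamma A_{\alpha\gamma}\otimes B_{\gamma\beta}$ modulo $\mu_r(f)a\otimes b=a\otimes\mu_l(f)b$, product $(a\otimes b)(c\otimes d)=ac\otimes bd$, and moment maps $\mu_l(f)\otimes 1$, $1\otimes\mu_r(f)$. $D$ is the algebra of difference operators $\sum_i f_iT_{\beta_i}$ on $M$, with $fT_{-\beta}\in D_{\beta\beta}$ and both moment maps the natural embedding; one identifies $x\in A_{\alpha\beta}$ with $x\otimes T_{-\beta}\in A\tilde\otimes D$ and with $T_{-\alpha}\otimes x\in D\tilde\otimes A$. An $\mathfrak h$-bialgebroid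 is an $\mathfrak h$-algebra with $\mathfrak h$-algebra morphisms $\Delta:A\to A\tilde\otimes A$ and $\varepsilon:A\to D$ satisfying $(\Delta\otimes\mathrm{id})\Delta=(\mathrm{id}\otimes\Delta)\Delta$ and $(\varepsilon\otimes\mathrm{id})\Delta=\mathrm{id}=(\mathrm{id}\otimes\varepsilon)\Delta$. It is an $\mathfrak h$-Hopf algebroid with antipode $S$ if $S:A\to A$ is $\mathbb C$-linear, $S(\mu_r(f)a)=S(a)\mu_l(f)$, $S(a\mu_l(f))=\mu_r(f)S(a)$, and, with $m$ the multiplication, $$m(\mathrm{id}\otimes S)\Delta(a)=\mu_l(\varepsilon(a)1)\ (a\in A),\qquad m(S\otimes\mathrm{id})\Delta(a)=\mu_r(T_\alpha(\varepsilon(a)1))\ (a\in A_{\alpha\beta}),$$ where $m(\mathrm{id}\otimes S)$ and $m(S\otimes \mathrm{id})$ are well defined on $\Delta(a)$ and $\varepsilon(a)1$ is $\varepsilon(a)$ applied to the constant function $1$. **The algebra $\mathcal F_R(M(n))$.** It is generated by $t_{ij}$ ($1\le i,j\le n$) and two commuting copies $\mu_l(M)$, $\mu_r(M)$ of $M$,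 with relations $\mu_l(f)t_{ij}=t_{ij}\mu_l(T_{\omega(i)}f)$, $\mu_r(f)t_{ij}=t_{ij}\mu_r(T_{\omega(j)}f)$ and $$\sum_{x,y}\mu_l(R^{xy}_{ac})\,t_{xb}t_{yd}=\sum_{x,y}\mu_r(R^{bd}_{xy})\,t_{cy}t_{ax}\qquad(1\le a,b,c,d\le n),$$ bigraded by giving $t_{ij}$ bidegree $(\omega(i),\omega(j))$ and both copies of $M$ bidegree $(0,0)$. For $I=\{i_1<\dots<i_r\}$, $J=\{j_1<\dots<j_r\}$ put $$\xi^I_J=\sum_{\sigma\in S_r}\mu_l\Big(\prod_{k<l,\ \sigma(k)>\sigma(l)}-h(\lambda_{i_{\sigma(k)}}-\lambda_{i_{\sigma(l)}})\Big)t_{i_{\sigma(1)}j_1}\cdots t_{i_{\sigma(r)}j_r},$$ $\xi^I_J=0$ if $\#I\ne\#J$, and $\det=\xi^{\{1,\dots,n\}}_{\{1,\dots,n\}}$. For disjoint $I_1,I_2$ let $\mathrm{sign}(I_1;I_2)=\prod_{k\in I_1,\,m\in I_2,\,k>m}-h(\lambda_k-\lambda_m)\in M$, and let $\hat\imath=\{1,\dots,n\}\setminus\{i\}$.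 **The algebra $\mathcal F_R(GL(n))$.** It is $\mathcal F_R(M(n))$ localized at $\det$: one adjoins a generator $\det^{-1}$ of bidegree $(-\underline 1,-\underline 1)$ with $\det\det^{-1}=1=\det^{-1}\det$, $t_{ij}\det^{-1}=\det^{-1}t_{ij}$, $\mu_l(f)\det^{-1}=\det^{-1}\mu_l(T_{-\underline 1}f)$ and $\mu_r(f)\det^{-1}=\det^{-1}\mu_r(T_{-\underline 1}f)$. **Proposition.** (a) The $\xi^I_J$ are the dynamical quantum minor determinants: let $W$ be the algebra generated by a copy of $M$ and $w_1,\dots,w_n$ with $f w_i=w_i\,T_{\omega(i)}f$, $w_i^2=0$, $w_jw_i=-h(\lambda_j-\lambda_i)w_iw_j$ for $i<j$, graded by giving $M$ degree $0$ and $w_i$ degree $\omega(i)$, let $w_I=w_{i_1}\cdots w_{i_r}$, let $R(w_i)=\sum_j w_j\otimes t_{ji}\in W\tilde\otimes\mathcal F_R(M(n))$ (the matrix tensor product modulo $fw\otimes a=w\otimes\mu_l(f)a$) and $R(w_J)=R(w_{j_1})\cdots R(w_{j_r})$; then $R(w_J)=\sum_{\#I=\#J}w_I\otimes\xi^I_J$,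 and $\xi^I_J$ has bidegree $(\sum_{i\in I}\omega(i),\sum_{j\in J}\omega(j))$. (b) There are $\Delta$, $\varepsilon$, $S$ with which $\mathcal F_R(GL(n))$ is an $\mathfrak h$-Hopf algebroid and such that $$\Delta(t_{ij})=\sum_k t_{ik}\otimes t_{kj},\quad \Delta(\det\nolimits^{-1})=\det\nolimits^{-1}\otimes\det\nolimits^{-1},\quad \varepsilon(t_{ij})=\delta_{ij}T_{-\omega(i)},\quad \varepsilon(\det\nolimits^{-1})=T_{\underline 1},$$ where the antipode $S$ is a unital algebra anti-homomorphism with $S(\mu_l(f))=\mu_r(f)$, $S(\mu_r(f))=\mu_l(f)$ for $f\in M$, $S(\det^{-1})=\det$, and $$S(t_{ij})=\det\nolimits^{-1}\,\frac{\mu_l(\mathrm{sign}(\hat\jmath;\{j\}))}{\mu_r(\mathrm{sign}(\hat\imath;\{i\}))}\,\xi^{\hat\jmath}_{\hat\imath}\qquad(1\le i,j\le n).$$ -/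

import Mathlib

open scoped TensorProduct

noncomputable section

namespace DynGL

/-! The dual Cartan `𝔥* = ℂⁿ` and the field of meromorphic functions on it. -/

/-- `𝔥* ≅ ℂⁿ`. -/
abbrev H (n : ℕ) : Type := Fin n → ℂ

/-- A function on `ℂⁿ` represents a meromorphic function if near every point it is a quotient
`g / h` of holomorphic functions with `h` not identically zero near that point.
(Its values on the polar locus are irrelevant.) -/
def IsMero {n : ℕ} (f : H n → ℂ) : Prop :=
  ∀ z : H n, ∃ g h : H n → ℂ, AnalyticAt ℂ g z ∧ AnalyticAt ℂ h z ∧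
    (¬ ∀ᶠ w in nhds z, h w = 0) ∧ ∀ᶠ w in nhds z, h w * f w = g w

theorem eqOn_zero_ball {n : ℕ} {g : H n → ℂ} {z w : H n} {r : ℝ}
    (hg : AnalyticOnNhd ℂ g (Metric.ball z r)) (hw : w ∈ Metric.ball z r)
    (h0 : ∀ᶠ v in nhds w, g v = 0) : ∀ v ∈ Metric.ball z r, g v = 0 := fun _ hv =>
  hg.eqOn_zero_of_preconnected_of_eventuallyEq_zero
    (convex_ball z r).isPreconnected hw h0 hv

theorem exists_ball {n : ℕ} {g : H n → ℂ} {z : H n} {p : H n → Prop}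
    (hg : AnalyticAt ℂ g z) (hp : ∀ᶠ w in nhds z, p w) :
    ∃ r > 0, AnalyticOnNhd ℂ g (Metric.ball z r) ∧ ∀ w ∈ Metric.ball z r, p w := by
  obtain ⟨r, hr, h⟩ := Metric.eventually_nhds_iff_ball.1 (hg.eventually_analyticAt.and hp)
  exact ⟨r, hr, fun w hw => (h w hw).1, fun w hw => (h w hw).2⟩

theorem not_eventually_zero_mul {n : ℕ} {g h : H n → ℂ} {z : H n}
    (hg : AnalyticAt ℂ g z) (hh : AnalyticAt ℂ h z)
    (hg0 : ¬ ∀ᶠ w in nhds z, g w = 0) (hh0 : ¬ ∀ᶠ w in nhds z, h w = 0) :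
    ¬ ∀ᶠ w in nhds z, g w * h w = 0 := by
  intro h0
  obtain ⟨r, hr, ha, hb⟩ := exists_ball hg (hh.eventually_analyticAt.and h0)
  have hz : z ∈ Metric.ball z r := Metric.mem_ball_self hr
  have hball : ∀ᶠ w in nhds z, w ∈ Metric.ball z r := Metric.ball_mem_nhds z hr
  have : ∃ w ∈ Metric.ball z r, g w ≠ 0 := by
    by_contra! hc
    exact hg0 (hball.mono hc)
  obtain ⟨w, hw, hgw⟩ := this
  have hne : ∀ᶠ v in nhds w, h v = 0 := by
    filter_upwards [(ha w hw).continuousAt.eventually_ne hgw, Metric.isOpen_ball.mem_nhds hw]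
      with v hv hvb
    exact (mul_eq_zero.1 (hb v hvb).2).resolve_left hv
  have := eqOn_zero_ball (fun v hv => (hb v hv).1) hw hne
  exact hh0 (hball.mono this)

theorem one_not_eventually_zero {n : ℕ} (z : H n) :
    ¬ ∀ᶠ w in nhds z, (fun _ : H n => (1 : ℂ)) w = 0 := fun h => by
  obtain ⟨_, hw⟩ := h.exists
  exact one_ne_zero hw

/-- The algebra of functions representing meromorphic functions. -/
def meroFun (n : ℕ) : Subalgebra ℂ (H n → ℂ) where
  carrier := {f | IsMero f}
  mul_mem' := by
    intro f f' hf hf' z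
    obtain ⟨g, h, hg, hh, h0, he⟩ := hf z
    obtain ⟨g', h', hg', hh', h0', he'⟩ := hf' z
    refine ⟨g * g', h * h', hg.mul hg', hh.mul hh', not_eventually_zero_mul hh hh' h0 h0', ?_⟩
    filter_upwards [he, he'] with w hw hw'
    simp only [Pi.mul_apply]
    rw [← hw, ← hw']; ring
  add_mem' := by
    intro f f' hf hf' z
    obtain ⟨g, h, hg, hh, h0, he⟩ := hf z
    obtain ⟨g', h', hg', hh', h0', he'⟩ := hf' z
    refine ⟨g * h' + g' * h, h * h', (hg.mul hh').add (hg'.mul hh), hh.mul hh',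
      not_eventually_zero_mul hh hh' h0 h0', ?_⟩
    filter_upwards [he, he'] with w hw hw'
    simp only [Pi.mul_apply, Pi.add_apply]
    rw [← hw, ← hw']; ring
  algebraMap_mem' := by
    intro c z
    exact ⟨fun _ => c, fun _ => 1, analyticAt_const, analyticAt_const, one_not_eventually_zero z,
      by simp⟩

/-- The functions vanishing on a dense open set. Two representatives define the same meromorphic
function when their difference lies here. -/
def nullIdeal (n : ℕ) : Ideal (meroFun n) where
  carrier := {f | Dense (interior {z | (f : H n → ℂ) z = 0})}
  zero_mem' := by simp
  add_mem' := by
    intro f g hf hg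
    refine (hf.inter_of_isOpen_left hg isOpen_interior).mono ?_
    rw [← interior_inter]
    refine interior_mono fun z hz => ?_
    have h1 : (f : H n → ℂ) z = 0 := hz.1
    have h2 : (g : H n → ℂ) z = 0 := hz.2
    simp [h1, h2]
  smul_mem' := by
    intro c f hf
    refine hf.mono (interior_mono fun z hz => ?_)
    have h1 : (f : H n → ℂ) z = 0 := hz
    simp [h1]

theorem mem_nullIdeal_of_local {n : ℕ} {f : meroFun n} {z₀ : H n} {g h : H n → ℂ}
    (hg0 : ∀ᶠ w in nhds z₀, g w = 0) (hh : AnalyticAt ℂ h z₀)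
    (hh0 : ¬ ∀ᶠ w in nhds z₀, h w = 0)
    (he : ∀ᶠ w in nhds z₀, h w * (f : H n → ℂ) w = g w) : f ∈ nullIdeal n := by
  set Z : Set (H n) := {z | (f : H n → ℂ) z = 0} with hZ
  -- if the local numerator vanishes near `z`, then `z` is interior to the closure
  have key : ∀ (z : H n) (h : H n → ℂ) (r : ℝ), AnalyticOnNhd ℂ h (Metric.ball z r) →
      (¬ ∀ᶠ w in nhds z, h w = 0) → 0 < r →
      (∀ w ∈ Metric.ball z r, h w * (f : H n → ℂ) w = 0) →
      z ∈ interior (closure (interior Z)) := by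
    intro z h r hh hh0 hr hf
    refine mem_interior.2 ⟨Metric.ball z r, ?_, Metric.isOpen_ball, Metric.mem_ball_self hr⟩
    intro w hw
    rw [mem_closure_iff_nhds]
    intro t ht
    by_contra hc
    rw [Set.not_nonempty_iff_eq_empty] at hc
    apply hh0
    have hball : ∀ᶠ v in nhds z, v ∈ Metric.ball z r := Metric.ball_mem_nhds z hr
    refine hball.mono (eqOn_zero_ball hh hw ?_)
    obtain ⟨u, hut, huo, hwu⟩ := mem_nhds_iff.1 ht
    filter_upwards [huo.mem_nhds hwu, Metric.isOpen_ball.mem_nhds hw] with v hvu hvb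
    by_contra hv
    have hvZ : v ∈ interior Z := by
      rw [mem_interior_iff_mem_nhds]
      filter_upwards [(hh v hvb).continuousAt.eventually_ne hv, Metric.isOpen_ball.mem_nhds hvb]
        with x hx hxb
      exact (mul_eq_zero.1 (hf x hxb)).resolve_left hx
    have : v ∈ t ∩ interior Z := ⟨hut hvu, hvZ⟩
    rw [hc] at this
    exact this
  have hclopen : IsClopen (interior (closure (interior Z))) := by
    refine ⟨?_, isOpen_interior⟩
    refine isClosed_of_closure_subset fun z hz => ?_
    obtain ⟨g, h, hg, hh, hh0, he⟩ := f.2 z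
    obtain ⟨r, hr, ha, hb⟩ := exists_ball hg (hh.eventually_analyticAt.and he)
    have h1 : (Metric.ball z r ∩ interior (closure (interior Z))).Nonempty :=
      mem_closure_iff_nhds.1 hz _ (Metric.ball_mem_nhds z hr)
    obtain ⟨w, hw, hw'⟩ := h1
    have h2 : (Metric.ball z r ∩ interior Z).Nonempty :=
      mem_closure_iff_nhds.1 (interior_subset hw') _ (Metric.isOpen_ball.mem_nhds hw)
    obtain ⟨v, hv, hv'⟩ := h2
    have hgv : ∀ᶠ x in nhds v, g x = 0 := by
      filter_upwards [isOpen_interior.mem_nhds hv', Metric.isOpen_ball.mem_nhds hv] with x hx hxb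
      have : x ∈ Z := interior_subset hx
      have : (f : H n → ℂ) x = 0 := this
      rw [← (hb x hxb).2, this, mul_zero]
    have hgz := eqOn_zero_ball ha hv hgv
    exact key z h r (fun x hx => (hb x hx).1) hh0 hr
      (fun x hx => by rw [(hb x hx).2, hgz x hx])
  have hne : (interior (closure (interior Z))).Nonempty := by
    obtain ⟨r, hr, ha, hb⟩ := exists_ball hh (he.and hg0)
    exact ⟨z₀, key z₀ h r ha hh0 hr (fun x hx => by rw [(hb x hx).1, (hb x hx).2])⟩
  have huniv := hclopen.eq_univ hne
  intro z
  exact interior_subset (huniv ▸ Set.mem_univ z)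

instance nullIdeal_isMaximal (n : ℕ) : (nullIdeal n).IsMaximal := by
  rw [Ideal.isMaximal_iff]
  refine ⟨?_, ?_⟩
  · intro h
    have h1 : Dense (interior {z : H n | ((1 : meroFun n) : H n → ℂ) z = 0}) := h
    simp at h1
    exact (Set.empty_ne_univ (closure_empty.symm.trans (dense_iff_closure_eq.1 h1)))
  · intro J f hIJ hf hfJ
    have hinv : IsMero (fun z => ((f : H n → ℂ) z)⁻¹) := by
      intro z
      obtain ⟨g, h, hg, hh, hh0, he⟩ := f.2 z
      have hg0 : ¬ ∀ᶠ w in nhds z, g w = 0 := fun hc => hf (mem_nullIdeal_of_local hc hh hh0 he)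
      refine ⟨g * h, g * g, hg.mul hh, hg.mul hg, not_eventually_zero_mul hg hg hg0 hg0, ?_⟩
      filter_upwards [he] with w hw
      simp only [Pi.mul_apply]
      by_cases h0 : (f : H n → ℂ) w = 0
      · rw [← hw, h0]; simp
      · rw [← hw]; field_simp
    let f' : meroFun n := ⟨_, hinv⟩
    have hmem : 1 - f' * f ∈ nullIdeal n := by
      have : Dense (interior {z : H n | (f : H n → ℂ) z ≠ 0}) := by
        intro z
        obtain ⟨g, h, hg, hh, hh0, he⟩ := f.2 z
        have hg0 : ¬ ∀ᶠ w in nhds z, g w = 0 := fun hc => hf (mem_nullIdeal_of_local hc hh hh0 he)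
        rw [mem_closure_iff_nhds]
        intro t ht
        obtain ⟨r, hr, ha, hb⟩ := exists_ball hg (he.and ht)
        have : ∃ w ∈ Metric.ball z r, g w ≠ 0 := by
          by_contra! hc
          exact hg0 (Filter.mem_of_superset (Metric.ball_mem_nhds z hr) hc)
        obtain ⟨w, hw, hgw⟩ := this
        refine ⟨w, (hb w hw).2, ?_⟩
        rw [mem_interior_iff_mem_nhds]
        filter_upwards [(ha w hw).continuousAt.eventually_ne hgw, Metric.isOpen_ball.mem_nhds hw]
          with v hv hvb hv0
        apply hv
        rw [← (hb v hvb).1, hv0, mul_zero]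
      refine this.mono (interior_mono fun z hz => ?_)
      have hz' : (f : H n → ℂ) z ≠ 0 := hz
      change (1 : ℂ) - ((f : H n → ℂ) z)⁻¹ * (f : H n → ℂ) z = 0
      rw [inv_mul_cancel₀ hz', sub_self]
    have h1 := J.add_mem (hIJ hmem) (J.mul_mem_left f' hfJ)
    simpa using h1

/-- The field `M_{𝔥*}` of meromorphic functions on `𝔥* = ℂⁿ`. -/
def M (n : ℕ) : Type := meroFun n ⧸ nullIdeal n

instance instCommRingM (n : ℕ) : CommRing (M n) :=
  inferInstanceAs (CommRing (meroFun n ⧸ nullIdeal n))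

/-- Every nonzero meromorphic function is invertible. -/
instance instFieldM (n : ℕ) : Field (M n) :=
  let F : Field (meroFun n ⧸ nullIdeal n) := Ideal.Quotient.field (nullIdeal n)
  { instCommRingM n with
    inv := F.inv
    exists_pair_ne := F.exists_pair_ne
    mul_inv_cancel := F.mul_inv_cancel
    inv_zero := F.inv_zero
    nnqsmul := _
    nnqsmul_def := fun _ _ => rfl
    qsmul := _
    qsmul_def := fun _ _ => rfl }

instance instAlgebraM (n : ℕ) : Algebra ℂ (M n) :=
  inferInstanceAs (Algebra ℂ (meroFun n ⧸ nullIdeal n))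

/-- The class of a representing function. -/
def toM (n : ℕ) : meroFun n →ₐ[ℂ] M n := Ideal.Quotient.mkₐ ℂ (nullIdeal n)

/-- A holomorphic function on `ℂⁿ` as a meromorphic function. -/
def ofEntire {n : ℕ} (f : H n → ℂ) (hf : ∀ z, AnalyticAt ℂ f z) : M n :=
  toM n
    ⟨f, fun z => ⟨f, fun _ => 1, hf z, analyticAt_const, one_not_eventually_zero z, by simp⟩⟩

theorem isMero_shift {n : ℕ} {f : H n → ℂ} (hf : IsMero f) (α : H n) :
    IsMero (fun z => f (z + α)) := by
  intro z
  obtain ⟨g, h, hg, hh, hh0, he⟩ := hf (z + α)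
  have ha : AnalyticAt ℂ (fun w : H n => w + α) z := analyticAt_id.add analyticAt_const
  have ht : Filter.map (fun w : H n => w + α) (nhds z) = nhds (z + α) :=
    (Homeomorph.addRight α).map_nhds_eq z
  refine ⟨fun w => g (w + α), fun w => h (w + α), AnalyticAt.fun_comp (f := fun w : H n => w + α) hg ha,
    AnalyticAt.fun_comp (f := fun w : H n => w + α) hh ha, ?_, ?_⟩
  · intro hc
    exact hh0 (ht ▸ (Filter.eventually_map.2 hc))
  · rw [← ht] at he
    exact Filter.eventually_map.1 he

/-- Translation on representatives. -/
def shiftFun {n : ℕ} (α : H n) : meroFun n →ₐ[ℂ] meroFun n where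
  toFun f := ⟨fun z => (f : H n → ℂ) (z + α), isMero_shift f.2 α⟩
  map_one' := rfl
  map_mul' _ _ := rfl
  map_zero' := rfl
  map_add' _ _ := rfl
  commutes' _ := rfl

theorem shiftFun_mem {n : ℕ} (α : H n) :
    nullIdeal n ≤ (nullIdeal n).comap (shiftFun α) := by
  intro f hf
  have hf' : Dense (interior {z | (f : H n → ℂ) z = 0}) := hf
  have h2 := hf'.preimage (Homeomorph.addRight α).isOpenMap
  rw [(Homeomorph.addRight α).preimage_interior] at h2
  exact h2

/-- `(T_α f)(λ) = f(λ + α)`. -/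
def T {n : ℕ} (α : H n) : M n →ₐ[ℂ] M n :=
  Ideal.quotientMapₐ (nullIdeal n) (shiftFun α) (shiftFun_mem α)

/-! Algebras with two gradings and two moment maps; the matrix tensor product. -/

/-- The part of the structure of a left tensor factor which enters `⊗̃`: a grading by `𝔥*` and
an action of `M_{𝔥*}`. -/
class RightGraded (n : ℕ) (A : Type) [Ring A] [Algebra ℂ A] where
  rgrade : H n → Submodule ℂ A
  rmom : M n →ₐ[ℂ] A

/-- The part of the structure of a right tensor factor which enters `⊗̃`. -/
class LeftGraded (n : ℕ) (A : Type) [Ring A] [Algebra ℂ A] where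
  lgrade : H n → Submodule ℂ A
  lmom : M n →ₐ[ℂ] A

/-- The data of an `𝔥`-algebra: the family `A_{αβ}` and the two moment maps into `A_{00}`.
The laws are in `IsHAlgebra`. -/
class HPre (n : ℕ) (A : Type) [Ring A] [Algebra ℂ A] where
  grade : H n → H n → Submodule ℂ A
  ml : M n →ₐ[ℂ] A
  mr : M n →ₐ[ℂ] A
  ml_mem : ∀ f, ml f ∈ grade 0 0
  mr_mem : ∀ f, mr f ∈ grade 0 0

open HPre

instance HPre.toRightGraded (n : ℕ) (A : Type) [Ring A] [Algebra ℂ A] [HPre n A] :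
    RightGraded n A where
  rgrade γ := ⨆ α : H n, grade α γ
  rmom := mr

instance HPre.toLeftGraded (n : ℕ) (A : Type) [Ring A] [Algebra ℂ A] [HPre n A] :
    LeftGraded n A where
  lgrade γ := ⨆ β : H n, grade γ β
  lmom := ml

open RightGraded LeftGraded

theorem mem_rgrade {n : ℕ} {A : Type} [Ring A] [Algebra ℂ A] [HPre n A] {α γ : H n} {a : A}
    (ha : a ∈ grade α γ) : a ∈ rgrade (A := A) γ :=
  Submodule.mem_iSup_of_mem α ha

theorem mem_lgrade {n : ℕ} {A : Type} [Ring A] [Algebra ℂ A] [HPre n A] {γ β : H n} {a : A}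
    (ha : a ∈ grade γ β) : a ∈ lgrade (A := A) γ :=
  Submodule.mem_iSup_of_mem (p := fun β : H n => grade γ β) β ha

open Classical in
/-- The laws of an `𝔥`-algebra: `A` is bigraded over `𝔥*`, the moment maps are embeddings, and
`μ_l(f) a = a μ_l(T_α f)`, `μ_r(f) a = a μ_r(T_β f)` for `a ∈ A_{αβ}`. -/
structure IsHAlgebra (n : ℕ) (A : Type) [Ring A] [Algebra ℂ A] [HPre n A] : Prop where
  internal : DirectSum.IsInternal (fun p : H n × H n => (grade p.1 p.2 : Submodule ℂ A))
  mul_mem : ∀ (α β γ δ : H n) (a b : A),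
    a ∈ grade α β → b ∈ grade γ δ → a * b ∈ grade (α + γ) (β + δ)
  ml_injective : Function.Injective (ml : M n →ₐ[ℂ] A)
  mr_injective : Function.Injective (mr : M n →ₐ[ℂ] A)
  ml_mul : ∀ (α β : H n) (f : M n) (a : A), a ∈ grade α β → ml f * a = a * ml (T α f)
  mr_mul : ∀ (α β : H n) (f : M n) (a : A), a ∈ grade α β → mr f * a = a * mr (T β f)

/-- Morphisms of `𝔥`-algebras. -/
structure HHom (n : ℕ) (A B : Type) [Ring A] [Algebra ℂ A] [HPre n A]
    [Ring B] [Algebra ℂ B] [HPre n B] extends A →ₐ[ℂ] B where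
  map_grade : ∀ (α β : H n) (a : A), a ∈ grade α β → toFun a ∈ grade α β
  map_ml : ∀ f : M n, toFun (ml f) = ml f
  map_mr : ∀ f : M n, toFun (mr f) = mr f

/-- The identity morphism. -/
def HHom.id (n : ℕ) (A : Type) [Ring A] [Algebra ℂ A] [HPre n A] : HHom n A A where
  toAlgHom := AlgHom.id ℂ A
  map_grade _ _ _ h := h
  map_ml _ := rfl
  map_mr _ := rfl

section Tensor

variable (n : ℕ) (A B : Type) [Ring A] [Algebra ℂ A] [Ring B] [Algebra ℂ B]

/-- The subalgebra `⊕_γ A_{·γ} ⊗_ℂ B_{γ·}` of `A ⊗_ℂ B`. -/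
def matchSub [RightGraded n A] [LeftGraded n B] : Subalgebra ℂ (A ⊗[ℂ] B) :=
  Algebra.adjoin ℂ {x | ∃ (γ : H n) (a : A) (b : B), a ∈ rgrade γ ∧ b ∈ lgrade γ ∧ x = a ⊗ₜ b}

/-- The relations `μ_r(f) a ⊗ b = a ⊗ μ_l(f) b`, for matching homogeneous `a`, `b`. -/
def MRel [RightGraded n A] [LeftGraded n B] (x y : matchSub n A B) : Prop :=
  ∃ (f : M n) (γ : H n) (a : A) (b : B), a ∈ rgrade γ ∧ b ∈ lgrade γ ∧
    (x : A ⊗[ℂ] B) = (rmom f * a) ⊗ₜ b ∧ (y : A ⊗[ℂ] B) = a ⊗ₜ (lmom f * b)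

/-- The matrix tensor product `A ⊗̃ B = ⊕_γ A_{·γ} ⊗_{M_{𝔥*}} B_{γ·}`, with the multiplication
`(a ⊗ b)(c ⊗ d) = ac ⊗ bd`. -/
def MTensor [RightGraded n A] [LeftGraded n B] : Type := RingQuot (MRel n A B)

instance [RightGraded n A] [LeftGraded n B] : Ring (MTensor n A B) :=
  inferInstanceAs (Ring (RingQuot (MRel n A B)))

instance [RightGraded n A] [LeftGraded n B] : Algebra ℂ (MTensor n A B) :=
  inferInstanceAs (Algebra ℂ (RingQuot (MRel n A B)))

/-- The projection `⊕_γ A_{·γ} ⊗_ℂ B_{γ·} → A ⊗̃ B`. -/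
def mkT [RightGraded n A] [LeftGraded n B] : matchSub n A B →ₐ[ℂ] MTensor n A B :=
  RingQuot.mkAlgHom ℂ (MRel n A B)

variable {n A B}

theorem tmul_mem [RightGraded n A] [LeftGraded n B] {γ : H n} {a : A} {b : B}
    (ha : a ∈ rgrade γ) (hb : b ∈ lgrade γ) : a ⊗ₜ[ℂ] b ∈ matchSub n A B :=
  Algebra.subset_adjoin ⟨γ, a, b, ha, hb, rfl⟩

/-- The class of `a ⊗ b` in `A ⊗̃ B`, for `a ∈ A_{·γ}` and `b ∈ B_{γ·}`. -/
def tmul [RightGraded n A] [LeftGraded n B] {γ : H n} (a : A) (b : B)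
    (ha : a ∈ rgrade γ) (hb : b ∈ lgrade γ) : MTensor n A B :=
  mkT n A B ⟨a ⊗ₜ[ℂ] b, tmul_mem ha hb⟩

variable [HPre n A] [HPre n B]

theorem one_mem_grade : (1 : A) ∈ grade (0 : H n) 0 := by
  have := ml_mem (A := A) (1 : M n)
  rwa [map_one] at this

/-- `(A ⊗̃ B)_{αβ} = ⊕_γ A_{αγ} ⊗_{M_{𝔥*}} B_{γβ}`, with moment maps `μ_l(f) ⊗ 1` and
`1 ⊗ μ_r(f)`. -/
instance : HPre n (MTensor n A B) where
  grade α β := Submodule.span ℂ {x | ∃ (γ : H n) (a : A) (b : B) (ha : a ∈ grade α γ)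
    (hb : b ∈ grade γ β), x = tmul a b (mem_rgrade ha) (mem_lgrade hb)}
  ml := (mkT n A B).comp (AlgHom.codRestrict
    ((Algebra.TensorProduct.includeLeft : A →ₐ[ℂ] A ⊗[ℂ] B).comp ml) (matchSub n A B)
    fun f => tmul_mem (mem_rgrade (ml_mem f)) (mem_lgrade one_mem_grade))
  mr := (mkT n A B).comp (AlgHom.codRestrict
    ((Algebra.TensorProduct.includeRight : B →ₐ[ℂ] A ⊗[ℂ] B).comp mr) (matchSub n A B)
    fun f => tmul_mem (mem_rgrade one_mem_grade) (mem_lgrade (mr_mem f)))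
  ml_mem f := Submodule.subset_span ⟨0, ml f, 1, ml_mem f, one_mem_grade, rfl⟩
  mr_mem f := Submodule.subset_span ⟨0, 1, mr f, one_mem_grade, mr_mem f, rfl⟩

end Tensor

section Map

variable {n : ℕ} {A A' B B' : Type} [Ring A] [Algebra ℂ A] [HPre n A]
  [Ring A'] [Algebra ℂ A'] [HPre n A'] [Ring B] [Algebra ℂ B] [HPre n B]
  [Ring B'] [Algebra ℂ B'] [HPre n B']

theorem HHom.map_rgrade (f : HHom n A A') {γ : H n} {a : A} (ha : a ∈ rgrade γ) :
    f.toAlgHom a ∈ rgrade (A := A') γ := by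
  have h : (⨆ α : H n, (grade α γ : Submodule ℂ A)) ≤
      (rgrade (A := A') γ).comap f.toAlgHom.toLinearMap :=
    iSup_le fun α x hx => mem_rgrade (f.map_grade α γ x hx)
  exact h ha

theorem HHom.map_lgrade (f : HHom n A A') {γ : H n} {a : A} (ha : a ∈ lgrade γ) :
    f.toAlgHom a ∈ lgrade (A := A') γ := by
  have h : (⨆ β : H n, (grade γ β : Submodule ℂ A)) ≤
      (lgrade (A := A') γ).comap f.toAlgHom.toLinearMap :=
    iSup_le fun β x hx => mem_lgrade (f.map_grade γ β x hx)
  exact h ha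

theorem map_matchSub (f : HHom n A A') (g : HHom n B B') (x : matchSub n A B) :
    Algebra.TensorProduct.map f.toAlgHom g.toAlgHom (x : A ⊗[ℂ] B) ∈ matchSub n A' B' := by
  have h : matchSub n A B ≤ (matchSub n A' B').comap
      (Algebra.TensorProduct.map f.toAlgHom g.toAlgHom) := by
    refine Algebra.adjoin_le ?_
    rintro _ ⟨γ, a, b, ha, hb, rfl⟩
    exact tmul_mem (f.map_rgrade ha) (g.map_lgrade hb)
  exact h x.2

/-- `f ⊗ g` on `⊕_γ A_{·γ} ⊗_ℂ B_{γ·}`. -/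
def mapMatch (f : HHom n A A') (g : HHom n B B') : matchSub n A B →ₐ[ℂ] matchSub n A' B' :=
  AlgHom.codRestrict ((Algebra.TensorProduct.map f.toAlgHom g.toAlgHom).comp
    (matchSub n A B).val) (matchSub n A' B') (map_matchSub f g)

/-- `f ⊗ g : A ⊗̃ B → A' ⊗̃ B'` for morphisms of `𝔥`-algebras. -/
def tmap (f : HHom n A A') (g : HHom n B B') : MTensor n A B →ₐ[ℂ] MTensor n A' B' :=
  RingQuot.liftAlgHom ℂ ⟨(mkT n A' B').comp (mapMatch f g), by
    rintro ⟨x, hx⟩ ⟨y, hy⟩ ⟨c, γ, a, b, ha, hb, rfl, rfl⟩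
    refine RingQuot.mkAlgHom_rel ℂ
      ⟨c, γ, f.toAlgHom a, g.toAlgHom b, f.map_rgrade ha, g.map_lgrade hb, ?_, ?_⟩
    · have h : f.toAlgHom (mr c) = mr c := f.map_mr c
      change (f.toAlgHom (mr c * a)) ⊗ₜ[ℂ] (g.toAlgHom b) = (mr c * f.toAlgHom a) ⊗ₜ _
      rw [map_mul, h]
    · have h : g.toAlgHom (ml c) = ml c := g.map_ml c
      change (f.toAlgHom a) ⊗ₜ[ℂ] (g.toAlgHom (ml c * b)) = _ ⊗ₜ (ml c * g.toAlgHom b)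
      rw [map_mul, h]⟩

theorem tmap_tmul (f : HHom n A A') (g : HHom n B B') {γ : H n} (a : A) (b : B)
    (ha : a ∈ rgrade γ) (hb : b ∈ lgrade γ) :
    tmap f g (tmul a b ha hb) =
      tmul (f.toAlgHom a) (g.toAlgHom b) (f.map_rgrade ha) (g.map_lgrade hb) :=
  RingQuot.liftAlgHom_mkAlgHom_apply ..

end Map

section Assoc

variable (n : ℕ) (A B C : Type) [Ring A] [Algebra ℂ A] [HPre n A]
  [Ring B] [Algebra ℂ B] [HPre n B] [Ring C] [Algebra ℂ C] [HPre n C]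

variable {n A B C} in
theorem tmul_mem_grade {α γ β : H n} {a : A} {b : B} (ha : a ∈ grade α γ) (hb : b ∈ grade γ β) :
    tmul a b (mem_rgrade ha) (mem_lgrade hb) ∈ (grade α β : Submodule ℂ (MTensor n A B)) :=
  Submodule.subset_span ⟨γ, a, b, ha, hb, rfl⟩

/-- The graph of the canonical identification `(A ⊗̃ B) ⊗̃ C ≅ A ⊗̃ (B ⊗̃ C)`,
`(a ⊗ b) ⊗ c ↔ a ⊗ (b ⊗ c)`. -/
def assocGraph : Submodule ℂ (MTensor n (MTensor n A B) C × MTensor n A (MTensor n B C)) :=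
  Submodule.span ℂ {p | ∃ (α γ δ β : H n) (a : A) (b : B) (c : C) (ha : a ∈ grade α γ)
    (hb : b ∈ grade γ δ) (hc : c ∈ grade δ β),
    p = (tmul (tmul a b (mem_rgrade ha) (mem_lgrade hb)) c
          (mem_rgrade (tmul_mem_grade ha hb)) (mem_lgrade hc),
        tmul a (tmul b c (mem_rgrade hb) (mem_lgrade hc))
          (mem_rgrade ha) (mem_lgrade (tmul_mem_grade hb hc)))}

end Assoc

/-! The algebra of difference operators. -/

/-- The difference operator `f T_α` on `M_{𝔥*}`. -/
def dop {n : ℕ} (f : M n) (α : H n) : Module.End ℂ (M n) :=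
  LinearMap.mulLeft ℂ f ∘ₗ (T α).toLinearMap

/-- The algebra `D_{𝔥*}` of difference operators `∑ f_i T_{β_i}` on `M_{𝔥*}`, as a subalgebra of
the endomorphisms of `M_{𝔥*}`. -/
def DhSub (n : ℕ) : Subalgebra ℂ (Module.End ℂ (M n)) :=
  Algebra.adjoin ℂ {x | ∃ (f : M n) (α : H n), x = dop f α}

/-- The algebra `D_{𝔥*}` of difference operators. -/
def Dh (n : ℕ) : Type := DhSub n

instance (n : ℕ) : Ring (Dh n) := inferInstanceAs (Ring (DhSub n))

instance (n : ℕ) : Algebra ℂ (Dh n) := inferInstanceAs (Algebra ℂ (DhSub n))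

/-- The action of difference operators on `M_{𝔥*}`. -/
def Dh.toEnd (n : ℕ) : Dh n →ₐ[ℂ] Module.End ℂ (M n) := (DhSub n).val

/-- `f T_α` as an element of `D_{𝔥*}`. -/
def dOp {n : ℕ} (f : M n) (α : H n) : Dh n :=
  (⟨dop f α, Algebra.subset_adjoin ⟨f, α, rfl⟩⟩ : DhSub n)

theorem T_zero {n : ℕ} (f : M n) : T 0 f = f := by
  obtain ⟨f, rfl⟩ := Ideal.Quotient.mk_surjective f
  change Ideal.Quotient.mk (nullIdeal n) (shiftFun 0 f) = _
  congr 1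
  ext z
  change (f : H n → ℂ) (z + 0) = _
  rw [add_zero]

/-- The natural embedding `M_{𝔥*} → D_{𝔥*}` by multiplication operators. -/
def dMul (n : ℕ) : M n →ₐ[ℂ] Dh n :=
  AlgHom.codRestrict (Algebra.lmul ℂ (M n)) (DhSub n) fun f => by
    have : Algebra.lmul ℂ (M n) f = dop f 0 := by
      ext g
      simp [dop, T_zero]
    rw [this]
    exact Algebra.subset_adjoin ⟨f, 0, rfl⟩

theorem dMul_eq {n : ℕ} (f : M n) : dMul n f = dOp f (-0) := by
  refine Subtype.ext (LinearMap.ext fun g => ?_)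
  change f * g = f * T (-0) g
  rw [neg_zero, T_zero]

/-- `f T_{-β} ∈ (D_{𝔥*})_{ββ}`, and both moment maps are the natural embedding. -/
instance (n : ℕ) : HPre n (Dh n) where
  grade α β := Submodule.span ℂ {x | α = β ∧ ∃ f : M n, x = dOp f (-β)}
  ml := dMul n
  mr := dMul n
  ml_mem f := Submodule.subset_span ⟨rfl, f, dMul_eq f⟩
  mr_mem f := Submodule.subset_span ⟨rfl, f, dMul_eq f⟩

theorem dOp_mem {n : ℕ} (f : M n) (β : H n) :
    dOp f (-β) ∈ (grade β β : Submodule ℂ (Dh n)) :=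
  Submodule.subset_span ⟨rfl, f, rfl⟩

/-! `𝔥`-bialgebroids and `𝔥`-Hopf algebroids. -/

section Hopf

variable {n : ℕ} {A : Type} [Ring A] [Algebra ℂ A] [HPre n A]

/-- `A` is an `𝔥`-bialgebroid with comultiplication `Δ` and counit `ε`. The counit axioms use
`T_{-α} ⊗ x ≅ x ≅ x ⊗ T_{-β}` for `x ∈ A_{αβ}`. -/
structure IsHBialgebroid (Δ : HHom n A (MTensor n A A)) (ε : HHom n A (Dh n)) : Prop where
  isHAlgebra : IsHAlgebra n A
  coassoc : ∀ a : A, (tmap Δ (HHom.id n A) (Δ.toAlgHom a), tmap (HHom.id n A) Δ (Δ.toAlgHom a)) ∈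
    assocGraph n A A A
  counit_left : ∀ (α β : H n) (a : A) (ha : a ∈ grade α β),
    tmap ε (HHom.id n A) (Δ.toAlgHom a) =
      tmul (dOp 1 (-α)) a (mem_rgrade (dOp_mem 1 α)) (mem_lgrade ha)
  counit_right : ∀ (α β : H n) (a : A) (ha : a ∈ grade α β),
    tmap (HHom.id n A) ε (Δ.toAlgHom a) =
      tmul a (dOp 1 (-β)) (mem_rgrade ha) (mem_lgrade (dOp_mem 1 β))

/-- `ε(a)1`: the difference operator `ε(a)` applied to the constant function `1`. -/
def counitOne (ε : HHom n A (Dh n)) (a : A) : M n :=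
  Dh.toEnd n (ε.toAlgHom a) 1

/-- `S` is an antipode. The maps `m ∘ (id ⊗ S)` and `m ∘ (S ⊗ id)` on `A ⊗̃ A` are evaluated on
representatives in `⊕_γ A_{·γ} ⊗_ℂ A_{γ·}`; the identities are required for every
representative of `Δ(a)`, so that well-definedness is included. -/
structure IsAntipode (Δ : HHom n A (MTensor n A A)) (ε : HHom n A (Dh n)) (S : A →ₗ[ℂ] A) :
    Prop where
  map_mr_mul : ∀ (f : M n) (a : A), S (mr f * a) = S a * ml f
  map_mul_ml : ∀ (f : M n) (a : A), S (a * ml f) = mr f * S a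
  mul_id_S : ∀ (a : A) (x : matchSub n A A), mkT n A A x = Δ.toAlgHom a →
    LinearMap.mul' ℂ A (TensorProduct.map LinearMap.id S (x : A ⊗[ℂ] A)) = ml (counitOne ε a)
  mul_S_id : ∀ (α β : H n) (a : A), a ∈ grade α β →
    ∀ x : matchSub n A A, mkT n A A x = Δ.toAlgHom a →
    LinearMap.mul' ℂ A (TensorProduct.map S LinearMap.id (x : A ⊗[ℂ] A)) =
      mr (T α (counitOne ε a))

/-- `A` is an `𝔥`-Hopf algebroid with structure maps `Δ`, `ε`, `S`. -/
structure IsHHopfAlgebroid (Δ : HHom n A (MTensor n A A)) (ε : HHom n A (Dh n)) (S : A →ₗ[ℂ] A) :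
    Prop where
  isHBialgebroid : IsHBialgebroid Δ ε
  isAntipode : IsAntipode Δ ε S

end Hopf

/-! The `R`-matrix. -/

/-- The meromorphic (entire) function `q^{-2(λ_a - λ_b)}`, where `q^z = exp(z log q)`. -/
def qpow {n : ℕ} (q : ℂ) (a b : Fin n) : M n :=
  ofEntire (fun z : H n => Complex.exp (Complex.log q * (-2 * (z a - z b)))) (by
    intro z
    have h : ∀ i : Fin n, AnalyticAt ℂ (fun w : H n => w i) z := fun i =>
      (ContinuousLinearMap.proj (R := ℂ) (φ := fun _ : Fin n => ℂ) i).analyticAt z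
    exact (analyticAt_const.mul (analyticAt_const.mul ((h a).sub (h b)))).cexp)

/-- Constants as meromorphic functions. -/
def cst {n : ℕ} (c : ℂ) : M n := algebraMap ℂ (M n) c

/-- `h₀(λ_a - λ_b)`, where `h₀(λ) = (q⁻¹ - q) / (q^{-2λ} - 1)`. -/
def h0 {n : ℕ} (q : ℂ) (a b : Fin n) : M n := cst (q⁻¹ - q) / (qpow q a b - 1)

/-- `g(λ_a - λ_b)`, where `g(λ) = (q^{-2λ} - q⁻²)(q^{-2λ} - q²) / (q^{-2λ} - 1)²`. -/
def gfun {n : ℕ} (q : ℂ) (a b : Fin n) : M n :=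
  (qpow q a b - cst ((q ^ 2)⁻¹)) * (qpow q a b - cst (q ^ 2)) / (qpow q a b - 1) ^ 2

/-- `h(λ_a - λ_b)`, where `h(λ) = q (q^{-2λ} - q⁻²) / (q^{-2λ} - 1)`. -/
def hfun {n : ℕ} (q : ℂ) (a b : Fin n) : M n :=
  cst q * (qpow q a b - cst ((q ^ 2)⁻¹)) / (qpow q a b - 1)

/-- The matrix elements `R^{ab}_{xy}` of
`R = q ∑ E_aa ⊗ E_aa + ∑_{a<b} E_aa ⊗ E_bb + ∑_{a>b} g(λ_a - λ_b) E_aa ⊗ E_bb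
  + ∑_{a≠b} h₀(λ_a - λ_b) E_ba ⊗ E_ab`,
i.e. `R (v_a ⊗ v_b) = ∑ R^{ab}_{xy} v_x ⊗ v_y`. -/
def Rmat {n : ℕ} (q : ℂ) (a b x y : Fin n) : M n :=
  (if a = b ∧ x = a ∧ y = a then cst q else 0) +
  (if a < b ∧ x = a ∧ y = b then 1 else 0) +
  (if b < a ∧ x = a ∧ y = b then gfun q a b else 0) +
  (if a ≠ b ∧ x = b ∧ y = a then h0 q a b else 0)

/-- `ω(i) = e_i`. -/
def wt {n : ℕ} (i : Fin n) : H n := Pi.single i 1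

/-! Signs and dynamical quantum minor determinants. -/

/-- `sign(I₁;I₂) = ∏_{k ∈ I₁, m ∈ I₂, k > m} -h(λ_k - λ_m)` for disjoint `I₁`, `I₂`, else `0`. -/
def sgn {n : ℕ} (q : ℂ) (I J : Finset (Fin n)) : M n :=
  if Disjoint I J then ∏ k ∈ I, ∏ m ∈ J, if m < k then -hfun q k m else 1 else 0

/-- `S(σ,I) = ∏_{k<l, σ(k)>σ(l)} -h(λ_{i_{σ(k)}} - λ_{i_{σ(l)}})` for `I = {i_1 < ⋯ < i_r}`. -/
def gsign {n r : ℕ} (q : ℂ) (σ : Equiv.Perm (Fin r)) (i : Fin r → Fin n) : M n :=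
  ∏ k : Fin r, ∏ l : Fin r, if k < l ∧ σ l < σ k then -hfun q (i (σ k)) (i (σ l)) else 1

/-- The expression `ξ^I_J = ∑_σ μ_l(S(σ,I)) t_{i_σ(1) j_1} ⋯ t_{i_σ(r) j_r}`
(zero if `#I ≠ #J`) in an algebra with elements `t_{ij}` and a map `μ_l`. -/
def minorOf {n : ℕ} {A : Type} [Ring A] (q : ℂ) (l : M n → A) (t : Fin n → Fin n → A)
    (I J : Finset (Fin n)) : A :=
  if h : J.card = I.card then
    ∑ σ : Equiv.Perm (Fin I.card),
      l (gsign q σ (I.orderEmbOfFin rfl)) *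
        (List.ofFn fun k => t (I.orderEmbOfFin rfl (σ k)) (J.orderEmbOfFin h k)).prod
  else 0

/-- The span of the products of generators of total degree `δ`. -/
def wordSpan {G X A : Type} [AddMonoid G] [Ring A] [Algebra ℂ A] (gen : X → A) (deg : X → G)
    (δ : G) : Submodule ℂ A :=
  Submodule.span ℂ {x | ∃ w : List X, (w.map deg).sum = δ ∧ x = (w.map gen).prod}

theorem gen_mem_wordSpan {G X A : Type} [AddMonoid G] [Ring A] [Algebra ℂ A] (gen : X → A)
    (deg : X → G) (x : X) : gen x ∈ wordSpan gen deg (deg x) :=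
  Submodule.subset_span ⟨[x], by simp, by simp⟩

/-! The algebra `F_R(M(n))`. -/

/-- Generators of `F_R(M(n))`: two copies of `M_{𝔥*}` and the `t_{ij}`. -/
inductive Gen (n : ℕ) : Type
  | l : M n → Gen n
  | r : M n → Gen n
  | t : Fin n → Fin n → Gen n

/-- The bidegrees of the generators. -/
def Gen.deg {n : ℕ} : Gen n → H n × H n
  | .l _ => 0
  | .r _ => 0
  | .t i j => (wt i, wt j)

/-- The generators inside the free algebra. -/
abbrev fl {n : ℕ} (f : M n) : FreeAlgebra ℂ (Gen n) := FreeAlgebra.ι ℂ (Gen.l f)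
/-- The generators inside the free algebra. -/
abbrev fr {n : ℕ} (f : M n) : FreeAlgebra ℂ (Gen n) := FreeAlgebra.ι ℂ (Gen.r f)
/-- The generators inside the free algebra. -/
abbrev ft {n : ℕ} (i j : Fin n) : FreeAlgebra ℂ (Gen n) := FreeAlgebra.ι ℂ (Gen.t i j)

/-- The defining relations of `F_R(M(n))`: the generalized FRST construction for `R`. -/
inductive RelM (n : ℕ) (q : ℂ) : FreeAlgebra ℂ (Gen n) → FreeAlgebra ℂ (Gen n) → Prop
  | l_add (f g : M n) : RelM n q (fl (f + g)) (fl f + fl g)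
  | l_mul (f g : M n) : RelM n q (fl (f * g)) (fl f * fl g)
  | l_const (c : ℂ) : RelM n q (fl (algebraMap ℂ (M n) c)) (algebraMap ℂ _ c)
  | r_add (f g : M n) : RelM n q (fr (f + g)) (fr f + fr g)
  | r_mul (f g : M n) : RelM n q (fr (f * g)) (fr f * fr g)
  | r_const (c : ℂ) : RelM n q (fr (algebraMap ℂ (M n) c)) (algebraMap ℂ _ c)
  | lr_comm (f g : M n) : RelM n q (fl f * fr g) (fr g * fl f)
  | l_t (f : M n) (i j : Fin n) : RelM n q (fl f * ft i j) (ft i j * fl (T (wt i) f))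
  | r_t (f : M n) (i j : Fin n) : RelM n q (fr f * ft i j) (ft i j * fr (T (wt j) f))
  | rll (a b c d : Fin n) : RelM n q
      (∑ x, ∑ y, fl (Rmat q x y a c) * ft x b * ft y d)
      (∑ x, ∑ y, fr (Rmat q b d x y) * ft c y * ft a x)

/-- The dynamical analogue `F_R(M(n))` of the algebra of functions on `n × n` matrices. -/
def FM (n : ℕ) (q : ℂ) : Type := RingQuot (RelM n q)

instance (n : ℕ) (q : ℂ) : Ring (FM n q) := inferInstanceAs (Ring (RingQuot (RelM n q)))

instance (n : ℕ) (q : ℂ) : Algebra ℂ (FM n q) :=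
  inferInstanceAs (Algebra ℂ (RingQuot (RelM n q)))

/-- The projection from the free algebra. -/
def FM.mk (n : ℕ) (q : ℂ) : FreeAlgebra ℂ (Gen n) →ₐ[ℂ] FM n q :=
  RingQuot.mkAlgHom ℂ (RelM n q)

theorem FM.rel {n : ℕ} {q : ℂ} {x y : FreeAlgebra ℂ (Gen n)} (h : RelM n q x y) :
    FM.mk n q x = FM.mk n q y := RingQuot.mkAlgHom_rel ℂ h

/-- The generators in `F_R(M(n))`. -/
def FM.gen (n : ℕ) (q : ℂ) (x : Gen n) : FM n q := FM.mk n q (FreeAlgebra.ι ℂ x)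

/-- `μ_l(f) = f(λ)`. -/
def FM.ml (n : ℕ) (q : ℂ) : M n →ₐ[ℂ] FM n q where
  toFun f := FM.gen n q (.l f)
  map_one' := by simpa [FM.gen] using FM.rel (RelM.l_const (n := n) (q := q) 1)
  map_mul' f g := by simpa [FM.gen] using FM.rel (RelM.l_mul (n := n) (q := q) f g)
  map_zero' := by simpa [FM.gen] using FM.rel (RelM.l_const (n := n) (q := q) 0)
  map_add' f g := by simpa [FM.gen] using FM.rel (RelM.l_add (n := n) (q := q) f g)
  commutes' c := by simpa [FM.gen] using FM.rel (RelM.l_const (n := n) (q := q) c)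

/-- `μ_r(f) = f(μ)`. -/
def FM.mr (n : ℕ) (q : ℂ) : M n →ₐ[ℂ] FM n q where
  toFun f := FM.gen n q (.r f)
  map_one' := by simpa [FM.gen] using FM.rel (RelM.r_const (n := n) (q := q) 1)
  map_mul' f g := by simpa [FM.gen] using FM.rel (RelM.r_mul (n := n) (q := q) f g)
  map_zero' := by simpa [FM.gen] using FM.rel (RelM.r_const (n := n) (q := q) 0)
  map_add' f g := by simpa [FM.gen] using FM.rel (RelM.r_add (n := n) (q := q) f g)
  commutes' c := by simpa [FM.gen] using FM.rel (RelM.r_const (n := n) (q := q) c)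

/-- The generator `t_{ij}`. -/
def FM.t {n : ℕ} (q : ℂ) (i j : Fin n) : FM n q := FM.gen n q (.t i j)

instance (n : ℕ) (q : ℂ) : HPre n (FM n q) where
  grade α β := wordSpan (FM.gen n q) Gen.deg (α, β)
  ml := FM.ml n q
  mr := FM.mr n q
  ml_mem f := gen_mem_wordSpan (FM.gen n q) Gen.deg (.l f)
  mr_mem f := gen_mem_wordSpan (FM.gen n q) Gen.deg (.r f)

theorem FM.t_mem {n : ℕ} (q : ℂ) (i j : Fin n) : FM.t q i j ∈ grade (wt i) (wt j) :=
  gen_mem_wordSpan (FM.gen n q) Gen.deg (.t i j)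

/-- The dynamical quantum minor determinant `ξ^I_J`. -/
def FM.minor {n : ℕ} (q : ℂ) (I J : Finset (Fin n)) : FM n q :=
  minorOf q (FM.ml n q) (FM.t q) I J

/-! The exterior algebra `W` and its corepresentation. -/

/-- Generators of `W`. -/
inductive GenW (n : ℕ) : Type
  | f : M n → GenW n
  | w : Fin n → GenW n

/-- The degrees of the generators. -/
def GenW.deg {n : ℕ} : GenW n → H n
  | .f _ => 0
  | .w i => wt i

/-- The generators inside the free algebra. -/
abbrev wf {n : ℕ} (f : M n) : FreeAlgebra ℂ (GenW n) := FreeAlgebra.ι ℂ (GenW.f f)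
/-- The generators inside the free algebra. -/
abbrev ww {n : ℕ} (i : Fin n) : FreeAlgebra ℂ (GenW n) := FreeAlgebra.ι ℂ (GenW.w i)

/-- The defining relations of `W`. -/
inductive RelW (n : ℕ) (q : ℂ) : FreeAlgebra ℂ (GenW n) → FreeAlgebra ℂ (GenW n) → Prop
  | f_add (f g : M n) : RelW n q (wf (f + g)) (wf f + wf g)
  | f_mul (f g : M n) : RelW n q (wf (f * g)) (wf f * wf g)
  | f_const (c : ℂ) : RelW n q (wf (algebraMap ℂ (M n) c)) (algebraMap ℂ _ c)
  | f_w (f : M n) (i : Fin n) : RelW n q (wf f * ww i) (ww i * wf (T (wt i) f))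
  | sq (i : Fin n) : RelW n q (ww i * ww i) 0
  | anti (i j : Fin n) (h : i < j) : RelW n q (ww j * ww i) (wf (-hfun q j i) * ww i * ww j)

/-- The dynamical exterior algebra `W`. -/
def W (n : ℕ) (q : ℂ) : Type := RingQuot (RelW n q)

instance (n : ℕ) (q : ℂ) : Ring (W n q) := inferInstanceAs (Ring (RingQuot (RelW n q)))

instance (n : ℕ) (q : ℂ) : Algebra ℂ (W n q) :=
  inferInstanceAs (Algebra ℂ (RingQuot (RelW n q)))

/-- The projection from the free algebra. -/
def W.mk (n : ℕ) (q : ℂ) : FreeAlgebra ℂ (GenW n) →ₐ[ℂ] W n q :=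
  RingQuot.mkAlgHom ℂ (RelW n q)

theorem W.rel {n : ℕ} {q : ℂ} {x y : FreeAlgebra ℂ (GenW n)} (h : RelW n q x y) :
    W.mk n q x = W.mk n q y := RingQuot.mkAlgHom_rel ℂ h

/-- The generators in `W`. -/
def W.gen (n : ℕ) (q : ℂ) (x : GenW n) : W n q := W.mk n q (FreeAlgebra.ι ℂ x)

/-- `μ_W(f) = f(λ)`. -/
def W.mom (n : ℕ) (q : ℂ) : M n →ₐ[ℂ] W n q where
  toFun f := W.gen n q (.f f)
  map_one' := by simpa [W.gen] using W.rel (RelW.f_const (n := n) (q := q) 1)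
  map_mul' f g := by simpa [W.gen] using W.rel (RelW.f_mul (n := n) (q := q) f g)
  map_zero' := by simpa [W.gen] using W.rel (RelW.f_const (n := n) (q := q) 0)
  map_add' f g := by simpa [W.gen] using W.rel (RelW.f_add (n := n) (q := q) f g)
  commutes' c := by simpa [W.gen] using W.rel (RelW.f_const (n := n) (q := q) c)

instance (n : ℕ) (q : ℂ) : RightGraded n (W n q) where
  rgrade := wordSpan (W.gen n q) GenW.deg
  rmom := W.mom n q

/-- The generator `w_i`. -/
def W.w {n : ℕ} (q : ℂ) (i : Fin n) : W n q := W.gen n q (.w i)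

theorem W.w_mem {n : ℕ} (q : ℂ) (i : Fin n) : W.w q i ∈ rgrade (A := W n q) (wt i) :=
  gen_mem_wordSpan (W.gen n q) GenW.deg (.w i)

/-- `w_I = w_{i_1} ⋯ w_{i_r}` for `I = {i_1 < ⋯ < i_r}`. -/
def W.wI {n : ℕ} (q : ℂ) (I : Finset (Fin n)) : W n q :=
  ((I.sort (· ≤ ·)).map (W.w q)).prod

/-- `R(w_i) = ∑_j w_j ⊗ t_{ji}` in `W ⊗̃ F_R(M(n))`. -/
def corepW {n : ℕ} (q : ℂ) (i : Fin n) : MTensor n (W n q) (FM n q) :=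
  ∑ j, tmul (W.w q j) (FM.t q j i) (W.w_mem q j) (mem_lgrade (FM.t_mem q j i))

/-- `R(w_J) = R(w_{j_1}) ⋯ R(w_{j_r})` for `J = {j_1 < ⋯ < j_r}`. -/
def corepWJ {n : ℕ} (q : ℂ) (J : Finset (Fin n)) : MTensor n (W n q) (FM n q) :=
  ((J.sort (· ≤ ·)).map (corepW q)).prod

/-- The `ξ^I_J` are the matrix elements of the corepresentation on `W`:
`R(w_J) = ∑_{#I = #J} w_I ⊗ ξ^I_J`, with `ξ^I_J = 0` if `#I ≠ #J`. -/
def IsMatrixElements {n : ℕ} (q : ℂ) (ξ : Finset (Fin n) → Finset (Fin n) → FM n q) : Prop :=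
  (∀ I J, I.card ≠ J.card → ξ I J = 0) ∧
  ∃ (hw : ∀ I, W.wI q I ∈ rgrade (A := W n q) (∑ i ∈ I, wt i))
    (hξ : ∀ I J, ξ I J ∈ grade (∑ i ∈ I, wt i) (∑ j ∈ J, wt j)),
    ∀ J, corepWJ q J = ∑ I with I.card = J.card, tmul (W.wI q I) (ξ I J) (hw I) (mem_lgrade (hξ I J))

/-! The algebra `F_R(GL(n))`: the formal inverse of the determinant is adjoined. -/

/-- The inclusion of the free algebra on the generators of `F_R(M(n))` into the free algebra with
one more generator `det⁻¹`. -/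
def emb (n : ℕ) : FreeAlgebra ℂ (Gen n) →ₐ[ℂ] FreeAlgebra ℂ (Gen n ⊕ Unit) :=
  FreeAlgebra.lift ℂ fun x => FreeAlgebra.ι ℂ (Sum.inl x)

/-- The free generator `det⁻¹`. -/
def fdinv (n : ℕ) : FreeAlgebra ℂ (Gen n ⊕ Unit) := FreeAlgebra.ι ℂ (Sum.inr ())

/-- The determinant `ξ^{{1,…,n}}_{{1,…,n}}` written in the free generators. -/
def fdet (n : ℕ) (q : ℂ) : FreeAlgebra ℂ (Gen n ⊕ Unit) :=
  emb n (minorOf q fl ft Finset.univ Finset.univ)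

/-- The defining relations of `F_R(GL(n))`. -/
inductive RelGL (n : ℕ) (q : ℂ) :
    FreeAlgebra ℂ (Gen n ⊕ Unit) → FreeAlgebra ℂ (Gen n ⊕ Unit) → Prop
  | ofM (x y : FreeAlgebra ℂ (Gen n)) : RelM n q x y → RelGL n q (emb n x) (emb n y)
  | det_mul : RelGL n q (fdet n q * fdinv n) 1
  | mul_det : RelGL n q (fdinv n * fdet n q) 1
  | t_comm (i j : Fin n) : RelGL n q (emb n (ft i j) * fdinv n) (fdinv n * emb n (ft i j))
  | l_comm (f : M n) :
      RelGL n q (emb n (fl f) * fdinv n) (fdinv n * emb n (fl (T (-1) f)))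
  | r_comm (f : M n) :
      RelGL n q (emb n (fr f) * fdinv n) (fdinv n * emb n (fr (T (-1) f)))

/-- The dynamical `GL(n)` quantum group `F_R(GL(n))`. -/
def FGL (n : ℕ) (q : ℂ) : Type := RingQuot (RelGL n q)

instance (n : ℕ) (q : ℂ) : Ring (FGL n q) := inferInstanceAs (Ring (RingQuot (RelGL n q)))

instance (n : ℕ) (q : ℂ) : Algebra ℂ (FGL n q) :=
  inferInstanceAs (Algebra ℂ (RingQuot (RelGL n q)))

/-- The projection from the free algebra. -/
def FGL.mk (n : ℕ) (q : ℂ) : FreeAlgebra ℂ (Gen n ⊕ Unit) →ₐ[ℂ] FGL n q :=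
  RingQuot.mkAlgHom ℂ (RelGL n q)

/-- The canonical homomorphism `F_R(M(n)) → F_R(GL(n))`. -/
def FGL.ofM (n : ℕ) (q : ℂ) : FM n q →ₐ[ℂ] FGL n q :=
  RingQuot.liftAlgHom ℂ ⟨(FGL.mk n q).comp (emb n), fun _ _ h =>
    RingQuot.mkAlgHom_rel ℂ (RelGL.ofM _ _ h)⟩

/-- The generators of `F_R(GL(n))`. -/
def FGL.gen (n : ℕ) (q : ℂ) : Gen n ⊕ Unit → FGL n q
  | .inl x => FGL.ofM n q (FM.gen n q x)
  | .inr _ => FGL.mk n q (fdinv n)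

/-- The bidegrees of the generators; `det⁻¹` has bidegree `(-1, -1)` with `1 = (1,…,1)`. -/
def FGL.deg (n : ℕ) : Gen n ⊕ Unit → H n × H n
  | .inl x => x.deg
  | .inr _ => (-1, -1)

instance (n : ℕ) (q : ℂ) : HPre n (FGL n q) where
  grade α β := wordSpan (FGL.gen n q) (FGL.deg n) (α, β)
  ml := (FGL.ofM n q).comp ml
  mr := (FGL.ofM n q).comp mr
  ml_mem f := gen_mem_wordSpan (FGL.gen n q) (FGL.deg n) (.inl (.l f))
  mr_mem f := gen_mem_wordSpan (FGL.gen n q) (FGL.deg n) (.inl (.r f))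

/-- The generator `t_{ij}` of `F_R(GL(n))`. -/
def FGL.t {n : ℕ} (q : ℂ) (i j : Fin n) : FGL n q := FGL.ofM n q (FM.t q i j)

/-- The generator `det⁻¹` of `F_R(GL(n))`. -/
def FGL.detInv (n : ℕ) (q : ℂ) : FGL n q := FGL.mk n q (fdinv n)

/-- The quantum minor determinant `ξ^I_J` in `F_R(GL(n))`. -/
def FGL.minor {n : ℕ} (q : ℂ) (I J : Finset (Fin n)) : FGL n q := FGL.ofM n q (FM.minor q I J)

/-- The determinant in `F_R(GL(n))`. -/
def FGL.det (n : ℕ) (q : ℂ) : FGL n q := FGL.minor q Finset.univ Finset.univ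

theorem FGL.t_mem {n : ℕ} (q : ℂ) (i j : Fin n) : FGL.t q i j ∈ grade (wt i) (wt j) :=
  gen_mem_wordSpan (FGL.gen n q) (FGL.deg n) (.inl (.t i j))

theorem FGL.detInv_mem (n : ℕ) (q : ℂ) : FGL.detInv n q ∈ grade (-1 : H n) (-1) :=
  gen_mem_wordSpan (FGL.gen n q) (FGL.deg n) (.inr ())

end DynGL

end

open scoped TensorProduct

noncomputable section

namespace DynGL

open HPre RightGraded LeftGraded

/-! Meromorphic functions: translations and the functions `h`, `h₀`, `g`. -/

/-! Everything rests on the minors being alternating in their columns and, dually, in their rows.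

Since `h₀ = q - h` and `g(λ) = h(λ) h(-λ)`, the `RLL` relations can be written with `h` and
constants alone. They contain a system of quadratic relations exchanging two columns
(`IsRLL.isDynMatrix`), and the same system for the transposed matrix, with the order of the indices
reversed and `μ_l`, `μ_r` interchanged (`IsRLL.isDynMatrix_dual`). A minor is taken with a set of
rows and a word of columns and is defined by expansion along the first column (`colMinor`). By the
first system an exchange of adjacent letters costs a scalar acting through `μ_r`, and a repeated
letter gives zero (`IsDynMatrix.isAlternating`). The words in the `w_i` behave in the same way, so
multiplying out `R(w_J)` produces the minors (`prod_corepW`), which is part (a).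

For `Δ`, the matrix `∑_k t_{ik} ⊗ t_{kj}` again satisfies `RLL` (`IsRLL.matComul`), and alternation
in columns gives a Cauchy–Binet formula (`colMinor_matComul`), so that `det` is group-like and `Δ`
extends to `det⁻¹`. The counit comes from the diagonal solution `δ_{ij} T_{-ω(i)}`. The bigrading,
defined by spans of words, is direct because it is the weight decomposition for a coaction of a
group algebra (`FGL.exists_coaction`).

For `S`, the proposed values form the inverse of the matrix `(t_{ij})`. On one side this is
expansion along the last column. On the other side it is expansion along a row, so column minors and
row minors must agree (`colMinor_eq_rowMinor`). A double sum over rows and columns, evaluated in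
both orders, shows that they agree up to a common constant. A Lagrange interpolation identity
identifies this constant as a `q`-number up to sign, which does not vanish because `q^{2k} ≠ 1`. The
signs of the two expansions match through `h(λ+1) h(-λ) = 1`. The inverse matrix satisfies the
reversed `RLL` relations (`IsRLL.sum_inverse`), and its determinant is `det⁻¹`
(`FGL.minorInv_univ`), so `S` exists as a homomorphism into the opposite algebra.

The maps `m(id ⊗ S)` and `m(S ⊗ id)` are not multiplicative. They are therefore replaced by the
actions `c ↦ a c S(b)` and `c ↦ S(a) c b` of `a ⊗ b`, which are. Restricted to elements `c` of
right, respectively left, degree zero, these actions respect the relations of `⊗̃`. On the image of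
a moment map they reproduce the counit, which can be checked on generators; evaluation at `1` gives
the antipode axioms. -/

theorem T_T {n : ℕ} (α β : H n) (f : M n) : T α (T β f) = T (α + β) f := by
  obtain ⟨f, rfl⟩ := Ideal.Quotient.mk_surjective f
  change Ideal.Quotient.mk (nullIdeal n) (shiftFun α (shiftFun β f)) =
    Ideal.Quotient.mk (nullIdeal n) (shiftFun (α + β) f)
  congr 1
  refine Subtype.ext (funext fun z => ?_)
  change (f : H n → ℂ) (z + α + β) = (f : H n → ℂ) (z + (α + β))
  rw [add_assoc]

@[simp] theorem T_neg_T {n : ℕ} (α : H n) (f : M n) : T (-α) (T α f) = f := by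
  rw [T_T, neg_add_cancel, T_zero]

@[simp] theorem T_T_neg {n : ℕ} (α : H n) (f : M n) : T α (T (-α) f) = f := by
  rw [T_T, add_neg_cancel, T_zero]

@[simp] theorem T_cst {n : ℕ} (α : H n) (c : ℂ) : T α (cst c : M n) = cst c :=
  (T α).commutes c

theorem ofEntire_mul {n : ℕ} {f g k : H n → ℂ} {hf hg hk} (h : ∀ z, f z * g z = k z) :
    (ofEntire f hf : M n) * ofEntire g hg = ofEntire k hk := by
  have : k = f * g := funext fun z => (h z).symm
  subst this
  exact (map_mul (toM n) _ _).symm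

theorem ofEntire_const {n : ℕ} {f : H n → ℂ} {hf} {c : ℂ} (h : ∀ z, f z = c) :
    (ofEntire f hf : M n) = cst c := by
  have : f = fun _ => c := funext h
  subst this
  exact (toM n).commutes c

/-- Equality in `M` holds only on a dense set, but the coincidence set of continuous functions is
closed. This allows an identity between classes to be tested at points. -/
theorem eq_const_of_ofEntire {n : ℕ} {f : H n → ℂ} {hf} {c : ℂ}
    (h : (ofEntire f hf : M n) = cst c) (z : H n) : f z = c := by
  have h1 : toM n (⟨f, fun z => ⟨f, fun _ => 1, hf z, analyticAt_const,
      one_not_eventually_zero z, by simp⟩⟩ - algebraMap ℂ _ c) = 0 := by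
    rw [map_sub, sub_eq_zero]
    exact h.trans ((toM n).commutes c).symm
  have h2 := Ideal.Quotient.eq_zero_iff_mem.1 h1
  have h3 : Dense (interior {z | f z - c = 0}) := h2
  have h4 : IsClosed {z | f z - c = 0} := by
    refine isClosed_eq ?_ continuous_const
    exact (continuous_iff_continuousAt.2 fun z => (hf z).continuousAt).sub continuous_const
  have h5 := (h3.mono interior_subset).closure_eq
  rw [h4.closure_eq] at h5
  have : z ∈ {z | f z - c = 0} := h5 ▸ Set.mem_univ z
  exact sub_eq_zero.1 this

/-- The meromorphic function `q^{-2λ_a}`. -/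
def qexp {n : ℕ} (q : ℂ) (a : Fin n) : M n :=
  ofEntire (fun z : H n => Complex.exp (Complex.log q * (-2 * z a))) (by
    intro z
    have h : AnalyticAt ℂ (fun w : H n => w a) z :=
      (ContinuousLinearMap.proj (R := ℂ) (φ := fun _ : Fin n => ℂ) a).analyticAt z
    exact (analyticAt_const.mul (analyticAt_const.mul h)).cexp)

theorem qpow_mul_qexp {n : ℕ} (q : ℂ) (a b : Fin n) : qpow q a b * qexp q b = qexp q a :=
  ofEntire_mul fun z => by rw [← Complex.exp_add]; ring_nf

theorem qexp_ne_zero {n : ℕ} (q : ℂ) (a : Fin n) : qexp q a ≠ 0 := by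
  intro h
  have h' : qexp q a = cst (n := n) 0 := by rw [h]; exact (map_zero _).symm
  exact Complex.exp_ne_zero _ (eq_const_of_ofEntire h' 0)

theorem qpow_mul_qpow {n : ℕ} (q : ℂ) (a b : Fin n) : qpow q a b * qpow q b a = 1 := by
  have := qpow_mul_qexp q b a
  have h2 := qpow_mul_qexp q a b
  rw [← this, ← mul_assoc] at h2
  exact mul_right_cancel₀ (qexp_ne_zero q a) (h2.trans (one_mul _).symm)

theorem T_qpow {n : ℕ} (q : ℂ) (α : H n) (a b : Fin n) :
    T α (qpow q a b) = qpow q a b * cst (Complex.exp (Complex.log q * (-2 * (α a - α b)))) := by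
  have h : (cst (Complex.exp (Complex.log q * (-2 * (α a - α b)))) : M n) =
    ofEntire (fun _ => Complex.exp (Complex.log q * (-2 * (α a - α b))))
      (fun _ => analyticAt_const) := (ofEntire_const fun _ => rfl).symm
  rw [h]
  have hh : ∀ z : H n, AnalyticAt ℂ (fun z : H n =>
      Complex.exp (Complex.log q * (-2 * ((z + α) a - (z + α) b)))) z := by
    intro z
    have h : ∀ i : Fin n, AnalyticAt ℂ (fun w : H n => (w + α) i) z := fun i =>
      ((ContinuousLinearMap.proj (R := ℂ) (φ := fun _ : Fin n => ℂ) i).analyticAt z).add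
        analyticAt_const
    exact (analyticAt_const.mul (analyticAt_const.mul ((h a).sub (h b)))).cexp
  have e : T α (qpow q a b) = ofEntire _ hh := rfl
  rw [e]
  symm
  refine ofEntire_mul fun z => ?_
  rw [← Complex.exp_add]
  simp only [Pi.add_apply]
  ring_nf

section Parameter

variable {n : ℕ} {q : ℂ}

theorem qpow_ne_cst (hq0 : q ≠ 0) (hq1 : q ≠ 1) {a b : Fin n} (hab : a ≠ b) (c : ℂ) :
    qpow q a b ≠ cst c := by
  intro h
  have h1 := eq_const_of_ofEntire h 0
  -- At `-e_a/2` the exponent is `log q`, so the value there is `q`, while the value at `0` is `1`.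
  have h2 := eq_const_of_ofEntire h (Pi.single a (-1 / 2))
  simp only [Pi.zero_apply, sub_self, mul_zero, Complex.exp_zero] at h1
  simp only [Pi.single_eq_same, Pi.single_eq_of_ne hab.symm] at h2
  rw [← h1] at h2
  apply hq1
  rw [← h2, show Complex.log q * (-2 * (-1 / 2 - 0)) = Complex.log q by ring,
    Complex.exp_log hq0]

theorem qpow_sub_one_ne (hq0 : q ≠ 0) (hq1 : q ≠ 1) {a b : Fin n} (hab : a ≠ b) :
    qpow q a b - 1 ≠ 0 := by
  have := qpow_ne_cst hq0 hq1 hab 1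
  rw [sub_ne_zero]
  rwa [cst, map_one] at this

theorem cst_mul (c d : ℂ) : (cst (c * d) : M n) = cst c * cst d := map_mul _ _ _
theorem cst_sub (c d : ℂ) : (cst (c - d) : M n) = cst c - cst d := map_sub _ _ _
theorem cst_one : (cst 1 : M n) = 1 := map_one _
theorem cst_inv (c : ℂ) : (cst c⁻¹ : M n) = (cst c)⁻¹ := map_inv₀ _ _
theorem cst_pow (c : ℂ) (k : ℕ) : (cst (c ^ k) : M n) = cst c ^ k := map_pow _ _ _
theorem cst_ne_zero {c : ℂ} (h : c ≠ 0) : (cst c : M n) ≠ 0 :=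
  (map_ne_zero (algebraMap ℂ (M n))).2 h

theorem hfun_ne_zero (hq0 : q ≠ 0) (hq1 : q ≠ 1) {a b : Fin n} (hab : a ≠ b) :
    hfun q a b ≠ 0 :=
  div_ne_zero (mul_ne_zero (cst_ne_zero hq0) (sub_ne_zero.2 (qpow_ne_cst hq0 hq1 hab _)))
    (qpow_sub_one_ne hq0 hq1 hab)

/-- Used to eliminate `h0` from the `RLL` relations in favour of `hfun` and constants. -/
theorem h0_add_hfun (hq0 : q ≠ 0) (hq1 : q ≠ 1) {a b : Fin n} (hab : a ≠ b) :
    h0 q a b + hfun q a b = cst q := by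
  have h := qpow_sub_one_ne hq0 hq1 hab
  have hc := cst_ne_zero (n := n) hq0
  simp only [h0, hfun, cst_sub, cst_inv, cst_pow]
  field_simp
  ring

theorem h0_add_h0 (hq0 : q ≠ 0) (hq1 : q ≠ 1) {a b : Fin n} (hab : a ≠ b) :
    h0 q a b + h0 q b a = cst q - cst q⁻¹ := by
  have h := qpow_sub_one_ne hq0 hq1 hab
  have h' := qpow_sub_one_ne hq0 hq1 hab.symm
  have e := qpow_mul_qpow q a b
  simp only [h0, cst_sub, cst_inv]
  rw [div_add_div _ _ h h', div_eq_iff (mul_ne_zero h h')]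
  linear_combination ((cst q)⁻¹ - cst q) * e

/-- The remaining coefficient of the `R`-matrix also factors through `h`, as `g(λ) = h(λ) h(-λ)`. -/
theorem gfun_eq (hq0 : q ≠ 0) (hq1 : q ≠ 1) {a b : Fin n} (hab : a ≠ b) :
    gfun q a b = hfun q a b * hfun q b a := by
  have h := qpow_sub_one_ne hq0 hq1 hab
  have h' := qpow_sub_one_ne hq0 hq1 hab.symm
  have e := qpow_mul_qpow q a b
  have hc := cst_ne_zero (n := n) hq0
  have hx : qpow q a b ≠ 0 := left_ne_zero_of_mul_eq_one e
  have e' : qpow q b a = (qpow q a b)⁻¹ := eq_inv_of_mul_eq_one_right e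
  rw [e'] at h'
  simp only [gfun, hfun, cst_inv, cst_pow, e']
  field_simp
  have h2 : 1 - qpow q a b ≠ 0 := by
    intro h3; apply h; linear_combination -h3
  field_simp
  ring

/-- This is `h(λ+1) h(-λ) = 1`: translation by `-ω(b)` raises `λ_a - λ_b` by one. It reconciles the
signs of last-column expansions with those of row expansions. -/
theorem hfun_neg_shift (hq0 : q ≠ 0) (hq1 : q ≠ 1) {a b : Fin n} (hab : a ≠ b) :
    T (-wt b) (hfun q a b) * hfun q b a = 1 := by
  have h := qpow_sub_one_ne hq0 hq1 hab
  have h' := qpow_sub_one_ne hq0 hq1 hab.symm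
  have e := qpow_mul_qpow q a b
  have hc := cst_ne_zero (n := n) hq0
  have hx : qpow q a b ≠ 0 := left_ne_zero_of_mul_eq_one e
  have e' : qpow q b a = (qpow q a b)⁻¹ := eq_inv_of_mul_eq_one_right e
  have h4 : qpow q a b ≠ cst (q ^ 2) := qpow_ne_cst hq0 hq1 hab _
  have ex : Complex.exp (Complex.log q * (-2 * ((-wt b : H n) a - (-wt b : H n) b))) =
      (q ^ 2)⁻¹ := by
    simp only [wt, Pi.neg_apply, Pi.single_eq_same, Pi.single_eq_of_ne hab]
    rw [show Complex.log q * (-2 * (-0 - -1)) = -(Complex.log q + Complex.log q) by ring,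
      Complex.exp_neg, Complex.exp_add, Complex.exp_log hq0, sq]
  rw [e'] at h'
  simp only [hfun, map_div₀, map_mul, map_sub, T_cst, T_qpow, ex, map_one, e']
  simp only [cst_inv, cst_pow]
  rw [cst_pow] at h4
  have h2 : 1 - qpow q a b ≠ 0 := by
    intro h3; apply h; linear_combination -h3
  have h5 : qpow q a b - cst q ^ 2 ≠ 0 := sub_ne_zero.2 h4
  have h6 : cst q ^ 2 - qpow q a b ≠ 0 := sub_ne_zero.2 h4.symm
  field_simp
  ring

theorem T_hfun_of_eq (α : H n) {a b : Fin n} (h : α a = α b) :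
    T α (hfun q a b) = hfun q a b := by
  simp only [hfun, map_div₀, map_mul, map_sub, T_cst, T_qpow, map_one, h, sub_self, mul_zero,
    Complex.exp_zero, cst_one, mul_one]

theorem wt_apply_of_ne {c a : Fin n} (h : c ≠ a) : (wt c : H n) a = 0 := by
  simp [wt, h.symm]

theorem T_neg_wt_hfun {a b c : Fin n} (ha : c ≠ a) (hb : c ≠ b) :
    T (-wt c) (hfun q a b) = hfun q a b :=
  T_hfun_of_eq _ (by simp [wt_apply_of_ne ha, wt_apply_of_ne hb])

end Parameter

/-- The Lagrange interpolation identity behind `∑_j ∏_{m ≠ j} h(λ_j - λ_m) = const`. -/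
theorem sum_prod_div {ι F : Type} [DecidableEq ι] [Field F] (t : F) (ht : t ≠ 1) (s : Finset ι)
    (x : ι → F) (hx : Set.InjOn x s) (hx0 : ∀ i ∈ s, x i ≠ 0) :
    ∑ j ∈ s, ∏ m ∈ s.erase j, (t * x j - x m) / (x j - x m) = (t ^ s.card - 1) / (t - 1) := by
  classical
  -- The leading terms of the two products cancel, so `P` is determined by its values at the nodes
  -- `x_j`, where the second product vanishes. The identity is the interpolation formula for `P`
  -- evaluated at `0`.
  open Polynomial in
  set P : F[X] := ∏ m ∈ s, (C t * X - C (x m)) - C (t ^ s.card) * ∏ m ∈ s, (X - C (x m)) with hP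
  have hev : ∀ j ∈ s, P.eval (x j) = (t - 1) * x j * ∏ m ∈ s.erase j, (t * x j - x m) := by
    intro j hj
    rw [hP, eval_sub, eval_mul, eval_prod, eval_prod, ← Finset.mul_prod_erase s _ hj,
      ← Finset.mul_prod_erase s (fun m => eval (x j) (X - C (x m))) hj]
    simp
    left; ring
  have hdeg : P.degree < s.card := by
    -- For `t = 0` the factors `t X - x_m` are constants and the comparison of leading coefficients
    -- below does not apply.
    by_cases h0 : t = 0
    · subst h0
      rcases s.eq_empty_or_nonempty with rfl | hs
      · simp [hP]
      · have : (0 : F) ^ s.card = 0 := zero_pow (Finset.card_pos.2 hs).ne'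
        rw [hP, this]
        simp only [map_zero, zero_mul, zero_sub, sub_zero]
        rw [show ∏ m ∈ s, -C (x m) = C (∏ m ∈ s, -x m) by rw [map_prod]; simp]
        exact lt_of_le_of_lt degree_C_le (by exact_mod_cast Finset.card_pos.2 hs)
    · have d1 : ∀ m, (C t * X - C (x m)).degree = 1 := fun m => by
        rw [sub_eq_add_neg, ← C_neg]; exact degree_linear h0
      have d2 : (∏ m ∈ s, (C t * X - C (x m))).degree = (s.card : WithBot ℕ) := by
        rw [degree_prod]; simp [d1]
      have d3 : (∏ m ∈ s, (X - C (x m))).degree = (s.card : WithBot ℕ) := by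
        rw [degree_prod]; simp
      have hne : C (t ^ s.card) ≠ 0 := by simp [h0]
      have l3 : (∏ m ∈ s, (X - C (x m))).leadingCoeff = 1 := by
        rw [leadingCoeff_prod]; simp
      have l1 : ∀ m, (C t * X - C (x m)).leadingCoeff = t := fun m => by
        rw [sub_eq_add_neg, ← C_neg]; exact leadingCoeff_linear h0
      rw [← d2]
      refine degree_sub_lt_left ?_ ?_ ?_
      · rw [degree_mul, d3, d2, degree_C (pow_ne_zero _ h0), zero_add]
      · intro h; rw [h] at d2; simp at d2
      · rw [leadingCoeff_prod, leadingCoeff_mul, l3]; simp [l1]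
  have key := Lagrange.eq_interpolate hx hdeg
  have k0 := congrArg (eval 0) key
  rw [Lagrange.interpolate_apply, eval_finsetSum] at k0
  have e1 : eval 0 P = (1 - t ^ s.card) * ∏ m ∈ s, (-x m) := by
    rw [hP, eval_sub, eval_mul, eval_prod, eval_prod]; simp; ring
  -- The factor `x_j` in `P(x_j)` completes the numerator of the Lagrange basis polynomial at `0` to
  -- this product, up to sign. It is therefore common to all terms and can be cancelled.
  have hprod : ∏ m ∈ s, (-x m) ≠ 0 := Finset.prod_ne_zero_iff.2 fun i hi => neg_ne_zero.2 (hx0 i hi)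
  have e2 : ∀ j ∈ s, eval 0 (C (eval (x j) P) * Lagrange.basis s x j) =
      (1 - t) * (∏ m ∈ s.erase j, (t * x j - x m) / (x j - x m)) * ∏ m ∈ s, (-x m) := by
    intro j hj
    rw [eval_mul, eval_C, hev j hj, Lagrange.basis, eval_prod, ← Finset.mul_prod_erase s _ hj,
      Finset.prod_div_distrib]
    have : ∏ m ∈ s.erase j, eval 0 (Lagrange.basisDivisor (x j) (x m)) =
        (∏ m ∈ s.erase j, (-x m)) / ∏ m ∈ s.erase j, (x j - x m) := by
      rw [← Finset.prod_div_distrib]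
      refine Finset.prod_congr rfl fun m _ => ?_
      simp [Lagrange.basisDivisor, div_eq_inv_mul]
    rw [this]
    ring
  rw [Finset.sum_congr rfl e2, e1, ← Finset.sum_mul, ← Finset.mul_sum] at k0
  have k1 := mul_right_cancel₀ hprod k0
  rw [eq_div_iff (sub_ne_zero.2 ht)]
  linear_combination k1

/-- With `x_j = q^{-2λ_j}` one has `h(λ_j - λ_m) = q⁻¹ (q² x_j - x_m) / (x_j - x_m)`, so this is the
interpolation identity at `t = q²`. The value is the `q`-number of `#J`, a constant independent of
`λ`. -/
theorem sum_prod_hfun {n : ℕ} {q : ℂ} (hq0 : q ≠ 0) (hq2 : q ^ 2 ≠ 1) (J : Finset (Fin n)) :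
    ∑ j ∈ J, ∏ m ∈ J.erase j, hfun q j m =
      cst ((q⁻¹) ^ (J.card - 1) * ((q ^ (2 * J.card) - 1) / (q ^ 2 - 1))) := by
  have hq1 : q ≠ 1 := by rintro rfl; simp at hq2
  have hc := cst_ne_zero (n := n) hq0
  have hsub : ∀ j m : Fin n, j ≠ m → qexp q j - qexp q m ≠ 0 := by
    intro j m hjm h
    have h1 := qpow_mul_qexp q j m
    have h2 := qpow_sub_one_ne hq0 hq1 hjm
    have h3 : (qpow q j m - 1) * qexp q m = 0 := by rw [sub_mul, h1, one_mul, h]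
    exact (mul_ne_zero h2 (qexp_ne_zero q m)) h3
  have hinj : Set.InjOn (qexp (n := n) q) J := by
    intro a _ b _ h
    by_contra hab
    exact hsub a b hab (sub_eq_zero.2 h)
  have ht : (cst (q ^ 2) : M n) ≠ 1 := by
    rw [← cst_one]
    exact fun h => hq2 ((algebraMap ℂ (M n)).injective h)
  have hh : ∀ j m : Fin n, j ≠ m → hfun q j m =
      cst q⁻¹ * ((cst (q ^ 2) * qexp q j - qexp q m) / (qexp q j - qexp q m)) := by
    intro j m hjm
    have h1 := qpow_mul_qexp q j m
    have h2 := qpow_sub_one_ne hq0 hq1 hjm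
    have h3 := hsub j m hjm
    have h4 : qexp q j - qexp q m = (qpow q j m - 1) * qexp q m := by rw [sub_mul, h1, one_mul]
    have h5 := qexp_ne_zero q m
    rw [h4, ← h1]
    simp only [hfun, cst_pow, cst_inv]
    field_simp
  rw [Finset.sum_congr rfl fun j hj => Finset.prod_congr rfl fun m hm =>
    hh j m (Finset.ne_of_mem_erase hm).symm]
  simp only [Finset.prod_mul_distrib, Finset.prod_const]
  rw [Finset.sum_congr rfl fun j hj => by rw [Finset.card_erase_of_mem hj], ← Finset.mul_sum,
    sum_prod_div _ ht J _ hinj fun i _ => qexp_ne_zero q i, cst_mul, cst_pow]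
  congr 1
  have : (cst ((q ^ (2 * J.card) - 1) / (q ^ 2 - 1)) : M n) =
      cst (q ^ (2 * J.card) - 1) / cst (q ^ 2 - 1) := map_div₀ _ _ _
  rw [this]
  simp only [cst_sub, cst_one, pow_mul, cst_pow]

/-! Dynamical minors by expansion along columns. -/

theorem sum_erase_pairs {ι : Type} [LinearOrder ι] {B : Type} [AddCommMonoid B] (I : Finset ι) (f : ι → ι → B) :
    ∑ i ∈ I, ∑ k ∈ I.erase i, f i k = ∑ i ∈ I, ∑ k ∈ I with i < k, (f i k + f k i) := by
  simp only [Finset.sum_add_distrib]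
  rw [Finset.sum_comm' (s := I) (t := fun i => {k ∈ I | i < k}) (t' := I)
    (s' := fun k => {i ∈ I | i < k}) (f := fun i k => f k i)
    (by intro x y; simp only [Finset.mem_filter]; tauto), ← Finset.sum_add_distrib]
  refine Finset.sum_congr rfl fun i _ => ?_
  rw [← Finset.sum_union]
  · congr 1
    ext k
    simp only [Finset.mem_erase, Finset.mem_union, Finset.mem_filter]
    constructor
    · rintro ⟨h1, h2⟩
      rcases lt_or_gt_of_ne h1 with h | h <;> simp [h, h2]
    · rintro (⟨h1, h2⟩ | ⟨h1, h2⟩)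
      · exact ⟨h2.ne', h1⟩
      · exact ⟨h2.ne, h1⟩
  · rw [Finset.disjoint_filter]
    intro k _ h1 h2
    exact lt_asymm h1 h2

theorem exists_sort_split {ι : Type} [LinearOrder ι] {k : ι} {J : Finset ι} (hk : k ∉ J) : ∃ L₁ L₂ : List ι,
    J.sort (· ≤ ·) = L₁ ++ L₂ ∧ (insert k J).sort (· ≤ ·) = L₁ ++ k :: L₂ ∧
    (∀ m ∈ L₁, m < k) ∧ ∀ m ∈ L₂, k < m := by
  have hmem : k ∈ (insert k J).sort (· ≤ ·) := by simp
  obtain ⟨L₁, L₂, hL⟩ := List.append_of_mem hmem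
  have hs : ((insert k J).sort (· ≤ ·)).Pairwise (· < ·) := (Finset.sortedLT_sort _).pairwise
  rw [hL] at hs
  refine ⟨L₁, L₂, ?_, hL, fun m hm => (List.pairwise_append.1 hs).2.2 m hm k (by simp),
    fun m hm => List.rel_of_pairwise_cons (List.pairwise_append.1 hs).2.1 hm⟩
  have hs2 : (L₁ ++ L₂).Pairwise (· < ·) :=
    hs.sublist (List.Sublist.append_left (List.sublist_cons_self k L₂) L₁)
  have hJ : J = (L₁ ++ L₂).toFinset := by
    have h1 : (insert k J) = (L₁ ++ k :: L₂).toFinset := by rw [← hL, Finset.sort_toFinset]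
    have h2 : k ∉ L₁ ++ L₂ := by
      have := hs.imp (S := (· ≠ ·)) (fun h => ne_of_lt h)
      have hn : (L₁ ++ k :: L₂).Nodup := this
      exact (List.nodup_middle.1 hn |> List.nodup_cons.1).1
    have h3 : J = (insert k J).erase k := (Finset.erase_insert hk).symm
    rw [h3, h1]
    ext m
    have h4 : m ∈ L₁ ++ L₂ → m ≠ k := by rintro h rfl; exact h2 h
    simp only [Finset.mem_erase, List.mem_toFinset, List.mem_append, List.mem_cons] at h4 ⊢
    tauto
  rw [hJ]
  refine List.Perm.eq_of_pairwise' (Finset.pairwise_sort _ _) (hs2.imp le_of_lt) ?_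
  rw [← Multiset.coe_eq_coe, Finset.sort_eq, List.toFinset_val, List.dedup_eq_self.2]
  exact hs2.imp (S := (· ≠ ·)) (fun h => ne_of_lt h)

/-! ### Signs for moving a letter to its place in a sorted word. -/

section Signs

variable {ι K : Type} [LinearOrder ι] [Field K]

theorem prod_eq_prod_sort (J : Finset ι) (f : ι → K) :
    ∏ m ∈ J, f m = ((J.sort (· ≤ ·)).map f).prod := by
  rw [((Finset.sort_perm_toList J (· ≤ ·)).map f).prod_eq, Finset.prod_map_toList]

/-- `∏_{m ∈ I, m < i} -h(i, m)`: the sign for moving `i` from the front of `I` to its place. -/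
def signFront (h : ι → ι → K) (i : ι) (I : Finset ι) : K :=
  ∏ m ∈ I, if m < i then -h i m else 1

/-- `∏_{m ∈ I, k < m} -h(m, k)`: the sign for moving `k` from the end of `I` to its place. -/
def signBack (h : ι → ι → K) (I : Finset ι) (k : ι) : K :=
  ∏ m ∈ I, if k < m then -h m k else 1

theorem signBack_ne_zero {h : ι → ι → K} (hh : ∀ a b, a ≠ b → h a b ≠ 0) (I : Finset ι) (k : ι) :
    signBack h I k ≠ 0 := by
  refine Finset.prod_ne_zero_iff.2 fun m _ => ?_
  split_ifs with hm
  · exact neg_ne_zero.2 (hh _ _ hm.ne')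
  · exact one_ne_zero

theorem signFront_eq_mul_erase (h : ι → ι → K) {i k : ι} {I : Finset ι} (hk : k ∈ I) :
    signFront h i I = (if k < i then -h i k else 1) * signFront h i (I.erase k) :=
  (Finset.mul_prod_erase I _ hk).symm

theorem signBack_eq_mul_erase (h : ι → ι → K) {i k : ι} {I : Finset ι} (hi : i ∈ I) :
    signBack h I k = (if k < i then -h i k else 1) * signBack h (I.erase i) k :=
  (Finset.mul_prod_erase I _ hi).symm

end Signs

section Minors

variable {ι K A : Type} [LinearOrder ι] [Field K] [Algebra ℂ K] [Ring A] [Algebra ℂ A]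

/-- The dynamical minor with rows `I` and list of columns `L`, by expansion along the first
column. -/
def colMinor (h : ι → ι → K) (l : K →ₐ[ℂ] A) (t : ι → ι → A) : List ι → Finset ι → A
  | [], I => if I = ∅ then 1 else 0
  | c :: L, I => ∑ i ∈ I, l (signFront h i (I.erase i)) * t i c * colMinor h l t L (I.erase i)

theorem colMinor_nil (h : ι → ι → K) (l : K →ₐ[ℂ] A) (t : ι → ι → A) (I : Finset ι) :
    colMinor h l t [] I = if I = ∅ then 1 else 0 := rfl

theorem colMinor_cons (h : ι → ι → K) (l : K →ₐ[ℂ] A) (t : ι → ι → A) (c : ι) (L : List ι)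
    (I : Finset ι) : colMinor h l t (c :: L) I =
      ∑ i ∈ I, l (signFront h i (I.erase i)) * t i c * colMinor h l t L (I.erase i) := rfl

theorem colMinor_eq_zero (h : ι → ι → K) (l : K →ₐ[ℂ] A) (t : ι → ι → A) (L : List ι) :
    ∀ I : Finset ι, I.card ≠ L.length → colMinor h l t L I = 0 := by
  induction L with
  | nil => intro I hI; rw [colMinor_nil, if_neg]; rintro rfl; exact hI rfl
  | cons c L ih =>
    intro I hI
    rw [colMinor_cons]
    refine Finset.sum_eq_zero fun i hi => ?_
    rw [ih, mul_zero]
    intro h1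
    rw [Finset.card_erase_of_mem hi] at h1
    have := Finset.card_pos.2 ⟨i, hi⟩
    exact hI (by rw [List.length_cons]; omega)

theorem map_colMinor {B : Type} [Ring B] [Algebra ℂ B] (h : ι → ι → K) (l : K →ₐ[ℂ] A)
    (t : ι → ι → A) (φ : A →ₐ[ℂ] B) (L : List ι) : ∀ I : Finset ι,
    φ (colMinor h l t L I) = colMinor h (φ.comp l) (fun i j => φ (t i j)) L I := by
  induction L with
  | nil => intro I; simp only [colMinor_nil]; split_ifs <;> simp
  | cons c L ih =>
    intro I
    simp only [colMinor_cons, map_sum, map_mul, ih]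
    rfl

/-- The `t_{ij}` intertwine translations `τ_i` of the scalars acting through `l`, and `h(a, b)` is
invariant under `τ_c` for `c ≠ a, b`. -/
structure IsShifted (h : ι → ι → K) (τ : ι → K →ₐ[ℂ] K) (l : K →ₐ[ℂ] A) (t : ι → ι → A) :
    Prop where
  t_l : ∀ i j f, t i j * l f = l (τ i f) * t i j
  τ_h : ∀ a b c, c ≠ a → c ≠ b → τ c (h a b) = h a b

theorem τ_signFront {h : ι → ι → K} {τ : ι → K →ₐ[ℂ] K}
    (τ_h : ∀ a b c, c ≠ a → c ≠ b → τ c (h a b) = h a b) {i k : ι} {I : Finset ι} (hi : i ∉ I)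
    (hik : i ≠ k) : τ i (signFront h k I) = signFront h k I := by
  rw [signFront, map_prod]
  refine Finset.prod_congr rfl fun m hm => ?_
  split_ifs
  · rw [map_neg, τ_h _ _ _ hik]; rintro rfl; exact hi hm
  · exact map_one _

theorem τ_signBack {h : ι → ι → K} {τ : ι → K →ₐ[ℂ] K}
    (τ_h : ∀ a b c, c ≠ a → c ≠ b → τ c (h a b) = h a b) {i k : ι} {I : Finset ι} (hi : i ∉ I)
    (hik : i ≠ k) : τ i (signBack h I k) = signBack h I k := by
  rw [signBack, map_prod]
  refine Finset.prod_congr rfl fun m hm => ?_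
  split_ifs
  · rw [map_neg, τ_h _ _ _ _ hik]; rintro rfl; exact hi hm
  · exact map_one _

/-- Expansion along the last column. -/
theorem colMinor_append_singleton {h : ι → ι → K} {τ : ι → K →ₐ[ℂ] K} {l : K →ₐ[ℂ] A}
    {t : ι → ι → A} (H : IsShifted h τ l t) (j : ι) (L : List ι) : ∀ I : Finset ι,
    colMinor h l t (L ++ [j]) I =
      ∑ k ∈ I, l (signBack h (I.erase k) k) * colMinor h l t L (I.erase k) * t k j := by
  induction L with
  | nil =>
    intro I
    simp only [List.nil_append, colMinor_cons, colMinor_nil]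
    refine Finset.sum_congr rfl fun i _ => ?_
    split_ifs with h0
    · simp [h0, signFront, signBack]
    · simp
  | cons c L ih =>
    intro I
    simp only [List.cons_append, colMinor_cons, ih, Finset.mul_sum, Finset.sum_mul]
    rw [Finset.sum_comm' (t' := I) (s' := fun k => I.erase k)
      (by intro x y; simp only [Finset.mem_erase]; tauto)]
    refine Finset.sum_congr rfl fun k hk => Finset.sum_congr rfl fun i hi => ?_
    have hik : i ≠ k := Finset.ne_of_mem_erase hi
    have hi' := Finset.mem_of_mem_erase hi
    -- Row `i` is used for the first column and row `k` for the last. Whichever is removed first,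
    -- the pair contributes the same factor, `-h(i,k)` when `k < i`; it sits in the front sign on
    -- one side and in the back sign on the other.
    have e1 := signFront_eq_mul_erase h (i := i) (Finset.mem_erase.2 ⟨hik.symm, hk⟩)
    have e2 := signBack_eq_mul_erase h (k := k) hi
    rw [e1, e2, Finset.erase_right_comm (a := k) (b := i)]
    have e3 := τ_signBack H.τ_h (i := i) (k := k) (I := (I.erase i).erase k) (by simp) hik
    have e4 := H.t_l i c (signBack h ((I.erase i).erase k) k)
    rw [e3] at e4
    simp only [mul_assoc, map_mul]
    rw [← mul_assoc (t i c), e4]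
    simp only [← mul_assoc, ← map_mul]
    rw [mul_assoc (if k < i then -h i k else 1), mul_assoc (if k < i then -h i k else 1),
      mul_comm (signFront h i _)]

/-- The choices `(i,k)` and `(k,i)` of rows for the first two columns differ by one inversion, so
these columns enter only through `2 × 2` blocks. Quadratic relations between the entries of two rows
therefore suffice to exchange them. -/
theorem colMinor_cons_cons {h : ι → ι → K} {τ : ι → K →ₐ[ℂ] K} {l : K →ₐ[ℂ] A}
    {t : ι → ι → A} (H : IsShifted h τ l t) (x y : ι) (L : List ι) (I : Finset ι) :
    colMinor h l t (x :: y :: L) I = ∑ i ∈ I, ∑ k ∈ I with i < k,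
      l (signFront h i ((I.erase i).erase k) * signFront h k ((I.erase i).erase k)) *
        (t i x * t k y - l (h k i) * (t k x * t i y)) * colMinor h l t L ((I.erase i).erase k) := by
  simp only [colMinor_cons, Finset.mul_sum]
  rw [sum_erase_pairs I (fun i k => l (signFront h i (I.erase i)) * t i x *
    (l (signFront h k ((I.erase i).erase k)) * t k y * colMinor h l t L ((I.erase i).erase k)))]
  refine Finset.sum_congr rfl fun i hi => Finset.sum_congr rfl fun k hk => ?_
  obtain ⟨hk, hik⟩ := Finset.mem_filter.1 hk
  rw [signFront_eq_mul_erase h (i := i) (Finset.mem_erase.2 ⟨hik.ne', hk⟩),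
    signFront_eq_mul_erase h (i := k) (Finset.mem_erase.2 ⟨hik.ne, hi⟩), if_neg hik.not_gt,
    if_pos hik, Finset.erase_right_comm (a := k) (b := i)]
  set J := (I.erase i).erase k with hJ
  have e1 := H.t_l i x (signFront h k J)
  rw [τ_signFront H.τ_h (by simp [hJ]) hik.ne] at e1
  have e2 := H.t_l k x (signFront h i J)
  rw [τ_signFront H.τ_h (by simp [hJ]) hik.ne'] at e2
  have a1 : ∀ (a b : K) (X Y : A), l a * t i x * (l (signFront h k J) * X * Y) =
      l a * l (signFront h k J) * (t i x * X) * Y := by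
    intro a b X Y
    rw [show l a * t i x * (l (signFront h k J) * X * Y) =
      l a * (t i x * l (signFront h k J)) * X * Y by simp only [mul_assoc], e1]
    simp only [mul_assoc]
  have a2 : ∀ (a b : K) (X Y : A), l a * t k x * (l (signFront h i J) * X * Y) =
      l a * l (signFront h i J) * (t k x * X) * Y := by
    intro a b X Y
    rw [show l a * t k x * (l (signFront h i J) * X * Y) =
      l a * (t k x * l (signFront h i J)) * X * Y by simp only [mul_assoc], e2]
    simp only [mul_assoc]
  rw [a1 _ 0, a2 _ 0, ← map_mul, ← map_mul, one_mul, mul_sub, ← mul_assoc (l _) (l (h k i)),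
    ← map_mul, sub_mul, sub_eq_add_neg, ← neg_mul, ← neg_mul, ← map_neg]
  congr 5
  ring

/-- A family indexed by words in which adjacent letters can be exchanged up to scalars acting
through `r`, with the scalar `-h(x, y)` when `y < x`. -/
structure IsAlternating (h : ι → ι → K) (r : K →ₐ[ℂ] A) (F : List ι → A) : Prop where
  dup : ∀ P x Q, F (P ++ x :: x :: Q) = 0
  swap : ∀ P x y Q, y < x → x ∉ P → y ∉ P → F (P ++ x :: y :: Q) = r (-h x y) * F (P ++ y :: x :: Q)
  exists_swap : ∀ P x y Q, x ≠ y → ∃ u, F (P ++ x :: y :: Q) = r u * F (P ++ y :: x :: Q)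

/-! ### Sorting words in an alternating family. -/

namespace IsAlternating

variable {h : ι → ι → K} {r : K →ₐ[ℂ] A} {F : List ι → A}

/-- The first copy of `x` is exchanged rightwards until it meets the second. Only the existence of
the exchange scalars matters, which is why `exists_swap` leaves them unspecified: letters of the
prefix may translate them. -/
theorem eq_zero (H : IsAlternating h r F) (x : ι) (L Q : List ι) :
    ∀ P, F (P ++ x :: (L ++ x :: Q)) = 0 := by
  induction L with
  | nil => intro P; exact H.dup P x Q
  | cons y L ih =>
    intro P
    by_cases hxy : x = y
    · subst hxy; exact H.dup P x _
    · obtain ⟨u, hu⟩ := H.exists_swap P x y (L ++ x :: Q) hxy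
      have := ih (P ++ [y])
      rw [List.append_assoc] at this
      rw [List.cons_append, hu]
      simp only [List.cons_append, List.nil_append] at this
      rw [this, mul_zero]

/-- Each smaller letter passed contributes its factor `-h(k,m)`. The hypotheses on `P` and `L` keep
both exchanged letters out of the prefix, so that `swap` applies with the untranslated scalar. -/
theorem move_right (H : IsAlternating h r F) (k : ι) (Q : List ι) : ∀ L P : List ι,
    (∀ m ∈ L, m < k) → k ∉ P → (P ++ L).Nodup →
    F (P ++ k :: (L ++ Q)) = r ((L.map fun m => -h k m).prod) * F (P ++ (L ++ k :: Q)) := by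
  intro L
  induction L with
  | nil => intro P _ _ _; simp
  | cons m L ih =>
    intro P hL hP hn
    have hmP : m ∉ P := fun hm => (List.nodup_append.1 hn).2.2 m hm m (by simp) rfl
    have hm := hL m (by simp)
    rw [List.cons_append, H.swap P k m _ hm hP hmP]
    have := ih (P ++ [m]) (fun m' hm' => hL m' (List.mem_cons_of_mem _ hm'))
      (by simp [hP, hm.ne']) (by simpa using hn)
    simp only [List.append_assoc, List.cons_append, List.nil_append] at this ⊢
    rw [this, List.map_cons, List.prod_cons, map_mul, mul_assoc]

theorem move_left (H : IsAlternating h r F) (k : ι) (P : List ι) (hP : k ∉ P) :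
    ∀ L Q : List ι, (∀ m ∈ L, k < m) → (P ++ L).Nodup →
    F (P ++ (L ++ k :: Q)) = r ((L.map fun m => -h m k).prod) * F (P ++ k :: (L ++ Q)) := by
  intro L
  induction L using List.reverseRecOn with
  | nil => intro Q _ _; simp
  | append_singleton L m ih =>
    intro Q hL hn
    have hm := hL m (by simp)
    have hkL : k ∉ L := fun hk => lt_irrefl k (hL k (by simp [hk]))
    rw [← List.append_assoc] at hn
    have hmPL : m ∉ P ++ L := fun hm => (List.nodup_append.1 hn).2.2 m hm m (by simp) rfl
    have h1 := H.swap (P ++ L) m k Q hm hmPL (by simp [hP, hkL])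
    have h2 := ih (m :: Q) (fun m' hm' => hL m' (by simp [hm'])) (List.nodup_append.1 hn).1
    simp only [List.append_assoc, List.cons_append, List.nil_append] at h1 h2 ⊢
    rw [h1, h2, List.map_append, List.prod_append, ← mul_assoc, ← map_mul, mul_comm (-h m k)]
    simp

end IsAlternating

namespace IsAlternating

variable {h : ι → ι → K} {r : K →ₐ[ℂ] A} {F : List ι → A}

/-- In the sorted word the letters below `k` precede its place, and `k` has to pass only these; the
other factors of `signFront` are `1`. -/
theorem cons_sort (H : IsAlternating h r F) {k : ι} {J : Finset ι} (hk : k ∉ J) :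
    F (k :: J.sort (· ≤ ·)) = r (signFront h k J) * F ((insert k J).sort (· ≤ ·)) := by
  obtain ⟨L₁, L₂, h1, h2, h3, h4⟩ := exists_sort_split hk
  have hn : (L₁ ++ L₂).Nodup := h1 ▸ Finset.sort_nodup _ _
  have := H.move_right k L₂ L₁ [] h3 (by simp) (by simpa using (List.nodup_append.1 hn).1)
  simp only [List.nil_append] at this
  rw [h1, this, h2, signFront, prod_eq_prod_sort, h1, List.map_append, List.prod_append]
  congr 2
  rw [List.map_congr_left (f := fun m => if m < k then -h k m else 1) (g := fun m => -h k m)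
      (fun m hm => if_pos (h3 m hm)),
    List.map_congr_left (f := fun m => if m < k then -h k m else 1) (g := fun m => 1)
      (fun m hm => if_neg (h4 m hm).not_gt)]
  simp

theorem sort_append (H : IsAlternating h r F) {k : ι} {J : Finset ι} (hk : k ∉ J) :
    F (J.sort (· ≤ ·) ++ [k]) = r (signBack h J k) * F ((insert k J).sort (· ≤ ·)) := by
  obtain ⟨L₁, L₂, h1, h2, h3, h4⟩ := exists_sort_split hk
  have hn : (L₁ ++ L₂).Nodup := h1 ▸ Finset.sort_nodup _ _
  have := H.move_left k L₁ (fun hk => lt_irrefl k (h3 k hk)) L₂ [] h4 hn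
  simp only [List.append_nil] at this
  rw [h1, List.append_assoc, this, h2, signBack, prod_eq_prod_sort, h1, List.map_append,
    List.prod_append]
  congr 2
  rw [List.map_congr_left (l := L₁) (f := fun m => if k < m then -h m k else 1) (g := fun m => 1)
      (fun m hm => if_neg (h3 m hm).not_gt),
    List.map_congr_left (f := fun m => if k < m then -h m k else 1) (g := fun m => -h m k)
      (fun m hm => if_pos (h4 m hm))]
  simp

theorem cons_sort_of_mem (H : IsAlternating h r F) {k : ι} {J : Finset ι} (hk : k ∈ J) :
    F (k :: J.sort (· ≤ ·)) = 0 := by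
  obtain ⟨L₁, L₂, h1⟩ := List.append_of_mem ((Finset.mem_sort (· ≤ ·)).2 hk)
  rw [h1]
  exact H.eq_zero k L₁ L₂ []

theorem sort_append_of_mem (H : IsAlternating h r F) {k : ι} {J : Finset ι} (hk : k ∈ J) :
    F (J.sort (· ≤ ·) ++ [k]) = 0 := by
  obtain ⟨L₁, L₂, h1⟩ := List.append_of_mem ((Finset.mem_sort (· ≤ ·)).2 hk)
  rw [h1, List.append_assoc, List.cons_append]
  exact H.eq_zero k L₂ [] L₁

end IsAlternating

/-- Quadratic relations making the minors alternate in their columns. -/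
structure IsDynMatrix (h : ι → ι → K) (τ : ι → K →ₐ[ℂ] K) (l r : K →ₐ[ℂ] A) (t : ι → ι → A) :
    Prop extends IsShifted h τ l t where
  t_r : ∀ i j f, t i j * r f = r (τ j f) * t i j
  comm : ∀ f g, l f * r g = r g * l f
  h_ne : ∀ a b, a ≠ b → h a b ≠ 0
  same : ∀ i k a, i < k → t i a * t k a = l (h k i) * (t k a * t i a)
  swap : ∀ i k a b, i < k → a < b → t i b * t k a - l (h k i) * (t k b * t i a) =
    r (-h b a) * (t i a * t k b - l (h k i) * (t k a * t i b))

/-! ### Alternation of the minors in their columns. -/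

namespace IsDynMatrix

variable {h : ι → ι → K} {τ : ι → K →ₐ[ℂ] K} {l r : K →ₐ[ℂ] A} {t : ι → ι → A}

theorem colMinor_swap (H : IsDynMatrix h τ l r t) (x y : ι) (hxy : y < x) (Q : List ι)
    (I : Finset ι) : colMinor h l t (x :: y :: Q) I =
      r (-h x y) * colMinor h l t (y :: x :: Q) I := by
  rw [colMinor_cons_cons H.toIsShifted, colMinor_cons_cons H.toIsShifted, Finset.mul_sum]
  refine Finset.sum_congr rfl fun i _ => ?_
  rw [Finset.mul_sum]
  refine Finset.sum_congr rfl fun k hk => ?_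
  rw [H.swap i k y x (Finset.mem_filter.1 hk).2 hxy]
  simp only [← mul_assoc]
  rw [H.comm]

/-- A scalar in `r` crossing `t_{ip}` is translated according to the column `p` only. The translated
scalar does not depend on the row `i` and leaves the sum; hence the hypothesis is needed for all row
sets with the same `u`. -/
theorem colMinor_prefix (H : IsDynMatrix h τ l r t) {L L' : List ι} {u : K}
    (hL : ∀ I, colMinor h l t L I = r u * colMinor h l t L' I) (p : ι) (I : Finset ι) :
    colMinor h l t (p :: L) I = r (τ p u) * colMinor h l t (p :: L') I := by
  rw [colMinor_cons, colMinor_cons, Finset.mul_sum]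
  refine Finset.sum_congr rfl fun i _ => ?_
  rw [hL, ← mul_assoc, mul_assoc (l _), H.t_r, ← mul_assoc, H.comm]
  simp only [mul_assoc]

theorem exists_colMinor_swap (H : IsDynMatrix h τ l r t) (x y : ι) (hxy : x ≠ y) (Q : List ι) :
    ∀ P, ∃ u, ∀ I, colMinor h l t (P ++ x :: y :: Q) I =
      r u * colMinor h l t (P ++ y :: x :: Q) I := by
  intro P
  induction P with
  | nil =>
    rcases lt_or_gt_of_ne hxy with hlt | hlt
    · refine ⟨(-h y x)⁻¹, fun I => ?_⟩
      rw [List.nil_append, List.nil_append, H.colMinor_swap y x hlt, ← mul_assoc, ← map_mul,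
        inv_mul_cancel₀ (neg_ne_zero.2 (H.h_ne _ _ hlt.ne')), map_one, one_mul]
    · exact ⟨_, H.colMinor_swap x y hlt Q⟩
  | cons p P ih =>
    obtain ⟨u, hu⟩ := ih
    exact ⟨_, H.colMinor_prefix hu p⟩

theorem isAlternating (H : IsDynMatrix h τ l r t) (I : Finset ι) :
    IsAlternating h r (fun L => colMinor h l t L I) where
  dup P x Q := by
    induction P generalizing I with
    | nil =>
      simp only [List.nil_append]
      rw [colMinor_cons_cons H.toIsShifted]
      refine Finset.sum_eq_zero fun i _ => Finset.sum_eq_zero fun k hk => ?_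
      rw [H.same i k x (Finset.mem_filter.1 hk).2, sub_self, mul_zero, zero_mul]
    | cons p P ih =>
      simp only [List.cons_append] at ih ⊢
      rw [colMinor_cons]
      exact Finset.sum_eq_zero fun i _ => by rw [ih, mul_zero]
  swap P x y Q hxy := by
    induction P generalizing I with
    | nil => intro _ _; exact H.colMinor_swap x y hxy Q I
    | cons p P ih =>
      intro hx hy
      have h1 := H.colMinor_prefix (p := p) (I := I) (fun I => ih I (fun hh => hx (List.mem_cons_of_mem _ hh))
        (fun hh => hy (List.mem_cons_of_mem _ hh)))
      -- The prefixed letter differs from `x` and `y`, so its translation fixes `h(x,y)`.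
      rw [map_neg, H.τ_h] at h1
      · exact h1
      · rintro rfl; simp at hx
      · rintro rfl; simp at hy
  exists_swap P x y Q hxy := by
    obtain ⟨u, hu⟩ := H.exists_colMinor_swap x y hxy Q P
    exact ⟨u, hu I⟩

end IsDynMatrix

end Minors

/-! Minors as sums over permutations. -/

section Permutations

variable {ι K A : Type} [LinearOrder ι] [Field K] [Algebra ℂ K] [Ring A] [Algebra ℂ A]

/-- The product of `-h(f k, f l)` over the inversions `k < l`, `f l < f k` of a word `f`. -/
def inversionSign (h : ι → ι → K) {r : ℕ} (f : Fin r → ι) : K :=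
  ∏ k : Fin r, ∏ l : Fin r, if k < l ∧ f l < f k then -h (f k) (f l) else 1

theorem inversionSign_cons {ι K : Type} [LinearOrder ι] [Field K] (h : ι → ι → K) {r : ℕ} (i : ι) (f : Fin r → ι)
    (hf : Function.Injective f) :
    inversionSign h (Fin.cons i f : Fin (r + 1) → ι) =
      signFront h i (Finset.univ.image f) * inversionSign h f := by
  rw [inversionSign, Fin.prod_univ_succ, signFront, Finset.prod_image fun _ _ _ _ h => hf h]
  congr 1
  · rw [Fin.prod_univ_succ]
    simp
  · refine Finset.prod_congr rfl fun k _ => ?_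
    rw [Fin.prod_univ_succ]
    simp

/-- The cardinality of `I` excludes that `i` recurs among the values of `f`. -/
theorem image_cons_eq_iff {ι : Type} [DecidableEq ι] {r : ℕ} (i : ι) (f : Fin r → ι) {I : Finset ι} (hI : I.card = r + 1) :
    Finset.univ.image (Fin.cons i f : Fin (r + 1) → ι) = I ↔
      i ∈ I ∧ Finset.univ.image f = I.erase i := by
  have e : Finset.univ.image (Fin.cons i f : Fin (r + 1) → ι) =
      insert i (Finset.univ.image f) := by
    ext x
    simp only [Finset.mem_image, Finset.mem_univ, true_and, Finset.mem_insert, Fin.exists_fin_succ,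
      Fin.cons_zero, Fin.cons_succ]
    tauto
  rw [e]
  constructor
  · rintro rfl
    refine ⟨Finset.mem_insert_self _ _, (Finset.erase_insert fun hi => ?_).symm⟩
    rw [Finset.insert_eq_of_mem hi] at hI
    have := Finset.card_image_le (s := Finset.univ) (f := f)
    rw [hI, Finset.card_univ, Fintype.card_fin] at this
    omega
  · rintro ⟨h1, h2⟩
    rw [h2, Finset.insert_erase h1]

theorem injective_of_image_eq {ι : Type} [DecidableEq ι] {r : ℕ} {f : Fin r → ι} {I : Finset ι}
    (h : Finset.univ.image f = I) (hI : I.card = r) : Function.Injective f := by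
  have := (Finset.card_image_iff (s := Finset.univ) (f := f)).1
    (by rw [h, hI, Finset.card_univ, Fintype.card_fin])
  rwa [Finset.coe_univ, Set.injOn_univ] at this

/-- The words of length `#I` with image `I` are the orderings of `I`; using all words avoids a
parametrization of permutations and lets the induction peel off the first letter. The inversion sign
of the remaining letters does not involve the first letter `i`, hence is fixed by `τ_i` and passes
through `t_{i,c(0)}`. -/
theorem sum_words_eq_colMinor [Fintype ι] {h : ι → ι → K} {τ : ι → K →ₐ[ℂ] K} {l : K →ₐ[ℂ] A}
    {t : ι → ι → A} (H : IsShifted h τ l t) : ∀ (r : ℕ) (c : Fin r → ι) (I : Finset ι),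
    I.card = r → (∑ f : Fin r → ι, if Finset.univ.image f = I then
      l (inversionSign h f) * (List.ofFn fun k => t (f k) (c k)).prod else 0) =
      colMinor h l t (List.ofFn c) I := by
  intro r
  induction r with
  | zero =>
    intro c I hI
    rw [Finset.card_eq_zero] at hI
    subst hI
    simp [colMinor_nil, inversionSign]
  | succ r ih =>
    intro c I hI
    rw [← (Fin.consEquiv fun _ : Fin (r + 1) => ι).sum_comp, Fintype.sum_prod_type,
      List.ofFn_succ, colMinor_cons]
    rw [← Finset.sum_subset (Finset.subset_univ I)]
    · refine Finset.sum_congr rfl fun i hi => ?_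
      have hc : (I.erase i).card = r := by rw [Finset.card_erase_of_mem hi, hI]; rfl
      rw [← ih (fun k => c k.succ) _ hc, Finset.mul_sum]
      refine Finset.sum_congr rfl fun f _ => ?_
      have e0 : (Fin.consEquiv fun _ : Fin (r + 1) => ι) (i, f) = Fin.cons i f := rfl
      rw [e0]
      by_cases hf : Finset.univ.image f = I.erase i
      · rw [if_pos ((image_cons_eq_iff i f hI).2 ⟨hi, hf⟩), if_pos hf,
          inversionSign_cons h i f (injective_of_image_eq hf hc), hf, List.ofFn_succ]
        simp only [Fin.cons_zero, Fin.cons_succ, List.prod_cons]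
        have e1 := H.t_l i (c 0) (inversionSign h f)
        have e2 : τ i (inversionSign h f) = inversionSign h f := by
          simp only [inversionSign, map_prod]
          have hif : ∀ k, i ≠ f k := by
            intro k hk
            have : f k ∈ I.erase i := hf ▸ Finset.mem_image_of_mem f (Finset.mem_univ k)
            rw [← hk] at this
            simp at this
          refine Finset.prod_congr rfl fun k _ => Finset.prod_congr rfl fun m _ => ?_
          split_ifs
          · rw [map_neg, H.τ_h _ _ _ (hif k) (hif m)]
          · exact map_one _
        rw [e2] at e1
        rw [map_mul]
        simp only [mul_assoc]
        rw [← mul_assoc (t i (c 0)), e1]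
        simp only [mul_assoc]
      · rw [if_neg hf, if_neg fun h => hf ((image_cons_eq_iff i f hI).1 h).2, mul_zero]
    · intro i _ hi
      exact Finset.sum_eq_zero fun f _ => if_neg fun h => hi ((image_cons_eq_iff i f hI).1 h).1

end Permutations

/-- A permutation `σ` corresponds to the word `k ↦ i_{σ(k)}`, and since the enumeration of `I` is
increasing, inversions of `σ` are inversions of this word. -/
theorem minorOf_eq_colMinor {n : ℕ} {q : ℂ} {A : Type} [Ring A] [Algebra ℂ A]
    {τ : Fin n → M n →ₐ[ℂ] M n} {l : M n →ₐ[ℂ] A} {t : Fin n → Fin n → A}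
    (H : IsShifted (hfun q) τ l t) {I J : Finset (Fin n)} (hIJ : J.card = I.card) :
    minorOf q l t I J = colMinor (hfun q) l t (J.sort (· ≤ ·)) I := by
  have hJ : J.sort (· ≤ ·) = List.ofFn (J.orderEmbOfFin hIJ) := by
    rw [List.ofFn_eq_map, Finset.listMap_orderEmbOfFin_finRange]
  rw [minorOf, dif_pos hIJ, hJ, ← sum_words_eq_colMinor H _ _ I rfl, ← Finset.sum_filter]
  refine Finset.sum_bij (fun σ _ => fun k => I.orderEmbOfFin rfl (σ k)) ?_ ?_ ?_ ?_
  · intro σ _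
    rw [Finset.mem_filter]
    refine ⟨Finset.mem_univ _, ?_⟩
    have : (fun k => I.orderEmbOfFin rfl (σ k)) = (I.orderEmbOfFin rfl) ∘ σ := rfl
    rw [this, ← Finset.image_image, Finset.image_univ_equiv, Finset.image_orderEmbOfFin_univ]
  · intro σ _ σ' _ h
    exact Equiv.ext fun k => (I.orderEmbOfFin rfl).injective (congrFun h k)
  · intro f hf
    have hf' := (Finset.mem_filter.1 hf).2
    have hinj := injective_of_image_eq hf' rfl
    have hex : ∀ k, ∃ m, I.orderEmbOfFin rfl m = f k := fun k => by
      have : f k ∈ Set.range (I.orderEmbOfFin rfl) := by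
        rw [Finset.range_orderEmbOfFin]
        have h1 : f k ∈ Finset.univ.image f := Finset.mem_image_of_mem f (Finset.mem_univ k)
        rwa [hf'] at h1
      exact this
    choose g hg using hex
    have hgi : Function.Injective g := fun a b hab => hinj (by rw [← hg, ← hg, hab])
    exact ⟨Equiv.ofBijective g (Finite.injective_iff_bijective.1 hgi), Finset.mem_univ _,
      funext hg⟩
  · intro σ _
    simp only [gsign, inversionSign, OrderEmbedding.lt_iff_lt]

/-! The two systems of quadratic relations contained in the dynamical `RLL` relations. -/

/-- Elements `t_{ij}` of an algebra satisfying the defining relations of `F_R(M(n))`. -/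
structure IsRLL {n : ℕ} {A : Type} [Ring A] [Algebra ℂ A] (q : ℂ) (l r : M n →ₐ[ℂ] A)
    (t : Fin n → Fin n → A) : Prop where
  comm : ∀ f g, l f * r g = r g * l f
  l_t : ∀ f i j, l f * t i j = t i j * l (T (wt i) f)
  r_t : ∀ f i j, r f * t i j = t i j * r (T (wt j) f)
  rll : ∀ a b c d, (∑ x, ∑ y, l (Rmat q x y a c) * t x b * t y d) =
    ∑ x, ∑ y, r (Rmat q b d x y) * t c y * t a x

section Rmat

variable {n : ℕ} {q : ℂ}

theorem Rmat_eq_zero {a b x y : Fin n} (h1 : ¬ (x = a ∧ y = b)) (h2 : ¬ (x = b ∧ y = a)) :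
    Rmat q a b x y = 0 := by
  unfold Rmat
  rw [if_neg fun h => h1 ⟨h.2.1, h.2.2.trans h.1⟩, if_neg fun h => h1 h.2,
    if_neg fun h => h1 h.2, if_neg fun h => h2 h.2]
  simp

theorem Rmat_self (a : Fin n) : Rmat q a a a a = cst q := by simp [Rmat]

theorem Rmat_diag_lt {a b : Fin n} (h : a < b) : Rmat q a b a b = 1 := by
  simp [Rmat, h, h.not_gt, h.ne]

theorem Rmat_diag_gt {a b : Fin n} (h : b < a) : Rmat q a b a b = gfun q a b := by
  simp [Rmat, h, h.not_gt, h.ne']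

theorem Rmat_flip {a b : Fin n} (h : a ≠ b) : Rmat q a b b a = h0 q a b := by
  simp [Rmat, h, h.symm]

end Rmat

theorem sum_sum_eq_pair {ι B : Type} [Fintype ι] [DecidableEq ι] [AddCommMonoid B] (G : ι → ι → B)
    {a c : ι} (hac : a ≠ c)
    (h : ∀ x y, ¬ (x = a ∧ y = c) → ¬ (x = c ∧ y = a) → G x y = 0) :
    ∑ x, ∑ y, G x y = G a c + G c a := by
  rw [← Fintype.sum_prod_type', ← Finset.sum_subset (Finset.subset_univ {(a, c), (c, a)}),
    Finset.sum_pair]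
  · simp [hac]
  · rintro ⟨x, y⟩ _ hxy
    simp only [Finset.mem_insert, Finset.mem_singleton, Prod.mk.injEq, not_or] at hxy
    exact h x y hxy.1 hxy.2

theorem sum_sum_eq_single {ι B : Type} [Fintype ι] [AddCommMonoid B] (G : ι → ι → B)
    {a : ι} (h : ∀ x y, ¬ (x = a ∧ y = a) → G x y = 0) :
    ∑ x, ∑ y, G x y = G a a := by
  rw [← Fintype.sum_prod_type', Fintype.sum_eq_single (a, a)]
  rintro ⟨x, y⟩ hxy
  exact h x y fun h => hxy (Prod.ext h.1 h.2)

namespace IsRLL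

variable {n : ℕ} {A : Type} [Ring A] [Algebra ℂ A] {q : ℂ} {l r : M n →ₐ[ℂ] A}
  {t : Fin n → Fin n → A}

theorem t_l (H : IsRLL q l r t) (i j : Fin n) (f : M n) :
    t i j * l f = l (T (-wt i) f) * t i j := by
  rw [H.l_t, T_T_neg]

theorem t_r (H : IsRLL q l r t) (i j : Fin n) (f : M n) :
    t i j * r f = r (T (-wt j) f) * t i j := by
  rw [H.r_t, T_T_neg]

theorem rll_of_ne (H : IsRLL q l r t) {a b c d : Fin n} (hac : a ≠ c) (hbd : b ≠ d) :
    l (Rmat q a c a c) * (t a b * t c d) + l (h0 q c a) * (t c b * t a d) =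
      r (Rmat q b d b d) * (t c d * t a b) + r (h0 q b d) * (t c b * t a d) := by
  have := H.rll a b c d
  rw [sum_sum_eq_pair _ hac, sum_sum_eq_pair _ hbd, Rmat_flip hac.symm, Rmat_flip hbd] at this
  · simpa only [mul_assoc] using this
  · intro x y h1 h2
    rw [Rmat_eq_zero h1 h2, map_zero, zero_mul, zero_mul]
  · intro x y h1 h2
    rw [Rmat_eq_zero (by tauto) (by tauto), map_zero, zero_mul, zero_mul]

theorem rll_same_col (H : IsRLL q l r t) {a c : Fin n} (hac : a ≠ c) (b : Fin n) :
    l (Rmat q a c a c) * (t a b * t c b) + l (h0 q c a) * (t c b * t a b) =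
      r (cst q) * (t c b * t a b) := by
  have := H.rll a b c b
  rw [sum_sum_eq_pair _ hac, sum_sum_eq_single _ (a := b), Rmat_flip hac.symm, Rmat_self] at this
  · simpa only [mul_assoc] using this
  · intro x y h1
    rw [Rmat_eq_zero h1 h1, map_zero, zero_mul, zero_mul]
  · intro x y h1 h2
    rw [Rmat_eq_zero (by tauto) (by tauto), map_zero, zero_mul, zero_mul]

theorem rll_same_row (H : IsRLL q l r t) {b d : Fin n} (hbd : b ≠ d) (a : Fin n) :
    l (cst q) * (t a b * t a d) =
      r (Rmat q b d b d) * (t a d * t a b) + r (h0 q b d) * (t a b * t a d) := by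
  have := H.rll a b a d
  rw [sum_sum_eq_single _ (a := a), sum_sum_eq_pair _ hbd, Rmat_flip hbd, Rmat_self] at this
  · simpa only [mul_assoc] using this
  · intro x y h1 h2
    rw [Rmat_eq_zero (by tauto) (by tauto), map_zero, zero_mul, zero_mul]
  · intro x y h1
    rw [Rmat_eq_zero (by tauto) (by tauto), map_zero, zero_mul, zero_mul]

theorem isShifted (H : IsRLL q l r t) : IsShifted (hfun q) (fun i => T (-wt i)) l t where
  t_l := H.t_l
  τ_h _ _ _ ha hb := T_neg_wt_hfun ha hb

/-- For fixed rows `i < k` the `RLL` relations for the columns `(a,b)` and `(b,a)` express `t_{ia}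
t_{kb}` and `t_{ib} t_{ka}` through the products in the opposite row order. After `h₀` and `g` are
written through `h`, these two equations combine to the exchange relation. -/
theorem isDynMatrix (H : IsRLL q l r t) (hq0 : q ≠ 0) (hq1 : 2 ≤ n → q ≠ 1) :
    IsDynMatrix (hfun q) (fun i => T (-wt i)) l r t where
  toIsShifted := H.isShifted
  t_r := H.t_r
  comm := H.comm
  h_ne a b hab := hfun_ne_zero hq0 (hq1 (by have := Fin.val_ne_of_ne hab; omega)) hab
  same i k a hik := by
    have hq1 := hq1 (by have := Fin.lt_def.1 hik; omega)
    have e := H.rll_same_col hik.ne a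
    have e1 : l (hfun q k i) = r (cst q) - l (h0 q k i) := by
      rw [show r (cst q) = l (cst q) from (r.commutes q).trans (l.commutes q).symm,
        ← h0_add_hfun hq0 hq1 hik.ne', map_add]
      abel
    rw [Rmat_diag_lt hik, map_one, one_mul] at e
    rw [e1, sub_mul, ← e, add_sub_cancel_right]
  swap i k a b hik hab := by
    have hq1 := hq1 (by have := Fin.lt_def.1 hik; omega)
    have e1 := H.rll_of_ne hik.ne hab.ne
    have e2 := H.rll_of_ne hik.ne hab.ne'
    rw [Rmat_diag_lt hik, map_one, one_mul] at e1 e2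
    rw [Rmat_diag_lt hab, map_one, one_mul] at e1
    rw [Rmat_diag_gt hab, gfun_eq hq0 hq1 hab.ne', map_mul] at e2
    have hl : l (cst q) = r (cst q) := (l.commutes q).trans (r.commutes q).symm
    have f1 : l (h0 q k i) = r (cst q) - l (hfun q k i) := by
      rw [← hl, ← h0_add_hfun hq0 hq1 hik.ne', map_add]; abel
    have f2 : r (h0 q a b) = r (cst q) - r (hfun q a b) := by
      rw [← h0_add_hfun hq0 hq1 hab.ne, map_add]; abel
    have f3 : r (h0 q b a) = r (cst q) - r (hfun q b a) := by
      rw [← h0_add_hfun hq0 hq1 hab.ne', map_add]; abel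
    rw [f1, f2] at e1
    rw [f1, f3] at e2
    rw [eq_sub_of_add_eq e1, eq_sub_of_add_eq e2, map_neg]
    noncomm_ring

/-- The relations in the rows: the same system for the transposed matrix, the opposite order and
the interchanged scalars. -/
theorem isDynMatrix_dual (H : IsRLL q l r t) (hq0 : q ≠ 0) (hq1 : 2 ≤ n → q ≠ 1) :
    IsDynMatrix (ι := (Fin n)ᵒᵈ) (hfun q : Fin n → Fin n → M n)
      (fun i : Fin n => T (-wt i)) r l (fun i j : Fin n => t j i) where
  t_l i j f := H.t_r j i f
  τ_h _ _ _ ha hb := T_neg_wt_hfun ha hb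
  t_r i j f := H.t_l j i f
  comm f g := (H.comm g f).symm
  h_ne (a b : Fin n) (hab : a ≠ b) :=
    hfun_ne_zero hq0 (hq1 (by have := Fin.val_ne_of_ne hab; omega)) hab
  same (i k a : Fin n) (hki : k < i) := by
    have hq1 := hq1 (by have := Fin.lt_def.1 hki; omega)
    have e := H.rll_same_row hki.ne a
    have e1 : r (hfun q k i) = l (cst q) - r (h0 q k i) := by
      rw [show l (cst q) = r (cst q) from (l.commutes q).trans (r.commutes q).symm,
        ← h0_add_hfun hq0 hq1 hki.ne, map_add]
      abel
    rw [Rmat_diag_lt hki, map_one, one_mul] at e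
    rw [e1, sub_mul, e, add_sub_cancel_right]
  swap (i k a b : Fin n) (hki : k < i) (hba : b < a) := by
    have hq1 := hq1 (by have := Fin.lt_def.1 hki; omega)
    have e1 := H.rll_of_ne hba.ne hki.ne
    have e2 := H.rll_of_ne hba.ne hki.ne'
    rw [Rmat_diag_lt hba, map_one, one_mul] at e1 e2
    rw [Rmat_diag_lt hki, map_one, one_mul] at e1
    rw [Rmat_diag_gt hki, gfun_eq hq0 hq1 hki.ne', mul_comm, map_mul] at e2
    have hl : l (cst q) = r (cst q) := (l.commutes q).trans (r.commutes q).symm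
    have hl' : l (cst q⁻¹) = r (cst q⁻¹) := (l.commutes q⁻¹).trans (r.commutes q⁻¹).symm
    have f0 := h0_add_h0 hq0 hq1 hba.ne
    have f1 : l (h0 q a b) = l (hfun q b a) - r (cst q⁻¹) := by
      have : h0 q a b = hfun q b a - cst q⁻¹ := by
        linear_combination f0 - h0_add_hfun hq0 hq1 hba.ne
      rw [this, map_sub, hl']
    have g0 := h0_add_h0 hq0 hq1 hki.ne
    have f2 : r (h0 q k i) = r (cst q) - r (hfun q k i) := by
      rw [← h0_add_hfun hq0 hq1 hki.ne, map_add]; abel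
    have f3 : r (h0 q i k) = r (hfun q k i) - r (cst q⁻¹) := by
      rw [← map_sub]; congr 1
      linear_combination g0 - h0_add_hfun hq0 hq1 hki.ne
    have f4 : r (hfun q i k) = r (cst q) + r (cst q⁻¹) - r (hfun q k i) := by
      rw [← map_add, ← map_sub]; congr 1
      linear_combination h0_add_hfun hq0 hq1 hki.ne' - g0 + h0_add_hfun hq0 hq1 hki.ne
    rw [f1, f2] at e1
    rw [f1, f3, f4] at e2
    have c := H.comm (hfun q b a) (hfun q k i)
    change t b i * t a k - r (hfun q k i) * (t b k * t a i) =
      l (-hfun q b a) * (t a i * t b k - r (hfun q k i) * (t a k * t b i))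
    rw [eq_sub_of_add_eq e1, eq_sub_of_add_eq e2, map_neg]
    -- Beyond the two solved relations only the commutation of these two scalars is needed.
    generalize l (hfun q b a) = x at c ⊢
    generalize r (hfun q k i) = y at c ⊢
    rw [show -x * (t a i * t b k - y * (t a k * t b i)) =
      -(x * (t a i * t b k)) + x * y * (t a k * t b i) by noncomm_ring, c]
    noncomm_ring

end IsRLL

/-! Expansions along rows agree with expansions along columns. -/

section Duality

variable {n : ℕ} {A : Type} [Ring A] [Algebra ℂ A] {q : ℂ} {l r : M n →ₐ[ℂ] A}
  {t : Fin n → Fin n → A}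

/-- `colMinor` for the transposed system. -/
def rowMinor (q : ℂ) (r : M n →ₐ[ℂ] A) (t : Fin n → Fin n → A) (L : List (Fin n))
    (J : Finset (Fin n)) : A :=
  colMinor (ι := (Fin n)ᵒᵈ) (hfun q : Fin n → Fin n → M n) r (fun i j : Fin n => t j i) L J

/-- `signFront` for the opposite order. -/
def signFrontOp (q : ℂ) (j : Fin n) (J : Finset (Fin n)) : M n :=
  ∏ m ∈ J, if j < m then -hfun q j m else 1

theorem rowMinor_cons (c : Fin n) (L : List (Fin n)) (J : Finset (Fin n)) :
    rowMinor q r t (c :: L) J =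
      ∑ j ∈ J, r (signFrontOp q j (J.erase j)) * t c j * rowMinor q r t L (J.erase j) := rfl

theorem rowMinor_cons_sort (H : IsRLL q l r t) (hq0 : q ≠ 0) (hq1 : 2 ≤ n → q ≠ 1) {i : Fin n}
    {I : Finset (Fin n)} (hi : i ∉ I) (J : Finset (Fin n)) :
    rowMinor q r t (i :: I.sort (· ≥ ·)) J =
      l (signFrontOp q i I) * rowMinor q r t ((insert i I).sort (· ≥ ·)) J :=
  ((H.isDynMatrix_dual hq0 hq1).isAlternating J).cons_sort (ι := (Fin n)ᵒᵈ) hi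

theorem rowMinor_cons_sort_of_mem (H : IsRLL q l r t) (hq0 : q ≠ 0) (hq1 : 2 ≤ n → q ≠ 1)
    {i : Fin n} {I : Finset (Fin n)} (hi : i ∈ I) (J : Finset (Fin n)) :
    rowMinor q r t (i :: I.sort (· ≥ ·)) J = 0 :=
  ((H.isDynMatrix_dual hq0 hq1).isAlternating J).cons_sort_of_mem (ι := (Fin n)ᵒᵈ) hi

/-- One sign collects the factors with `m < j`, the other those with `m > j`, so the product no
longer depends on the order. Up to sign it is the summand of `sum_prod_hfun`. -/
theorem signFront_mul_signFrontOp {j : Fin n} {J : Finset (Fin n)} (hj : j ∉ J) :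
    signFront (hfun q) j J * signFrontOp q j J = (-1) ^ J.card * ∏ m ∈ J, hfun q j m := by
  rw [signFront, signFrontOp, ← Finset.prod_mul_distrib, ← Finset.prod_const,
    ← Finset.prod_mul_distrib]
  refine Finset.prod_congr rfl fun m hm => ?_
  have : m ≠ j := by rintro rfl; exact hj hm
  rcases lt_or_gt_of_ne this with h | h
  · rw [if_pos h, if_neg h.not_gt]; ring
  · rw [if_neg h.not_gt, if_pos h]; ring

/-- Both sides come from the double sum over `i ∈ I`, `j ∈ J` of the signs of `j` and `i` times
`t_{ij}` and the minor with row `i` and column `j` deleted. Summing over `i` first gives, by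
alternation in columns, the column minor times a sum of products of the two signs over `J`. Summing
over `j` first gives, by induction and alternation in rows, the row minor times the same kind of sum
over `I`. Both sums of signs equal one nonzero constant. -/
theorem colMinor_eq_rowMinor (H : IsRLL q l r t) (hq0 : q ≠ 0)
    (hq : ∀ k : ℕ, 1 ≤ k → k ≤ n → q ^ (2 * k) ≠ 1) : ∀ (k : ℕ) (I J : Finset (Fin n)),
    I.card = k → J.card = k → colMinor (hfun q) l t (J.sort (· ≤ ·)) I =
      rowMinor q r t (I.sort (· ≥ ·)) J := by
  intro k
  induction k with
  | zero =>
    intro I J hI hJ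
    rw [Finset.card_eq_zero] at hI hJ
    subst hI hJ
    rw [Finset.sort_empty, Finset.sort_empty]
    rfl
  | succ k ih =>
    intro I J hI hJ
    have hkn : k + 1 ≤ n := hI ▸ (Finset.card_le_univ I).trans_eq (Fintype.card_fin n)
    have hq2 : q ^ 2 ≠ 1 := by simpa using hq 1 le_rfl (by omega)
    have hq1 : 2 ≤ n → q ≠ 1 := by rintro - rfl; simp at hq2
    -- Up to sign this is the `q`-number of `k + 1`; it is nonzero by the hypothesis on
    -- `q^{2(k+1)}`.
    set c : ℂ := (-1) ^ k * ((q⁻¹) ^ k * ((q ^ (2 * (k + 1)) - 1) / (q ^ 2 - 1))) with hc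
    have hc0 : c ≠ 0 := by
      refine mul_ne_zero (pow_ne_zero _ (by norm_num)) (mul_ne_zero
        (pow_ne_zero _ (inv_ne_zero hq0)) (div_ne_zero ?_ (sub_ne_zero.2 hq2)))
      exact sub_ne_zero.2 (hq (k + 1) (by omega) hkn)
    have hsum : ∀ S : Finset (Fin n), S.card = k + 1 →
        ∑ j ∈ S, signFront (hfun q) j (S.erase j) * signFrontOp q j (S.erase j) = cst c := by
      intro S hS
      rw [Finset.sum_congr rfl fun j hj => by
        rw [signFront_mul_signFrontOp (Finset.notMem_erase j S), Finset.card_erase_of_mem hj, hS],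
        ← Finset.mul_sum, sum_prod_hfun hq0 hq2, hS, hc, cst_mul]
      simp [cst]
    have D : ∀ j ∈ J, ∑ i ∈ I, l (signFront (hfun q) i (I.erase i)) * t i j *
        colMinor (hfun q) l t ((J.erase j).sort (· ≤ ·)) (I.erase i) =
        r (signFront (hfun q) j (J.erase j)) * colMinor (hfun q) l t (J.sort (· ≤ ·)) I := by
      intro j hj
      have := ((H.isDynMatrix hq0 hq1).isAlternating I).cons_sort (Finset.notMem_erase j J)
      rwa [Finset.insert_erase hj] at this
    have D' : ∀ i ∈ I, ∑ j ∈ J, r (signFrontOp q j (J.erase j)) * t i j *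
        colMinor (hfun q) l t ((J.erase j).sort (· ≤ ·)) (I.erase i) =
        l (signFrontOp q i (I.erase i)) * rowMinor q r t (I.sort (· ≥ ·)) J := by
      intro i hi
      have := rowMinor_cons_sort H hq0 hq1 (Finset.notMem_erase i I) J
      rw [Finset.insert_erase hi] at this
      rw [← this, rowMinor_cons]
      refine Finset.sum_congr rfl fun j hj => ?_
      rw [ih _ _ (by rw [Finset.card_erase_of_mem hi, hI]; rfl)
        (by rw [Finset.card_erase_of_mem hj, hJ]; rfl)]
    have E : ∑ j ∈ J, r (signFrontOp q j (J.erase j)) * ∑ i ∈ I,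
          l (signFront (hfun q) i (I.erase i)) * t i j *
          colMinor (hfun q) l t ((J.erase j).sort (· ≤ ·)) (I.erase i) =
        ∑ i ∈ I, l (signFront (hfun q) i (I.erase i)) * ∑ j ∈ J,
          r (signFrontOp q j (J.erase j)) * t i j *
          colMinor (hfun q) l t ((J.erase j).sort (· ≤ ·)) (I.erase i) := by
      simp only [Finset.mul_sum]
      rw [Finset.sum_comm]
      refine Finset.sum_congr rfl fun i _ => Finset.sum_congr rfl fun j _ => ?_
      simp only [← mul_assoc]
      rw [H.comm]
    rw [Finset.sum_congr rfl fun j hj => by rw [D j hj, ← mul_assoc, ← map_mul, mul_comm],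
      Finset.sum_congr (s₁ := I) rfl fun i hi => by rw [D' i hi, ← mul_assoc, ← map_mul],
      ← Finset.sum_mul, ← Finset.sum_mul, ← map_sum, ← map_sum, hsum I hI] at E
    have hsJ := hsum J hJ
    rw [hsJ] at E
    -- The moment maps agree on constants, so the common factor is a complex scalar and can be
    -- cancelled even though `A` may have zero divisors.
    have e1 : l (cst c) = algebraMap ℂ A c := l.commutes c
    have e2 : r (cst c) = algebraMap ℂ A c := r.commutes c
    rw [e1, e2, ← Algebra.smul_def, ← Algebra.smul_def] at E
    exact smul_right_injective A hc0 E

end Duality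

/-! Spans of words. -/

section WordSpan

variable {G X A : Type} [AddMonoid G] [Ring A] [Algebra ℂ A] {gen : X → A} {deg : X → G}

theorem wordSpan_induction {δ : G} {p : A → Prop} (h0 : p 0) (hadd : ∀ a b, p a → p b → p (a + b))
    (hsmul : ∀ (c : ℂ) a, p a → p (c • a))
    (hw : ∀ w : List X, (w.map deg).sum = δ → p (w.map gen).prod) {a : A}
    (ha : a ∈ wordSpan gen deg δ) : p a := by
  refine Submodule.span_induction ?_ h0 (fun a b _ _ => hadd a b) (fun c a _ => hsmul c a) ha
  rintro _ ⟨w, hw', rfl⟩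
  exact hw w hw'

theorem word_mem_wordSpan (gen : X → A) (deg : X → G) (w : List X) :
    (w.map gen).prod ∈ wordSpan gen deg (w.map deg).sum :=
  Submodule.subset_span ⟨w, rfl, rfl⟩

theorem one_mem_wordSpan (gen : X → A) (deg : X → G) : (1 : A) ∈ wordSpan gen deg 0 :=
  Submodule.subset_span ⟨[], rfl, rfl⟩

theorem mul_mem_wordSpan {δ ε : G} {a b : A} (ha : a ∈ wordSpan gen deg δ)
    (hb : b ∈ wordSpan gen deg ε) : a * b ∈ wordSpan gen deg (δ + ε) := by
  refine wordSpan_induction (p := fun a => a * b ∈ wordSpan gen deg (δ + ε)) ?_ ?_ ?_ ?_ ha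
  · rw [zero_mul]; exact zero_mem _
  · intro a a' h h'; rw [add_mul]; exact add_mem h h'
  · intro c a h; rw [smul_mul_assoc]; exact Submodule.smul_mem _ _ h
  · intro w hw
    refine wordSpan_induction (p := fun b => _ * b ∈ wordSpan gen deg (δ + ε)) ?_ ?_ ?_ ?_ hb
    · rw [mul_zero]; exact zero_mem _
    · intro a a' h h'; rw [mul_add]; exact add_mem h h'
    · intro c a h; rw [mul_smul_comm]; exact Submodule.smul_mem _ _ h
    · intro w' hw'
      exact Submodule.subset_span ⟨w ++ w', by simp [hw, hw'], by simp⟩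

theorem map_wordSpan {B : Type} [Ring B] [Algebra ℂ B] {gen' : X → B} (φ : A →ₐ[ℂ] B)
    (S : G → Submodule ℂ B) (h1 : (1 : B) ∈ S 0)
    (hmul : ∀ δ ε a b, a ∈ S δ → b ∈ S ε → a * b ∈ S (δ + ε))
    (hgen : ∀ x, φ (gen x) = gen' x) (hgen' : ∀ x, gen' x ∈ S (deg x)) {δ : G} {a : A}
    (ha : a ∈ wordSpan gen deg δ) : φ a ∈ S δ := by
  refine wordSpan_induction (p := fun a => φ a ∈ S δ) ?_ ?_ ?_ ?_ ha
  · rw [map_zero]; exact zero_mem _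
  · intro a b h h'; rw [map_add]; exact add_mem h h'
  · intro c a h; rw [map_smul]; exact Submodule.smul_mem _ _ h
  · rintro w rfl
    clear ha
    induction w with
    | nil => simpa using h1
    | cons x w ih =>
      simp only [List.map_cons, List.prod_cons, List.sum_cons, map_mul, hgen]
      exact hmul _ _ _ _ (hgen' x) ih

end WordSpan

/-! Multiplicative bigradings. -/

/-- `A_{αβ} A_{γδ} ⊆ A_{α+γ,β+δ}`. -/
class GradedMul (n : ℕ) (A : Type) [Ring A] [Algebra ℂ A] [HPre n A] : Prop where
  mul_mem : ∀ {α β γ δ : H n} {a b : A},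
    a ∈ grade α β → b ∈ grade γ δ → a * b ∈ grade (α + γ) (β + δ)

instance (n : ℕ) (q : ℂ) : GradedMul n (FM n q) where
  mul_mem {α β γ δ _ _} ha hb :=
    mul_mem_wordSpan (gen := FM.gen n q) (deg := Gen.deg) (δ := (α, β)) (ε := (γ, δ)) ha hb

instance (n : ℕ) (q : ℂ) : GradedMul n (FGL n q) where
  mul_mem {α β γ δ _ _} ha hb :=
    mul_mem_wordSpan (gen := FGL.gen n q) (deg := FGL.deg n) (δ := (α, β)) (ε := (γ, δ)) ha hb

section GradedMul

variable {n : ℕ} {A B : Type} [Ring A] [Algebra ℂ A] [HPre n A] [Ring B] [Algebra ℂ B] [HPre n B]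

theorem iSup_grade_mul {ι κ : Type} {S : ι → Submodule ℂ A} {S' : κ → Submodule ℂ A}
    {R : Submodule ℂ A} (h : ∀ i j a b, a ∈ S i → b ∈ S' j → a * b ∈ R) {a b : A}
    (ha : a ∈ ⨆ i, S i) (hb : b ∈ ⨆ j, S' j) : a * b ∈ R := by
  have : (⨆ i, S i) * (⨆ j, S' j) ≤ R := by
    rw [Submodule.iSup_mul]
    refine iSup_le fun i => ?_
    rw [Submodule.mul_iSup]
    exact iSup_le fun j => Submodule.mul_le.2 fun a ha b hb => h i j a b ha hb
  exact this (Submodule.mul_mem_mul ha hb)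

theorem rgrade_mul_mem [GradedMul n A] {γ δ : H n} {a b : A} (ha : a ∈ rgrade γ)
    (hb : b ∈ rgrade δ) : a * b ∈ rgrade (A := A) (γ + δ) :=
  iSup_grade_mul (fun _ _ _ _ ha hb => mem_rgrade (GradedMul.mul_mem ha hb)) ha hb

theorem lgrade_mul_mem [GradedMul n A] {γ δ : H n} {a b : A} (ha : a ∈ lgrade γ)
    (hb : b ∈ lgrade δ) : a * b ∈ lgrade (A := A) (γ + δ) :=
  iSup_grade_mul (fun _ _ _ _ ha hb => mem_lgrade (GradedMul.mul_mem ha hb)) ha hb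

end GradedMul

/-! Calculus in the matrix tensor product. -/

/-- The unit and the image of the moment map have degree zero. -/
class RightUnital (n : ℕ) (A : Type) [Ring A] [Algebra ℂ A] [RightGraded n A] : Prop where
  one_mem : (1 : A) ∈ rgrade (0 : H n)
  rmom_mem : ∀ f : M n, rmom f ∈ rgrade (A := A) (0 : H n)

/-- The unit and the image of the moment map have degree zero. -/
class LeftUnital (n : ℕ) (A : Type) [Ring A] [Algebra ℂ A] [LeftGraded n A] : Prop where
  one_mem : (1 : A) ∈ lgrade (0 : H n)
  lmom_mem : ∀ f : M n, lmom f ∈ lgrade (A := A) (0 : H n)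

instance (n : ℕ) (A : Type) [Ring A] [Algebra ℂ A] [HPre n A] : RightUnital n A where
  one_mem := mem_rgrade one_mem_grade
  rmom_mem f := mem_rgrade (mr_mem f)

instance (n : ℕ) (A : Type) [Ring A] [Algebra ℂ A] [HPre n A] : LeftUnital n A where
  one_mem := mem_lgrade one_mem_grade
  lmom_mem f := mem_lgrade (ml_mem f)

instance (n : ℕ) (q : ℂ) : RightUnital n (W n q) where
  one_mem := one_mem_wordSpan (W.gen n q) GenW.deg
  rmom_mem f := gen_mem_wordSpan (W.gen n q) GenW.deg (.f f)

section Tensor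

variable {n : ℕ} {A B : Type} [Ring A] [Algebra ℂ A] [Ring B] [Algebra ℂ B]
  [RightGraded n A] [LeftGraded n B]

open Classical in
variable (n) in
/-- The class of `a ⊗ b` in `A ⊗̃ B`, zero if `a ⊗ b` is not in `⊕_γ A_{·γ} ⊗ B_{γ·}`. -/
def tm (a : A) (b : B) : MTensor n A B :=
  if h : a ⊗ₜ[ℂ] b ∈ matchSub n A B then mkT n A B ⟨a ⊗ₜ[ℂ] b, h⟩ else 0

variable (n) in
/-- `a ⊗ b` lies in `⊕_γ A_{·γ} ⊗ B_{γ·}`. -/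
def Matching (a : A) (b : B) : Prop := a ⊗ₜ[ℂ] b ∈ matchSub n A B

theorem Matching.of_mem {γ : H n} {a : A} {b : B} (ha : a ∈ rgrade γ) (hb : b ∈ lgrade γ) :
    Matching n a b := tmul_mem ha hb

theorem Matching.tm_eq {a : A} {b : B} (h : Matching n a b) :
    tm n a b = mkT n A B ⟨a ⊗ₜ[ℂ] b, h⟩ := dif_pos h

theorem tmul_eq_tm {γ : H n} {a : A} {b : B} (ha : a ∈ rgrade γ) (hb : b ∈ lgrade γ) :
    tmul a b ha hb = tm n a b := (Matching.of_mem ha hb).tm_eq.symm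

theorem Matching.mul {a c : A} {b d : B} (h : Matching n a b) (h' : Matching n c d) :
    Matching n (a * c) (b * d) := by
  have := (matchSub n A B).mul_mem h h'
  rwa [Algebra.TensorProduct.tmul_mul_tmul] at this

theorem Matching.tm_mul {a c : A} {b d : B} (h : Matching n a b) (h' : Matching n c d) :
    tm n a b * tm n c d = tm n (a * c) (b * d) := by
  rw [h.tm_eq, h'.tm_eq, (h.mul h').tm_eq, ← map_mul]
  congr 1
  exact Subtype.ext (Algebra.TensorProduct.tmul_mul_tmul _ _ _ _)

theorem Matching.zero_left (b : B) : Matching n (0 : A) b := by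
  rw [Matching, TensorProduct.zero_tmul]; exact zero_mem _

theorem Matching.zero_right (a : A) : Matching n a (0 : B) := by
  rw [Matching, TensorProduct.tmul_zero]; exact zero_mem _

theorem tm_zero_left (b : B) : tm n (0 : A) b = 0 := by
  rw [(Matching.zero_left b).tm_eq, ← map_zero (mkT n A B)]
  congr 1
  exact Subtype.ext (TensorProduct.zero_tmul _ _)

theorem tm_zero_right (a : A) : tm n a (0 : B) = 0 := by
  rw [(Matching.zero_right a).tm_eq, ← map_zero (mkT n A B)]
  congr 1
  exact Subtype.ext (TensorProduct.tmul_zero _ _)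

theorem Matching.add_left {a a' : A} {b : B} (h : Matching n a b) (h' : Matching n a' b) :
    Matching n (a + a') b := by
  rw [Matching, TensorProduct.add_tmul]; exact add_mem h h'

theorem Matching.add_right {a : A} {b b' : B} (h : Matching n a b) (h' : Matching n a b') :
    Matching n a (b + b') := by
  rw [Matching, TensorProduct.tmul_add]; exact add_mem h h'

theorem Matching.tm_add_left {a a' : A} {b : B} (h : Matching n a b) (h' : Matching n a' b) :
    tm n (a + a') b = tm n a b + tm n a' b := by
  rw [h.tm_eq, h'.tm_eq, (h.add_left h').tm_eq, ← map_add]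
  congr 1
  exact Subtype.ext (TensorProduct.add_tmul _ _ _)

theorem Matching.tm_add_right {a : A} {b b' : B} (h : Matching n a b) (h' : Matching n a b') :
    tm n a (b + b') = tm n a b + tm n a b' := by
  rw [h.tm_eq, h'.tm_eq, (h.add_right h').tm_eq, ← map_add]
  congr 1
  exact Subtype.ext (TensorProduct.tmul_add _ _ _)

theorem Matching.smul_left {a : A} {b : B} (c : ℂ) (h : Matching n a b) :
    Matching n (c • a) b := by
  rw [Matching, ← TensorProduct.smul_tmul']; exact Subalgebra.smul_mem _ h c

theorem Matching.tm_smul_left {a : A} {b : B} (c : ℂ) (h : Matching n a b) :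
    tm n (c • a) b = c • tm n a b := by
  rw [h.tm_eq, (h.smul_left c).tm_eq, ← map_smul]
  rfl

theorem Matching.smul_right {a : A} {b : B} (c : ℂ) (h : Matching n a b) :
    Matching n a (c • b) := by
  rw [Matching, ← TensorProduct.smul_tmul]; exact h.smul_left c

theorem Matching.tm_smul_right {a : A} {b : B} (c : ℂ) (h : Matching n a b) :
    tm n a (c • b) = c • tm n a b := by
  rw [h.tm_eq, (h.smul_right c).tm_eq, ← map_smul]
  congr 1
  exact Subtype.ext (TensorProduct.tmul_smul _ _ _)

theorem Matching.sum_left {ι : Type} {s : Finset ι} {a : ι → A} {b : B}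
    (h : ∀ i ∈ s, Matching n (a i) b) : Matching n (∑ i ∈ s, a i) b := by
  rw [Matching, TensorProduct.sum_tmul]; exact sum_mem h

theorem Matching.sum_right {ι : Type} {s : Finset ι} {a : A} {b : ι → B}
    (h : ∀ i ∈ s, Matching n a (b i)) : Matching n a (∑ i ∈ s, b i) := by
  rw [Matching, TensorProduct.tmul_sum]; exact sum_mem h

theorem tm_sum_left {ι : Type} {s : Finset ι} {a : ι → A} {b : B} :
    (∀ i ∈ s, Matching n (a i) b) → tm n (∑ i ∈ s, a i) b = ∑ i ∈ s, tm n (a i) b := by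
  classical
  induction s using Finset.induction_on with
  | empty => intro _; simp [tm_zero_left]
  | insert i s hi ih =>
    intro h
    have hs : ∀ i ∈ s, Matching n (a i) b := fun j hj => h j (Finset.mem_insert_of_mem hj)
    rw [Finset.sum_insert hi, Finset.sum_insert hi,
      (h i (Finset.mem_insert_self _ _)).tm_add_left (Matching.sum_left hs), ih hs]

theorem tm_sum_right {ι : Type} {s : Finset ι} {a : A} {b : ι → B} :
    (∀ i ∈ s, Matching n a (b i)) → tm n a (∑ i ∈ s, b i) = ∑ i ∈ s, tm n a (b i) := by
  classical
  induction s using Finset.induction_on with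
  | empty => intro _; simp [tm_zero_right]
  | insert i s hi ih =>
    intro h
    have hs : ∀ i ∈ s, Matching n a (b i) := fun j hj => h j (Finset.mem_insert_of_mem hj)
    rw [Finset.sum_insert hi, Finset.sum_insert hi,
      (h i (Finset.mem_insert_self _ _)).tm_add_right (Matching.sum_right hs), ih hs]

variable [RightUnital n A] [LeftUnital n B]

theorem Matching.one_one : Matching n (1 : A) (1 : B) :=
  Matching.of_mem RightUnital.one_mem LeftUnital.one_mem

theorem tm_one_one : tm n (1 : A) (1 : B) = 1 := by
  rw [Matching.one_one.tm_eq, ← map_one (mkT n A B)]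
  rfl

theorem Matching.rmom_one (f : M n) : Matching n (rmom f : A) (1 : B) :=
  Matching.of_mem (RightUnital.rmom_mem f) LeftUnital.one_mem

theorem Matching.one_lmom (f : M n) : Matching n (1 : A) (lmom f : B) :=
  Matching.of_mem RightUnital.one_mem (LeftUnital.lmom_mem f)

theorem tm_rmom_one (f : M n) : tm n (rmom f : A) (1 : B) = tm n (1 : A) (lmom f : B) := by
  rw [(Matching.rmom_one f).tm_eq, (Matching.one_lmom f).tm_eq]
  refine RingQuot.mkAlgHom_rel ℂ
    ⟨f, 0, 1, 1, RightUnital.one_mem, LeftUnital.one_mem, ?_, ?_⟩ <;> simp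

theorem Matching.rmom_mul {a : A} {b : B} (h : Matching n a b) (f : M n) :
    Matching n (rmom f * a) b := by simpa using (Matching.rmom_one f).mul h

theorem Matching.lmom_mul {a : A} {b : B} (h : Matching n a b) (f : M n) :
    Matching n a (lmom f * b) := by simpa using (Matching.one_lmom f).mul h

/-- The balancing relation extends from homogeneous pairs to all matching ones, since both sides are
products with the element `μ_r(f) ⊗ 1 = 1 ⊗ μ_l(f)`. -/
theorem Matching.tm_rmom_mul {a : A} {b : B} (h : Matching n a b) (f : M n) :
    tm n (rmom f * a) b = tm n a (lmom f * b) := by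
  have h1 := (Matching.rmom_one f).tm_mul h
  have h2 := (Matching.one_lmom f).tm_mul h
  rw [one_mul] at h1 h2
  rw [← h1, ← h2, tm_rmom_one]

end Tensor

section TensorHPre

variable {n : ℕ} {A B : Type} [Ring A] [Algebra ℂ A] [HPre n A] [Ring B] [Algebra ℂ B] [HPre n B]

theorem Matching.of_grade {α γ β : H n} {a : A} {b : B} (ha : a ∈ grade α γ) (hb : b ∈ grade γ β) :
    Matching n a b := Matching.of_mem (mem_rgrade ha) (mem_lgrade hb)

theorem tm_mem_grade {α γ β : H n} {a : A} {b : B} (ha : a ∈ grade α γ) (hb : b ∈ grade γ β) :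
    tm n a b ∈ (grade α β : Submodule ℂ (MTensor n A B)) := by
  rw [← tmul_eq_tm (mem_rgrade ha) (mem_lgrade hb)]
  exact tmul_mem_grade ha hb

theorem Matching.ml_one (f : M n) : Matching n (ml f : A) (1 : B) :=
  Matching.of_grade (ml_mem f) one_mem_grade

theorem Matching.one_mr (f : M n) : Matching n (1 : A) (mr f : B) :=
  Matching.of_grade one_mem_grade (mr_mem f)

theorem ml_tensor (f : M n) : (ml f : MTensor n A B) = tm n (ml f : A) (1 : B) :=
  (Matching.ml_one f).tm_eq.symm

theorem mr_tensor (f : M n) : (mr f : MTensor n A B) = tm n (1 : A) (mr f : B) :=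
  (Matching.one_mr f).tm_eq.symm

theorem Matching.ml_mul {a : A} {b : B} (h : Matching n a b) (f : M n) :
    Matching n (ml f * a) b := by simpa using (Matching.ml_one f).mul h

theorem Matching.tm_ml_mul {a : A} {b : B} (h : Matching n a b) (f : M n) :
    ml f * tm n a b = tm n (ml f * a) b := by
  rw [ml_tensor, (Matching.ml_one f).tm_mul h, one_mul]

theorem Matching.tm_mr_mul {a : A} {b : B} (h : Matching n a b) (f : M n) :
    mr f * tm n a b = tm n a (mr f * b) := by
  rw [mr_tensor, (Matching.one_mr f).tm_mul h, one_mul]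

theorem Matching.tm_mul_ml {a : A} {b : B} (h : Matching n a b) (f : M n) :
    tm n a b * ml f = tm n (a * ml f) b := by
  rw [ml_tensor, h.tm_mul (Matching.ml_one f), mul_one]

theorem Matching.tm_mul_mr {a : A} {b : B} (h : Matching n a b) (f : M n) :
    tm n a b * mr f = tm n a (b * mr f) := by
  rw [mr_tensor, h.tm_mul (Matching.one_mr f), mul_one]

theorem tensor_grade_induction {α β : H n} {p : MTensor n A B → Prop} (h0 : p 0)
    (hadd : ∀ x y, p x → p y → p (x + y)) (hsmul : ∀ (c : ℂ) x, p x → p (c • x))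
    (ht : ∀ γ a b, a ∈ grade α γ → b ∈ grade γ β → p (tm n a b)) {x : MTensor n A B}
    (hx : x ∈ grade α β) : p x := by
  refine Submodule.span_induction ?_ h0 (fun a b _ _ => hadd a b) (fun c a _ => hsmul c a) hx
  rintro _ ⟨γ, a, b, ha, hb, rfl⟩
  rw [tmul_eq_tm]
  exact ht γ a b ha hb

instance [GradedMul n A] [GradedMul n B] : GradedMul n (MTensor n A B) where
  mul_mem {α β γ δ x y} hx hy := by
    refine tensor_grade_induction (p := fun x => x * y ∈ grade (α + γ) (β + δ)) ?_ ?_ ?_ ?_ hx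
    · rw [zero_mul]; exact zero_mem _
    · intro a a' h h'; rw [add_mul]; exact add_mem h h'
    · intro c a h; rw [smul_mul_assoc]; exact Submodule.smul_mem _ _ h
    · intro κ a b ha hb
      refine tensor_grade_induction (p := fun y => _ * y ∈ grade (α + γ) (β + δ)) ?_ ?_ ?_ ?_ hy
      · rw [mul_zero]; exact zero_mem _
      · intro a a' h h'; rw [mul_add]; exact add_mem h h'
      · intro c a h; rw [mul_smul_comm]; exact Submodule.smul_mem _ _ h
      · intro κ' a' b' ha' hb'
        rw [(Matching.of_grade ha hb).tm_mul (Matching.of_grade ha' hb')]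
        exact tm_mem_grade (GradedMul.mul_mem ha ha') (GradedMul.mul_mem hb hb')

end TensorHPre

/-! Difference operators. -/

section Difference

variable {n : ℕ}

theorem dOp_apply (f g : M n) (α : H n) : Dh.toEnd n (dOp f α) g = f * T α g := rfl

theorem Dh.ext {x y : Dh n} (h : ∀ g, Dh.toEnd n x g = Dh.toEnd n y g) : x = y :=
  Subtype.ext (LinearMap.ext h)

theorem dOp_mul (f g : M n) (α β : H n) : dOp f α * dOp g β = dOp (f * T α g) (α + β) := by
  refine Dh.ext fun k => ?_
  rw [map_mul, Module.End.mul_apply, dOp_apply, dOp_apply, dOp_apply, map_mul, T_T, mul_assoc]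

theorem dMul_eq_dOp (f : M n) : dMul n f = dOp f 0 := by rw [dMul_eq, neg_zero]

theorem dOp_one_zero : (dOp 1 0 : Dh n) = 1 := by rw [← dMul_eq_dOp, map_one]

theorem dMul_mul_dOp (f g : M n) (α : H n) : dMul n f * dOp g α = dOp (f * g) α := by
  rw [dMul_eq_dOp, dOp_mul, T_zero, zero_add]

theorem dOp_mul_dMul (f g : M n) (α : H n) : dOp g α * dMul n f = dOp (g * T α f) α := by
  rw [dMul_eq_dOp, dOp_mul, add_zero]

theorem dOp_add (f g : M n) (α : H n) : dOp f α + dOp g α = dOp (f + g) α := by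
  refine Dh.ext fun k => ?_
  rw [map_add, LinearMap.add_apply, dOp_apply, dOp_apply, dOp_apply, add_mul]

theorem dOp_zero (α : H n) : dOp (0 : M n) α = 0 := by
  refine Dh.ext fun k => ?_
  rw [map_zero, dOp_apply, zero_mul, LinearMap.zero_apply]

theorem smul_dOp (c : ℂ) (f : M n) (α : H n) : c • dOp f α = dOp (c • f) α := by
  refine Dh.ext fun k => ?_
  rw [map_smul, LinearMap.smul_apply, dOp_apply, dOp_apply, smul_mul_assoc]

/-- Off the diagonal the graded pieces are zero. The conditional equality of degrees covers this
case with the same normal form. -/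
theorem exists_dOp_of_mem {α β : H n} {x : Dh n} (hx : x ∈ grade α β) :
    ∃ f : M n, x = dOp f (-α) ∧ (f ≠ 0 → α = β) := by
  refine Submodule.span_induction ?_ ⟨0, (dOp_zero _).symm, fun h => (h rfl).elim⟩ ?_ ?_ hx
  · rintro _ ⟨rfl, f, rfl⟩; exact ⟨f, rfl, fun _ => rfl⟩
  · rintro _ _ _ _ ⟨f, rfl, hf⟩ ⟨g, rfl, hg⟩
    refine ⟨f + g, dOp_add _ _ _, fun h => ?_⟩
    by_cases h0 : f = 0
    · rw [h0, zero_add] at h; exact hg h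
    · exact hf h0
  · rintro c _ _ ⟨f, rfl, hf⟩
    exact ⟨c • f, smul_dOp _ _ _, fun h => hf (by rintro rfl; simp at h)⟩

instance : GradedMul n (Dh n) where
  mul_mem {α β γ δ x y} hx hy := by
    obtain ⟨f, rfl, hf⟩ := exists_dOp_of_mem hx
    obtain ⟨g, rfl, hg⟩ := exists_dOp_of_mem hy
    rw [dOp_mul]
    by_cases hf0 : f = 0
    · rw [hf0, zero_mul, dOp_zero]; exact zero_mem _
    by_cases hg0 : g = 0
    · rw [hg0, map_zero, mul_zero, dOp_zero]; exact zero_mem _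
    rw [hf hf0, hg hg0, show -β + -δ = -(β + δ) by abel]
    exact dOp_mem _ _

end Difference

/-! Homomorphisms out of `F_R(M(n))` and `F_R(GL(n))`. -/

section Lift

variable {n : ℕ} {q : ℂ}

theorem FM.isRLL (n : ℕ) (q : ℂ) : IsRLL q (FM.ml n q) (FM.mr n q) (FM.t q) where
  comm f g := by
    have := FM.rel (RelM.lr_comm (q := q) f g)
    rwa [map_mul, map_mul] at this
  l_t f i j := by
    have := FM.rel (RelM.l_t (q := q) f i j)
    rwa [map_mul, map_mul] at this
  r_t f i j := by
    have := FM.rel (RelM.r_t (q := q) f i j)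
    rwa [map_mul, map_mul] at this
  rll a b c d := by
    have := FM.rel (RelM.rll (q := q) a b c d)
    simp only [map_sum, map_mul] at this
    exact this

theorem IsRLL.map {A B : Type} [Ring A] [Algebra ℂ A] [Ring B] [Algebra ℂ B] {l r : M n →ₐ[ℂ] A}
    {t : Fin n → Fin n → A} (H : IsRLL q l r t) (φ : A →ₐ[ℂ] B) :
    IsRLL q (φ.comp l) (φ.comp r) (fun i j => φ (t i j)) where
  comm f g := by simpa only [map_mul, AlgHom.comp_apply] using congrArg φ (H.comm f g)
  l_t f i j := by simpa only [map_mul, AlgHom.comp_apply] using congrArg φ (H.l_t f i j)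
  r_t f i j := by simpa only [map_mul, AlgHom.comp_apply] using congrArg φ (H.r_t f i j)
  rll a b c d := by simpa only [map_sum, map_mul, AlgHom.comp_apply] using congrArg φ (H.rll a b c d)

variable {B : Type} [Ring B] [Algebra ℂ B]

/-- The images of the generators. -/
def genMap (l r : M n →ₐ[ℂ] B) (t : Fin n → Fin n → B) : Gen n → B
  | .l f => l f
  | .r f => r f
  | .t i j => t i j

/-- The homomorphism defined by elements satisfying the relations. -/
def FM.lift {l r : M n →ₐ[ℂ] B} {t : Fin n → Fin n → B} (H : IsRLL q l r t) : FM n q →ₐ[ℂ] B :=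
  RingQuot.liftAlgHom ℂ ⟨FreeAlgebra.lift ℂ (genMap l r t), fun x y h => by
    induction h with
    | l_add f g => simp [genMap]
    | l_mul f g => simp [genMap]
    | l_const c => simp only [FreeAlgebra.lift_ι_apply, AlgHom.commutes]; exact l.commutes c
    | r_add f g => simp [genMap]
    | r_mul f g => simp [genMap]
    | r_const c => simp only [FreeAlgebra.lift_ι_apply, AlgHom.commutes]; exact r.commutes c
    | lr_comm f g => simpa [genMap] using H.comm f g
    | l_t f i j => simpa [genMap] using H.l_t f i j
    | r_t f i j => simpa [genMap] using H.r_t f i j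
    | rll a b c d => simpa [genMap] using H.rll a b c d⟩

theorem FM.lift_gen {l r : M n →ₐ[ℂ] B} {t : Fin n → Fin n → B} (H : IsRLL q l r t) (x : Gen n) :
    FM.lift H (FM.gen n q x) = genMap l r t x :=
  (RingQuot.liftAlgHom_mkAlgHom_apply ..).trans (FreeAlgebra.lift_ι_apply _ _)

theorem FM.mk_surjective : Function.Surjective (FM.mk n q) := RingQuot.mkAlgHom_surjective ℂ _

theorem FGL.mk_surjective : Function.Surjective (FGL.mk n q) := RingQuot.mkAlgHom_surjective ℂ _

theorem FGL.ofM_mk (x : FreeAlgebra ℂ (Gen n)) :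
    FGL.ofM n q (FM.mk n q x) = FGL.mk n q (emb n x) :=
  RingQuot.liftAlgHom_mkAlgHom_apply ..

theorem FGL.mk_ι (x : Gen n ⊕ Unit) : FGL.mk n q (FreeAlgebra.ι ℂ x) = FGL.gen n q x := by
  rcases x with x | x
  · have := FGL.ofM_mk (n := n) (q := q) (FreeAlgebra.ι ℂ x)
    rw [emb, FreeAlgebra.lift_ι_apply] at this
    exact this.symm
  · rfl

theorem map_minorOf {A : Type} [Ring A] [Algebra ℂ A] (φ : A →ₐ[ℂ] B) (l : M n → A)
    (t : Fin n → Fin n → A) (I J : Finset (Fin n)) :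
    φ (minorOf q l t I J) = minorOf q (fun f => φ (l f)) (fun i j => φ (t i j)) I J := by
  unfold minorOf
  split_ifs
  · simp only [map_sum, map_mul, map_list_prod, List.map_ofFn]
    rfl
  · exact map_zero _

theorem FM.mk_minorOf (I J : Finset (Fin n)) :
    FM.mk n q (minorOf q fl ft I J) = FM.minor q I J := map_minorOf ..

/-- The homomorphism defined by a homomorphism on `F_R(M(n))` and an inverse of the image of the
determinant with the right commutation relations. -/
def FGL.lift (φ : FM n q →ₐ[ℂ] B) (d : B)
    (h1 : φ (FM.minor q Finset.univ Finset.univ) * d = 1)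
    (h2 : d * φ (FM.minor q Finset.univ Finset.univ) = 1)
    (ht : ∀ i j, φ (FM.t q i j) * d = d * φ (FM.t q i j))
    (hl : ∀ f, φ (FM.ml n q f) * d = d * φ (FM.ml n q (T (-1) f)))
    (hr : ∀ f, φ (FM.mr n q f) * d = d * φ (FM.mr n q (T (-1) f))) : FGL n q →ₐ[ℂ] B :=
  RingQuot.liftAlgHom ℂ
    ⟨FreeAlgebra.lift ℂ (Sum.elim (fun x => φ (FM.gen n q x)) (fun _ => d)), fun x y h => by
      have e : ∀ x, FreeAlgebra.lift ℂ (Sum.elim (fun x => φ (FM.gen n q x)) (fun _ => d))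
          (emb n x) = φ (FM.mk n q x) := by
        intro x
        have : (FreeAlgebra.lift ℂ (Sum.elim (fun x => φ (FM.gen n q x)) (fun _ => d))).comp
            (emb n) = φ.comp (FM.mk n q) := by
          refine FreeAlgebra.hom_ext (funext fun x => ?_)
          simp [emb, FM.gen]
        exact DFunLike.congr_fun this x
      have ed : FreeAlgebra.lift ℂ (Sum.elim (fun x => φ (FM.gen n q x)) (fun _ => d))
          (fdinv n) = d := by simp [fdinv]
      induction h with
      | ofM x y h => rw [e, e, FM.rel h]
      | det_mul => rw [map_mul, fdet, e, ed, FM.mk_minorOf, h1, map_one]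
      | mul_det => rw [map_mul, fdet, e, ed, FM.mk_minorOf, h2, map_one]
      | t_comm i j => rw [map_mul, map_mul, e, ed]; exact ht i j
      | l_comm f => rw [map_mul, map_mul, e, e, ed]; exact hl f
      | r_comm f => rw [map_mul, map_mul, e, e, ed]; exact hr f⟩

section

variable {φ : FM n q →ₐ[ℂ] B} {d : B} {h1 : φ (FM.minor q Finset.univ Finset.univ) * d = 1}
  {h2 : d * φ (FM.minor q Finset.univ Finset.univ) = 1}
  {ht : ∀ i j, φ (FM.t q i j) * d = d * φ (FM.t q i j)}
  {hl : ∀ f, φ (FM.ml n q f) * d = d * φ (FM.ml n q (T (-1) f))}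
  {hr : ∀ f, φ (FM.mr n q f) * d = d * φ (FM.mr n q (T (-1) f))}

theorem FGL.lift_detInv : FGL.lift φ d h1 h2 ht hl hr (FGL.detInv n q) = d :=
  (RingQuot.liftAlgHom_mkAlgHom_apply ..).trans (FreeAlgebra.lift_ι_apply _ _)

theorem FGL.lift_ofM (x : FM n q) : FGL.lift φ d h1 h2 ht hl hr (FGL.ofM n q x) = φ x := by
  obtain ⟨x, rfl⟩ := FM.mk_surjective x
  rw [FGL.ofM_mk]
  have : ((FGL.lift φ d h1 h2 ht hl hr).comp (FGL.mk n q)).comp (emb n) = φ.comp (FM.mk n q) := by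
    refine FreeAlgebra.hom_ext (funext fun x => ?_)
    simp only [Function.comp_apply, AlgHom.comp_apply, emb, FreeAlgebra.lift_ι_apply]
    exact (RingQuot.liftAlgHom_mkAlgHom_apply ..).trans (FreeAlgebra.lift_ι_apply _ _)
  exact DFunLike.congr_fun this x

end

theorem FGL.adjoin_gen : Algebra.adjoin ℂ (Set.range (FGL.gen n q)) = ⊤ := by
  have h := FreeAlgebra.adjoin_range_ι ℂ (Gen n ⊕ Unit)
  have h2 := congrArg (Subalgebra.map (FGL.mk n q)) h
  rw [AlgHom.map_adjoin, Algebra.map_top, (AlgHom.range_eq_top _).2 FGL.mk_surjective] at h2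
  rw [← h2, ← Set.range_comp]
  congr 2
  exact funext fun x => (FGL.mk_ι x).symm

end Lift

/-! Degrees of minors. -/

theorem sum_map_sort {ι G : Type} [LinearOrder ι] [AddCommMonoid G] (J : Finset ι) (f : ι → G) :
    ((J.sort (· ≤ ·)).map f).sum = ∑ j ∈ J, f j := by
  rw [((Finset.sort_perm_toList J (· ≤ ·)).map f).sum_eq, Finset.sum_map_toList]

theorem sum_wt_univ (n : ℕ) : ∑ i : Fin n, (wt i : H n) = 1 :=
  Finset.univ_sum_single (1 : H n)

section Degrees

variable {n : ℕ} {q : ℂ} {A : Type} [Ring A] [Algebra ℂ A] [HPre n A] [GradedMul n A]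
  {t : Fin n → Fin n → A}

theorem colMinor_mem_grade (ht : ∀ i j, t i j ∈ grade (wt i) (wt j)) (L : List (Fin n)) :
    ∀ I : Finset (Fin n), colMinor (hfun q) (ml : M n →ₐ[ℂ] A) t L I ∈
      grade (∑ i ∈ I, wt i) (L.map wt).sum := by
  induction L with
  | nil =>
    intro I
    rw [colMinor_nil]
    split_ifs with h
    · subst h; exact one_mem_grade
    · exact zero_mem _
  | cons c L ih =>
    intro I
    rw [colMinor_cons]
    refine sum_mem fun i hi => ?_
    have := GradedMul.mul_mem (GradedMul.mul_mem
      (ml_mem (A := A) (signFront (hfun q) i (I.erase i))) (ht i c)) (ih (I.erase i))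
    rwa [zero_add, zero_add, Finset.add_sum_erase I _ hi] at this

theorem colMinor_sort_mem_grade (ht : ∀ i j, t i j ∈ grade (wt i) (wt j)) (I J : Finset (Fin n)) :
    colMinor (hfun q) (ml : M n →ₐ[ℂ] A) t (J.sort (· ≤ ·)) I ∈
      grade (∑ i ∈ I, wt i) (∑ j ∈ J, wt j) := by
  have := colMinor_mem_grade (q := q) ht (J.sort (· ≤ ·)) I
  rwa [sum_map_sort] at this

end Degrees

theorem FM.minor_eq {n : ℕ} (q : ℂ) (I J : Finset (Fin n)) :
    FM.minor q I J = colMinor (hfun q) (FM.ml n q) (FM.t q) (J.sort (· ≤ ·)) I := by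
  by_cases h : J.card = I.card
  · exact minorOf_eq_colMinor (FM.isRLL n q).isShifted h
  · rw [colMinor_eq_zero _ _ _ _ _ (by rw [Finset.length_sort]; exact fun h' => h h'.symm)]
    exact dif_neg h

theorem FM.minor_mem_grade {n : ℕ} (q : ℂ) (I J : Finset (Fin n)) :
    FM.minor q I J ∈ grade (∑ i ∈ I, wt i) (∑ j ∈ J, wt j) := by
  rw [FM.minor_eq]
  exact colMinor_sort_mem_grade (FM.t_mem q) I J

/-- Reindexing of sums over pairs of a set and an element not in it. -/
theorem sum_sum_eq_sum_erase {ι B : Type} [Fintype ι] [DecidableEq ι] [AddCommMonoid B]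
    (G : ι → Finset ι → B) (hG : ∀ j I, j ∈ I → G j I = 0) :
    ∑ j, ∑ I, G j I = ∑ I, ∑ i ∈ I, G i (I.erase i) := by
  rw [Finset.sum_comm' (s := Finset.univ) (t := fun I : Finset ι => I) (t' := Finset.univ)
    (s' := fun j => {I : Finset ι | j ∈ I}) (by intro x y; simp)]
  refine Finset.sum_congr rfl fun j _ => ?_
  rw [← Finset.sum_filter_of_ne (p := fun I => j ∉ I) (fun I _ h hj => h (hG j I hj))]
  refine Finset.sum_nbij' (fun I => insert j I) (fun I => I.erase j) ?_ ?_ ?_ ?_ ?_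
  · intro I _; simp
  · intro I _; simp
  · intro I hI; exact Finset.erase_insert (by simpa using hI)
  · intro I hI; exact Finset.insert_erase (by simpa using hI)
  · intro I hI; rw [Finset.erase_insert (by simpa using hI)]

/-! The exterior algebra. -/

section Exterior

variable {n : ℕ} {q : ℂ}

theorem W.w_mul_mom (i : Fin n) (f : M n) :
    W.w q i * W.mom n q f = W.mom n q (T (-wt i) f) * W.w q i := by
  have := W.rel (RelW.f_w (q := q) (T (-wt i) f) i)
  rw [map_mul, map_mul, T_T_neg] at this
  exact this.symm

theorem W.w_mul_self (i : Fin n) : W.w q i * W.w q i = 0 := by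
  have := W.rel (RelW.sq (q := q) i)
  rwa [map_mul, map_zero] at this

theorem W.w_mul_w {y x : Fin n} (h : y < x) :
    W.w q x * W.w q y = W.mom n q (-hfun q x y) * (W.w q y * W.w q x) := by
  have := W.rel (RelW.anti (q := q) y x h)
  rw [map_mul, map_mul, map_mul] at this
  rw [← mul_assoc]
  exact this

theorem W.prod_mul_mom (P : List (Fin n)) (f : M n) :
    ∃ g, (P.map (W.w q)).prod * W.mom n q f = W.mom n q g * (P.map (W.w q)).prod := by
  induction P generalizing f with
  | nil => exact ⟨f, by simp⟩
  | cons p P ih =>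
    obtain ⟨g, hg⟩ := ih f
    refine ⟨T (-wt p) g, ?_⟩
    rw [List.map_cons, List.prod_cons, mul_assoc, hg, ← mul_assoc, W.w_mul_mom, mul_assoc]

theorem W.prod_mul_mom_of_invariant (P : List (Fin n)) (f : M n)
    (hf : ∀ p ∈ P, T (-wt p) f = f) :
    (P.map (W.w q)).prod * W.mom n q f = W.mom n q f * (P.map (W.w q)).prod := by
  induction P with
  | nil => simp
  | cons p P ih =>
    rw [List.map_cons, List.prod_cons, mul_assoc, ih fun p hp => hf p (List.mem_cons_of_mem _ hp),
      ← mul_assoc, W.w_mul_mom, mul_assoc, hf p (by simp)]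

/-- A scalar produced by an exchange inside a word must cross the preceding letters `w_p`, which
translate it. It is fixed when these letters differ from `x` and `y`; otherwise some translate of it
appears. -/
theorem W.isAlternating (hq0 : q ≠ 0) (hq1 : 2 ≤ n → q ≠ 1) :
    IsAlternating (hfun q) (W.mom n q) (fun L : List (Fin n) => (L.map (W.w q)).prod) where
  dup P x Q := by
    simp only [List.map_append, List.map_cons, List.prod_append, List.prod_cons]
    rw [← mul_assoc (W.w q x), W.w_mul_self, zero_mul, mul_zero]
  swap P x y Q hxy hx hy := by
    simp only [List.map_append, List.map_cons, List.prod_append, List.prod_cons]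
    rw [← mul_assoc (W.w q x), W.w_mul_w hxy, mul_assoc, ← mul_assoc (List.prod _),
      W.prod_mul_mom_of_invariant, mul_assoc, mul_assoc]
    intro p hp
    rw [map_neg, T_neg_wt_hfun]
    · rintro rfl; exact hx hp
    · rintro rfl; exact hy hp
  exists_swap P x y Q hxy := by
    have hq1 := hq1 (by have := Fin.val_ne_of_ne hxy; omega)
    have : ∃ u, W.w q x * W.w q y = W.mom n q u * (W.w q y * W.w q x) := by
      rcases lt_or_gt_of_ne hxy with h | h
      · refine ⟨(-hfun q y x)⁻¹, ?_⟩
        rw [W.w_mul_w h, ← mul_assoc, ← map_mul,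
          inv_mul_cancel₀ (neg_ne_zero.2 (hfun_ne_zero hq0 hq1 h.ne')), map_one, one_mul]
      · exact ⟨_, W.w_mul_w h⟩
    obtain ⟨u, hu⟩ := this
    obtain ⟨v, hv⟩ := W.prod_mul_mom (q := q) P u
    refine ⟨v, ?_⟩
    simp only [List.map_append, List.map_cons, List.prod_append, List.prod_cons]
    rw [← mul_assoc (W.w q x), hu, mul_assoc, ← mul_assoc (List.prod _), hv, mul_assoc, mul_assoc]

theorem W.wI_mem (q : ℂ) (I : Finset (Fin n)) :
    W.wI q I ∈ rgrade (A := W n q) (∑ i ∈ I, wt i) := by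
  have := word_mem_wordSpan (W.gen n q) GenW.deg ((I.sort (· ≤ ·)).map GenW.w)
  rw [List.map_map, List.map_map] at this
  have e : ((I.sort (· ≤ ·)).map (GenW.deg ∘ GenW.w)).sum = ∑ i ∈ I, wt i := sum_map_sort I wt
  rw [e] at this
  exact this

theorem corepW_eq (i : Fin n) : corepW q i = ∑ j, tm n (W.w q j) (FM.t q j i) :=
  Finset.sum_congr rfl fun _ _ => tmul_eq_tm _ _

/-- Prefixing a column `c` multiplies by `∑_j w_j ⊗ t_{jc}`. Sorting `w_j w_I` kills the terms with
`j ∈ I` and otherwise produces `signFront`, which crosses `⊗̃` and becomes the coefficient in `μ_l`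
of the expansion along the first column. The statement for arbitrary words is what the induction
needs. -/
theorem prod_corepW (hq0 : q ≠ 0) (hq1 : 2 ≤ n → q ≠ 1) (L : List (Fin n)) :
    (L.map (corepW q)).prod =
      ∑ I, tm n (W.wI q I) (colMinor (hfun q) (FM.ml n q) (FM.t q) L I) := by
  have hwt : ∀ j i : Fin n, Matching n (W.w q j) (FM.t q j i) := fun j i =>
    Matching.of_mem (W.w_mem q j) (mem_lgrade (FM.t_mem q j i))
  induction L with
  | nil =>
    rw [Finset.sum_eq_single ∅]
    · rw [colMinor_nil, if_pos rfl, W.wI, Finset.sort_empty]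
      exact tm_one_one.symm
    · intro I _ hI
      rw [colMinor_nil, if_neg hI, tm_zero_right]
    · intro h; exact (h (Finset.mem_univ _)).elim
  | cons c L ih =>
    have hm : ∀ I, Matching n (W.wI q I) (colMinor (hfun q) (FM.ml n q) (FM.t q) L I) := fun I =>
      Matching.of_mem (W.wI_mem q I) (mem_lgrade (colMinor_mem_grade (FM.t_mem q) L I))
    rw [List.map_cons, List.prod_cons, ih, corepW_eq, Finset.sum_mul]
    simp only [Finset.mul_sum]
    have e1 : ∀ j I, tm n (W.w q j) (FM.t q j c) *
        tm n (W.wI q I) (colMinor (hfun q) (FM.ml n q) (FM.t q) L I) =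
        tm n (W.w q j * W.wI q I) (FM.t q j c * colMinor (hfun q) (FM.ml n q) (FM.t q) L I) :=
      fun j I => (hwt j c).tm_mul (hm I)
    simp only [e1]
    have alt := W.isAlternating hq0 hq1
    rw [sum_sum_eq_sum_erase (fun j I => tm n (W.w q j * W.wI q I)
      (FM.t q j c * colMinor (hfun q) (FM.ml n q) (FM.t q) L I))]
    · refine Finset.sum_congr rfl fun I _ => ?_
      have e2 : ∀ i ∈ I, W.w q i * W.wI q (I.erase i) =
          W.mom n q (signFront (hfun q) i (I.erase i)) * W.wI q I := by
        intro i hi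
        have := alt.cons_sort (Finset.notMem_erase i I)
        rwa [List.map_cons, List.prod_cons, Finset.insert_erase hi] at this
      have h3 : ∀ i ∈ I, Matching n (W.wI q I)
          (FM.t q i c * colMinor (hfun q) (FM.ml n q) (FM.t q) L (I.erase i)) := by
        intro i hi
        refine Matching.of_mem (W.wI_mem q I) (mem_lgrade (β := wt c + (L.map wt).sum) ?_)
        have := GradedMul.mul_mem (FM.t_mem q i c)
          (colMinor_mem_grade (q := q) (FM.t_mem q) L (I.erase i))
        rwa [Finset.add_sum_erase I _ hi] at this
      rw [colMinor_cons, tm_sum_right]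
      · refine Finset.sum_congr rfl fun i hi => ?_
        rw [e2 i hi, mul_assoc]
        exact (h3 i hi).tm_rmom_mul _
      · intro i hi
        rw [mul_assoc]
        exact (h3 i hi).lmom_mul _
    · intro j I hj
      have := alt.cons_sort_of_mem hj
      rw [List.map_cons, List.prod_cons] at this
      rw [W.wI, this, tm_zero_left]

theorem isMatrixElements_minor (hq0 : q ≠ 0) (hq1 : 2 ≤ n → q ≠ 1) :
    IsMatrixElements (n := n) q (FM.minor q) := by
  refine ⟨fun I J h => dif_neg (Ne.symm h), W.wI_mem q, FM.minor_mem_grade q, fun J => ?_⟩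
  rw [corepWJ, prod_corepW hq0 hq1, Finset.sum_filter]
  refine Finset.sum_congr rfl fun I _ => ?_
  split_ifs with h
  · rw [tmul_eq_tm, FM.minor_eq]
  · rw [colMinor_eq_zero, tm_zero_right]
    rwa [Finset.length_sort]

end Exterior

theorem sum_comm₂ {ι κ B : Type} [Fintype ι] [Fintype κ] [AddCommMonoid B]
    (f : ι → ι → κ → κ → B) :
    ∑ x, ∑ y, ∑ k, ∑ m, f x y k m = ∑ k, ∑ m, ∑ x, ∑ y, f x y k m := by
  rw [Finset.sum_congr rfl fun x _ => Finset.sum_comm, Finset.sum_comm]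
  refine Finset.sum_congr rfl fun k _ => ?_
  rw [Finset.sum_congr rfl fun x _ => Finset.sum_comm, Finset.sum_comm]

/-! The comultiplication of the quadratic relations and of the minors. -/

section Comultiplication

variable {n : ℕ} {q : ℂ} {A : Type} [Ring A] [Algebra ℂ A] [HPre n A] [GradedMul n A]
  {t : Fin n → Fin n → A}

/-- `∑_k t_{ik} ⊗ t_{kj}`. -/
def matComul (t : Fin n → Fin n → A) (i j : Fin n) : MTensor n A A :=
  ∑ k, tm n (t i k) (t k j)

/-- In the left factor `RLL` turns the `R`-matrix in `μ_l` into the `R`-matrix in `μ_r`. Across `⊗̃`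
this is the `R`-matrix in `μ_l` of the right factor, where `RLL` applies once more. -/
theorem IsRLL.matComul (H : IsRLL q (ml : M n →ₐ[ℂ] A) mr t)
    (ht : ∀ i j, t i j ∈ grade (wt i) (wt j)) :
    IsRLL q (ml : M n →ₐ[ℂ] MTensor n A A) mr (matComul t) := by
  have hm : ∀ i k j, Matching n (t i k) (t k j) := fun i k j => Matching.of_grade (ht i k) (ht k j)
  refine ⟨fun f g => ?_, fun f i j => ?_, fun f i j => ?_, fun a b c d => ?_⟩
  · rw [ml_tensor, mr_tensor, (Matching.ml_one f).tm_mul (Matching.one_mr g),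
      (Matching.one_mr g).tm_mul (Matching.ml_one f)]
    simp
  · simp only [DynGL.matComul, Finset.mul_sum, Finset.sum_mul]
    refine Finset.sum_congr rfl fun k _ => ?_
    rw [(hm i k j).tm_ml_mul, (hm i k j).tm_mul_ml, H.l_t]
  · simp only [DynGL.matComul, Finset.mul_sum, Finset.sum_mul]
    refine Finset.sum_congr rfl fun k _ => ?_
    rw [(hm i k j).tm_mr_mul, (hm i k j).tm_mul_mr, H.r_t]
  · have hmm : ∀ x k y m, Matching n (t x k * t y m) (t k b * t m d) := fun x k y m =>
      (hm x k b).mul (hm y m d)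
    have e1 : ∀ x y, ml (Rmat q x y a c) * DynGL.matComul t x b * DynGL.matComul t y d =
        ∑ k, ∑ m, tm n (ml (Rmat q x y a c) * t x k * t y m) (t k b * t m d) := by
      intro x y
      simp only [DynGL.matComul, Finset.mul_sum, Finset.sum_mul]
      rw [Finset.sum_comm]
      refine Finset.sum_congr rfl fun k _ => Finset.sum_congr rfl fun m _ => ?_
      rw [(hm x k b).tm_ml_mul, ((hm x k b).ml_mul _).tm_mul (hm y m d)]
    have e2 : ∀ x y, mr (Rmat q b d x y) * DynGL.matComul t c y * DynGL.matComul t a x =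
        ∑ u, ∑ v, tm n (t c v * t a u) (mr (Rmat q b d x y) * t v y * t u x) := by
      intro x y
      simp only [DynGL.matComul, Finset.mul_sum, Finset.sum_mul]
      refine Finset.sum_congr rfl fun u _ => Finset.sum_congr rfl fun v _ => ?_
      rw [mul_assoc, (hm c v y).tm_mul (hm a u x), ((hm c v y).mul (hm a u x)).tm_mr_mul, mul_assoc]
    -- The inner degrees of such a term match only if `{x,y} = {k,m}`. In all other cases the matrix
    -- element of `R` vanishes, so every term makes sense in `⊗̃`.
    have m1 : ∀ k m x y, Matching n (mr (Rmat q k m x y) * t c y * t a x) (t k b * t m d) ∧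
        Matching n (t c y * t a x) (ml (Rmat q k m x y) * t k b * t m d) ∧
        tm n (mr (Rmat q k m x y) * t c y * t a x) (t k b * t m d) =
          tm n (t c y * t a x) (ml (Rmat q k m x y) * t k b * t m d) := by
      intro k m x y
      by_cases h : (x = k ∧ y = m) ∨ (x = m ∧ y = k)
      · have : Matching n (t c y * t a x) (t k b * t m d) := by
          rcases h with ⟨rfl, rfl⟩ | ⟨rfl, rfl⟩
          · refine Matching.of_grade (GradedMul.mul_mem (ht c y) (ht a x)) (β := wt b + wt d) ?_
            rw [add_comm (wt y)]
            exact GradedMul.mul_mem (ht x b) (ht y d)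
          · exact (hm c y b).mul (hm a x d)
        rw [mul_assoc, mul_assoc]
        exact ⟨this.rmom_mul _, this.lmom_mul _, this.tm_rmom_mul _⟩
      · rw [not_or] at h
        rw [Rmat_eq_zero h.1 h.2, map_zero, map_zero, zero_mul, zero_mul, zero_mul, zero_mul]
        exact ⟨Matching.zero_left _, Matching.zero_right _, by rw [tm_zero_left, tm_zero_right]⟩
    have s1 : ∀ k m, ∑ x, ∑ y, tm n (ml (Rmat q x y a c) * t x k * t y m) (t k b * t m d) =
        ∑ x, ∑ y, tm n (mr (Rmat q k m x y) * t c y * t a x) (t k b * t m d) := by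
      intro k m
      have h1 : ∀ x y, Matching n (ml (Rmat q x y a c) * t x k * t y m) (t k b * t m d) := by
        intro x y; rw [mul_assoc]; exact (hmm x k y m).ml_mul _
      have := congrArg (fun z => tm n z (t k b * t m d)) (H.rll a k c m)
      rw [tm_sum_left fun x _ => Matching.sum_left fun y _ => h1 x y,
        tm_sum_left fun x _ => Matching.sum_left fun y _ => (m1 k m x y).1] at this
      simp only [tm_sum_left fun y _ => h1 _ y, tm_sum_left fun y _ => (m1 k m _ y).1] at this
      exact this
    have s2 : ∀ x y, ∑ k, ∑ m, tm n (t c y * t a x) (ml (Rmat q k m x y) * t k b * t m d) =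
        ∑ u, ∑ v, tm n (t c y * t a x) (mr (Rmat q b d u v) * t y v * t x u) := by
      intro x y
      have h1 : ∀ u v, Matching n (t c y * t a x) (mr (Rmat q b d u v) * t y v * t x u) := by
        intro u v
        rw [mul_assoc]
        simpa using (Matching.one_mr (A := A) (B := A) (Rmat q b d u v)).mul
          ((hm c y v).mul (hm a x u))
      have := congrArg (fun z => tm n (t c y * t a x) z) (H.rll x b y d)
      rw [tm_sum_right fun k _ => Matching.sum_right fun m _ => (m1 k m x y).2.1,
        tm_sum_right fun u _ => Matching.sum_right fun v _ => h1 u v] at this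
      simp only [tm_sum_right fun m _ => (m1 _ m x y).2.1, tm_sum_right fun v _ => h1 _ v] at this
      exact this
    simp only [e1, e2]
    calc ∑ x, ∑ y, ∑ k, ∑ m, tm n (ml (Rmat q x y a c) * t x k * t y m) (t k b * t m d)
        = ∑ k, ∑ m, ∑ x, ∑ y, tm n (ml (Rmat q x y a c) * t x k * t y m) (t k b * t m d) :=
          sum_comm₂ _
      _ = ∑ k, ∑ m, ∑ x, ∑ y, tm n (t c y * t a x) (ml (Rmat q k m x y) * t k b * t m d) := by
          refine Finset.sum_congr rfl fun k _ => Finset.sum_congr rfl fun m _ => ?_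
          rw [s1]
          exact Finset.sum_congr rfl fun x _ => Finset.sum_congr rfl fun y _ => (m1 k m x y).2.2
      _ = ∑ x, ∑ y, ∑ k, ∑ m, tm n (t c y * t a x) (ml (Rmat q k m x y) * t k b * t m d) :=
          sum_comm₂ _
      _ = ∑ x, ∑ y, ∑ u, ∑ v, tm n (t c y * t a x) (mr (Rmat q b d u v) * t y v * t x u) := by
          refine Finset.sum_congr rfl fun x _ => Finset.sum_congr rfl fun y _ => s2 x y
      _ = _ := sum_comm₂ _

/-- A Cauchy–Binet formula. Expanding along the first column puts an index `k` in front of the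
sorted columns `K` of the left minor. Alternation removes the case `k ∈ K` and otherwise sorts `k`
into place with a sign in `μ_r`, which crosses to the right factor and becomes the sign of its own
expansion along the column `c`. -/
theorem colMinor_matComul (H : IsRLL q (ml : M n →ₐ[ℂ] A) mr t)
    (ht : ∀ i j, t i j ∈ grade (wt i) (wt j)) (hq0 : q ≠ 0) (hq1 : 2 ≤ n → q ≠ 1)
    (L : List (Fin n)) : ∀ I : Finset (Fin n),
    colMinor (hfun q) (ml : M n →ₐ[ℂ] MTensor n A A) (matComul t) L I =
      ∑ K : Finset (Fin n), tm n (colMinor (hfun q) ml t (K.sort (· ≤ ·)) I)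
        (colMinor (hfun q) ml t L K) := by
  have hm : ∀ i k j, Matching n (t i k) (t k j) := fun i k j => Matching.of_grade (ht i k) (ht k j)
  have hX : ∀ L I K, Matching n (colMinor (hfun q) (ml : M n →ₐ[ℂ] A) t (K.sort (· ≤ ·)) I)
      (colMinor (hfun q) ml t L K) := fun L I K =>
    Matching.of_grade (colMinor_sort_mem_grade ht I K) (colMinor_mem_grade ht L K)
  induction L with
  | nil =>
    intro I
    rw [Finset.sum_eq_single ∅]
    · rw [Finset.sort_empty, colMinor_nil, colMinor_nil, colMinor_nil, if_pos rfl]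
      split_ifs
      · exact tm_one_one.symm
      · exact (tm_zero_left _).symm
    · intro K _ hK
      rw [colMinor_nil, if_neg hK, tm_zero_right]
    · intro h; exact (h (Finset.mem_univ _)).elim
  | cons c L ih =>
    intro I
    have alt := (H.isDynMatrix hq0 hq1).isAlternating I
    have h1 : ∀ i k K, Matching n (ml (signFront (hfun q) i (I.erase i)) * t i k *
        colMinor (hfun q) ml t (K.sort (· ≤ ·)) (I.erase i))
        (t k c * colMinor (hfun q) ml t L K) := fun i k K =>
      ((hm i k c).ml_mul _).mul (hX L (I.erase i) K)
    have e1 : colMinor (hfun q) (ml : M n →ₐ[ℂ] MTensor n A A) (matComul t) (c :: L) I =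
        ∑ k, ∑ K : Finset (Fin n), tm n (colMinor (hfun q) ml t (k :: K.sort (· ≤ ·)) I)
          (t k c * colMinor (hfun q) ml t L K) := by
      have e0 : ∀ i k (K : Finset (Fin n)), ml (signFront (hfun q) i (I.erase i)) *
          tm n (t i k) (t k c) * tm n (colMinor (hfun q) ml t (K.sort (· ≤ ·)) (I.erase i))
            (colMinor (hfun q) ml t L K) =
          tm n (ml (signFront (hfun q) i (I.erase i)) * t i k *
            colMinor (hfun q) ml t (K.sort (· ≤ ·)) (I.erase i))
            (t k c * colMinor (hfun q) ml t L K) := fun i k K => by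
        rw [(hm i k c).tm_ml_mul, ((hm i k c).ml_mul _).tm_mul (hX L (I.erase i) K)]
      rw [colMinor_cons]
      simp only [ih, matComul, Finset.mul_sum, Finset.sum_mul, e0]
      have e3 : ∀ k (K : Finset (Fin n)),
          tm n (colMinor (hfun q) ml t (k :: K.sort (· ≤ ·)) I)
            (t k c * colMinor (hfun q) ml t L K) =
          ∑ i ∈ I, tm n (ml (signFront (hfun q) i (I.erase i)) * t i k *
            colMinor (hfun q) ml t (K.sort (· ≤ ·)) (I.erase i))
            (t k c * colMinor (hfun q) ml t L K) := fun k K => by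
        rw [colMinor_cons, tm_sum_left fun i _ => h1 i k K]
      simp only [e3]
      rw [Finset.sum_congr rfl fun i _ => Finset.sum_comm, Finset.sum_comm]
      exact Finset.sum_congr rfl fun k _ => Finset.sum_comm
    rw [e1, sum_sum_eq_sum_erase (fun k K => tm n
      (colMinor (hfun q) ml t (k :: K.sort (· ≤ ·)) I) (t k c * colMinor (hfun q) ml t L K))]
    · refine Finset.sum_congr rfl fun K _ => ?_
      have h3 : ∀ k ∈ K, Matching n (colMinor (hfun q) (ml : M n →ₐ[ℂ] A) t (K.sort (· ≤ ·)) I)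
          (t k c * colMinor (hfun q) ml t L (K.erase k)) := by
        intro k hk
        refine Matching.of_grade (colMinor_sort_mem_grade ht I K) (β := wt c + (L.map wt).sum) ?_
        have := GradedMul.mul_mem (ht k c) (colMinor_mem_grade (q := q) ht L (K.erase k))
        rwa [Finset.add_sum_erase K _ hk] at this
      rw [colMinor_cons, tm_sum_right]
      · refine Finset.sum_congr rfl fun k hk => ?_
        have := alt.cons_sort (Finset.notMem_erase k K)
        rw [Finset.insert_erase hk] at this
        rw [this, mul_assoc]
        exact (h3 k hk).tm_rmom_mul _
      · intro k hk
        rw [mul_assoc]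
        exact (h3 k hk).lmom_mul _
    · intro k K hk
      rw [alt.cons_sort_of_mem hk, tm_zero_left]

end Comultiplication

/-- Minors of a diagonal matrix. -/
theorem colMinor_diagonal {ι K A : Type} [LinearOrder ι] [Field K] [Algebra ℂ K] [Ring A]
    [Algebra ℂ A] (h : ι → ι → K) (l : K →ₐ[ℂ] A) (d : ι → A) (L : List ι)
    (hL : L.Pairwise (· < ·)) : ∀ I : Finset ι,
    colMinor h l (fun i j => if i = j then d i else 0) L I =
      if I = L.toFinset then (L.map d).prod else 0 := by
  induction L with
  | nil => intro I; rw [colMinor_nil]; simp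
  | cons c L ih =>
    intro I
    rw [List.pairwise_cons] at hL
    have hc : c ∉ L.toFinset := fun h => lt_irrefl c (hL.1 c (List.mem_toFinset.1 h))
    rw [colMinor_cons]
    simp only [mul_ite, ite_mul, mul_zero, zero_mul, Finset.sum_ite_eq']
    rw [ih hL.2, List.toFinset_cons]
    by_cases h1 : I = insert c L.toFinset
    · subst h1
      rw [if_pos (Finset.mem_insert_self _ _), Finset.erase_insert hc, if_pos rfl, if_pos rfl,
        List.map_cons, List.prod_cons]
      have : signFront h c L.toFinset = 1 := Finset.prod_eq_one fun m hm =>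
        if_neg (hL.1 m (List.mem_toFinset.1 hm)).not_gt
      rw [this, map_one, one_mul]
    · rw [if_neg h1]
      split_ifs with h2 h3
      · exact (h1 (by rw [← h3, Finset.insert_erase h2])).elim
      · exact mul_zero _
      · rfl

/-! The algebra `F_R(GL(n))`. -/

section GeneralLinear

variable {n : ℕ} {q : ℂ}

section FMLift

variable {B : Type} [Ring B] [Algebra ℂ B] {l r : M n →ₐ[ℂ] B} {t : Fin n → Fin n → B}

theorem FM.lift_ml (H : IsRLL q l r t) (f : M n) : FM.lift H (FM.ml n q f) = l f :=
  FM.lift_gen H (.l f)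

theorem FM.lift_mr (H : IsRLL q l r t) (f : M n) : FM.lift H (FM.mr n q f) = r f :=
  FM.lift_gen H (.r f)

theorem FM.lift_t (H : IsRLL q l r t) (i j : Fin n) : FM.lift H (FM.t q i j) = t i j :=
  FM.lift_gen H (.t i j)

theorem FM.lift_minor (H : IsRLL q l r t) (I J : Finset (Fin n)) :
    FM.lift H (FM.minor q I J) = colMinor (hfun q) l t (J.sort (· ≤ ·)) I := by
  rw [FM.minor_eq, map_colMinor]
  have e1 : (FM.lift H).comp (FM.ml n q) = l := AlgHom.ext (FM.lift_ml H)
  have e2 : (fun i j => FM.lift H (FM.t q i j)) = t := funext fun i => funext (FM.lift_t H i)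
  rw [e1, e2]

end FMLift

theorem FGL.isRLL (n : ℕ) (q : ℂ) : IsRLL q (ml : M n →ₐ[ℂ] FGL n q) mr (FGL.t q) :=
  (FM.isRLL n q).map (FGL.ofM n q)

theorem FGL.minor_eq (q : ℂ) (I J : Finset (Fin n)) :
    FGL.minor q I J =
      colMinor (hfun q) (ml : M n →ₐ[ℂ] FGL n q) (FGL.t q) (J.sort (· ≤ ·)) I := by
  rw [FGL.minor, FM.minor_eq, map_colMinor]
  rfl

theorem FGL.minor_mem_grade (q : ℂ) (I J : Finset (Fin n)) :
    FGL.minor q I J ∈ grade (∑ i ∈ I, wt i) (∑ j ∈ J, wt j) := by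
  rw [FGL.minor_eq]
  exact colMinor_sort_mem_grade (FGL.t_mem q) I J

theorem FGL.det_mem_grade (n : ℕ) (q : ℂ) : FGL.det n q ∈ grade (1 : H n) 1 := by
  have := FGL.minor_mem_grade q (Finset.univ : Finset (Fin n)) Finset.univ
  rwa [sum_wt_univ] at this

theorem FGL.rel {x y : FreeAlgebra ℂ (Gen n ⊕ Unit)} (h : RelGL n q x y) :
    FGL.mk n q x = FGL.mk n q y := RingQuot.mkAlgHom_rel ℂ h

theorem FGL.mk_fdet : FGL.mk n q (fdet n q) = FGL.det n q := by
  rw [fdet, ← FGL.ofM_mk, FM.mk_minorOf]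
  rfl

theorem FGL.det_mul_detInv : FGL.det n q * FGL.detInv n q = 1 := by
  have := FGL.rel (RelGL.det_mul (n := n) (q := q))
  rwa [map_mul, map_one, FGL.mk_fdet] at this

theorem FGL.detInv_mul_det : FGL.detInv n q * FGL.det n q = 1 := by
  have := FGL.rel (RelGL.mul_det (n := n) (q := q))
  rwa [map_mul, map_one, FGL.mk_fdet] at this

theorem FGL.t_mul_detInv (i j : Fin n) :
    FGL.t q i j * FGL.detInv n q = FGL.detInv n q * FGL.t q i j := by
  have := FGL.rel (RelGL.t_comm (q := q) i j)
  rw [map_mul, map_mul, ← FGL.ofM_mk] at this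
  exact this

theorem FGL.ml_mul_detInv (f : M n) :
    (ml f : FGL n q) * FGL.detInv n q = FGL.detInv n q * ml (T (-1) f) := by
  have := FGL.rel (RelGL.l_comm (q := q) f)
  rw [map_mul, map_mul, ← FGL.ofM_mk, ← FGL.ofM_mk] at this
  exact this

theorem FGL.mr_mul_detInv (f : M n) :
    (mr f : FGL n q) * FGL.detInv n q = FGL.detInv n q * mr (T (-1) f) := by
  have := FGL.rel (RelGL.r_comm (q := q) f)
  rw [map_mul, map_mul, ← FGL.ofM_mk, ← FGL.ofM_mk] at this
  exact this

/-- Induction over the generators. -/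
theorem FGL.gen_cases {p : FGL n q → H n × H n → Prop} (hl : ∀ f : M n, p (ml f) 0)
    (hr : ∀ f : M n, p (mr f) 0) (ht : ∀ i j, p (FGL.t q i j) (wt i, wt j))
    (hd : p (FGL.detInv n q) (-1, -1)) (x : Gen n ⊕ Unit) : p (FGL.gen n q x) (FGL.deg n x) :=
  match x with
  | .inl (.l f) => hl f
  | .inl (.r f) => hr f
  | .inl (.t i j) => ht i j
  | .inr _ => hd

theorem FGL.word_induction {p : FGL n q → H n × H n → Prop} (h1 : p 1 0) (hl : ∀ f : M n, p (ml f) 0)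
    (hr : ∀ f : M n, p (mr f) 0) (ht : ∀ i j, p (FGL.t q i j) (wt i, wt j))
    (hd : p (FGL.detInv n q) (-1, -1))
    (hmul : ∀ a b α β, p a α → p b β → p (a * b) (α + β)) (w : List (Gen n ⊕ Unit)) :
    p (w.map (FGL.gen n q)).prod (w.map (FGL.deg n)).sum := by
  induction w with
  | nil => exact h1
  | cons x w ih =>
    rw [List.map_cons, List.prod_cons, List.map_cons, List.sum_cons]
    exact hmul _ _ _ _ (FGL.gen_cases hl hr ht hd x) ih

theorem FGL.induction {p : FGL n q → Prop} (halg : ∀ c, p (algebraMap ℂ _ c))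
    (hl : ∀ f : M n, p (ml f)) (hr : ∀ f : M n, p (mr f)) (ht : ∀ i j, p (FGL.t q i j))
    (hd : p (FGL.detInv n q)) (hadd : ∀ a b, p a → p b → p (a + b))
    (hmul : ∀ a b, p a → p b → p (a * b)) (a : FGL n q) : p a := by
  have ha : a ∈ Algebra.adjoin ℂ (Set.range (FGL.gen n q)) := FGL.adjoin_gen ▸ Algebra.mem_top
  refine Algebra.adjoin_induction ?_ halg (fun a b _ _ => hadd a b) (fun a b _ _ => hmul a b) ha
  rintro _ ⟨x, rfl⟩
  exact FGL.gen_cases (p := fun a _ => p a) hl hr ht hd x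

theorem FGL.ml_mul_word (f : M n) (w : List (Gen n ⊕ Unit)) :
    ml f * (w.map (FGL.gen n q)).prod =
      (w.map (FGL.gen n q)).prod * ml (T (w.map (FGL.deg n)).sum.1 f) := by
  revert f
  refine FGL.word_induction (p := fun a α => ∀ f, ml f * a = a * ml (T α.1 f)) ?_ ?_ ?_ ?_ ?_ ?_ w
  · intro f; rw [mul_one, one_mul, Prod.fst_zero, T_zero]
  · intro g f; rw [Prod.fst_zero, T_zero, ← map_mul, ← map_mul, mul_comm]
  · intro g f; rw [Prod.fst_zero, T_zero]; exact (FGL.isRLL n q).comm f g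
  · intro i j f; exact (FGL.isRLL n q).l_t f i j
  · exact FGL.ml_mul_detInv
  · intro a b α β ha hb f
    rw [← mul_assoc, ha, mul_assoc, hb, T_T, mul_assoc, Prod.fst_add, add_comm]

theorem FGL.mr_mul_word (f : M n) (w : List (Gen n ⊕ Unit)) :
    mr f * (w.map (FGL.gen n q)).prod =
      (w.map (FGL.gen n q)).prod * mr (T (w.map (FGL.deg n)).sum.2 f) := by
  revert f
  refine FGL.word_induction (p := fun a α => ∀ f, mr f * a = a * mr (T α.2 f)) ?_ ?_ ?_ ?_ ?_ ?_ w
  · intro f; rw [mul_one, one_mul, Prod.snd_zero, T_zero]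
  · intro g f; rw [Prod.snd_zero, T_zero]; exact ((FGL.isRLL n q).comm g f).symm
  · intro g f; rw [Prod.snd_zero, T_zero, ← map_mul, ← map_mul, mul_comm]
  · intro i j f; exact (FGL.isRLL n q).r_t f i j
  · exact FGL.mr_mul_detInv
  · intro a b α β ha hb f
    rw [← mul_assoc, ha, mul_assoc, hb, T_T, mul_assoc, Prod.snd_add, add_comm]

theorem FGL.ml_mul {α β : H n} (f : M n) {a : FGL n q} (ha : a ∈ grade α β) :
    ml f * a = a * ml (T α f) := by
  refine wordSpan_induction (gen := FGL.gen n q) (deg := FGL.deg n) (δ := (α, β))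
    (p := fun a => ml f * a = a * ml (T α f)) (by simp) ?_ ?_ ?_ ha
  · intro a b h h'; rw [mul_add, add_mul, h, h']
  · intro c a h; rw [mul_smul_comm, smul_mul_assoc, h]
  · intro w hw; rw [FGL.ml_mul_word, hw]

theorem FGL.mr_mul {α β : H n} (f : M n) {a : FGL n q} (ha : a ∈ grade α β) :
    mr f * a = a * mr (T β f) := by
  refine wordSpan_induction (gen := FGL.gen n q) (deg := FGL.deg n) (δ := (α, β))
    (p := fun a => mr f * a = a * mr (T β f)) (by simp) ?_ ?_ ?_ ha
  · intro a b h h'; rw [mul_add, add_mul, h, h']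
  · intro c a h; rw [mul_smul_comm, smul_mul_assoc, h]
  · intro w hw; rw [FGL.mr_mul_word, hw]

theorem FGL.ml_mul_of_lgrade {γ : H n} (f : M n) {a : FGL n q} (ha : a ∈ lgrade γ) :
    ml f * a = a * ml (T γ f) := by
  refine Submodule.iSup_induction _ (motive := fun a => ml f * a = a * ml (T γ f)) ha ?_ (by simp) ?_
  · intro _ a ha; exact FGL.ml_mul f ha
  · intro a b h h'; rw [mul_add, add_mul, h, h']

theorem FGL.mr_mul_of_rgrade {γ : H n} (f : M n) {a : FGL n q} (ha : a ∈ rgrade γ) :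
    mr f * a = a * mr (T γ f) := by
  refine Submodule.iSup_induction _ (motive := fun a => mr f * a = a * mr (T γ f)) ha ?_ (by simp) ?_
  · intro _ a ha; exact FGL.mr_mul f ha
  · intro a b h h'; rw [mul_add, add_mul, h, h']

/-! Morphisms of `𝔥`-algebras out of `F_R(GL(n))`. -/

/-- The morphism of `𝔥`-algebras with given images of the generators. -/
def FGL.hlift {B : Type} [Ring B] [Algebra ℂ B] [HPre n B] [GradedMul n B]
    {t : Fin n → Fin n → B} {d : B} (HB : IsRLL q (ml : M n →ₐ[ℂ] B) mr t)
    (ht : ∀ i j, t i j ∈ grade (wt i) (wt j)) (hd : d ∈ grade (-1 : H n) (-1))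
    (h1 : colMinor (hfun q) ml t (Finset.univ.sort (· ≤ ·)) Finset.univ * d = 1)
    (h2 : d * colMinor (hfun q) ml t (Finset.univ.sort (· ≤ ·)) Finset.univ = 1)
    (hc : ∀ i j, t i j * d = d * t i j) (hl : ∀ f : M n, ml f * d = d * ml (T (-1) f))
    (hr : ∀ f : M n, mr f * d = d * mr (T (-1) f)) : HHom n (FGL n q) B where
  toAlgHom := FGL.lift (FM.lift HB) d (by rwa [FM.lift_minor]) (by rwa [FM.lift_minor])
    (fun i j => by rw [FM.lift_t, hc]) (fun f => by rw [FM.lift_ml, FM.lift_ml, hl])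
    (fun f => by rw [FM.lift_mr, FM.lift_mr, hr])
  map_grade α β a ha := by
    refine map_wordSpan (gen := FGL.gen n q) (deg := FGL.deg n) (δ := (α, β)) _
      (fun δ => grade δ.1 δ.2) one_mem_grade (fun _ _ _ _ ha hb => GradedMul.mul_mem ha hb)
      (fun _ => rfl) ?_ ha
    intro x
    refine FGL.gen_cases (p := fun a δ => FGL.lift (FM.lift HB) d _ _ _ _ _ a ∈
      (grade δ.1 δ.2 : Submodule ℂ B)) ?_ ?_ ?_ ?_ x
    · intro f
      rw [show (ml f : FGL n q) = FGL.ofM n q (FM.ml n q f) from rfl, FGL.lift_ofM, FM.lift_ml]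
      exact ml_mem f
    · intro f
      rw [show (mr f : FGL n q) = FGL.ofM n q (FM.mr n q f) from rfl, FGL.lift_ofM, FM.lift_mr]
      exact mr_mem f
    · intro i j
      rw [FGL.t, FGL.lift_ofM, FM.lift_t]
      exact ht i j
    · rw [FGL.lift_detInv]; exact hd
  map_ml f := (FGL.lift_ofM _).trans (FM.lift_ml HB f)
  map_mr f := (FGL.lift_ofM _).trans (FM.lift_mr HB f)

section

variable {B : Type} [Ring B] [Algebra ℂ B] [HPre n B] [GradedMul n B]
    {t : Fin n → Fin n → B} {d : B} {HB : IsRLL q (ml : M n →ₐ[ℂ] B) mr t}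
    {ht : ∀ i j, t i j ∈ grade (wt i) (wt j)} {hd : d ∈ grade (-1 : H n) (-1)}
    {h1 : colMinor (hfun q) ml t (Finset.univ.sort (· ≤ ·)) Finset.univ * d = 1}
    {h2 : d * colMinor (hfun q) ml t (Finset.univ.sort (· ≤ ·)) Finset.univ = 1}
    {hc : ∀ i j, t i j * d = d * t i j} {hl : ∀ f : M n, ml f * d = d * ml (T (-1) f)}
    {hr : ∀ f : M n, mr f * d = d * mr (T (-1) f)}

theorem FGL.hlift_t (i j : Fin n) :
    (FGL.hlift HB ht hd h1 h2 hc hl hr).toAlgHom (FGL.t q i j) = t i j := by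
  simp only [FGL.hlift, FGL.t]
  rw [FGL.lift_ofM, FM.lift_t]

theorem FGL.hlift_detInv :
    (FGL.hlift HB ht hd h1 h2 hc hl hr).toAlgHom (FGL.detInv n q) = d := by
  simp only [FGL.hlift]
  rw [FGL.lift_detInv]

end

/-- The comultiplication. -/
def FGL.comul (hq0 : q ≠ 0) (hq1 : 2 ≤ n → q ≠ 1) :
    HHom n (FGL n q) (MTensor n (FGL n q) (FGL n q)) := by
  have hdd : Matching n (FGL.detInv n q) (FGL.detInv n q) :=
    Matching.of_grade (FGL.detInv_mem n q) (FGL.detInv_mem n q)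
  have hDD : Matching n (FGL.det n q) (FGL.det n q) :=
    Matching.of_grade (FGL.det_mem_grade n q) (FGL.det_mem_grade n q)
  have hm : ∀ i k j, Matching n (FGL.t q i k) (FGL.t q k j) := fun i k j =>
    Matching.of_grade (FGL.t_mem q i k) (FGL.t_mem q k j)
  -- In the Cauchy–Binet sum only the full set has the right cardinality, so the determinant is
  -- group-like.
  have hdet : colMinor (hfun q) (ml : M n →ₐ[ℂ] MTensor n (FGL n q) (FGL n q))
      (matComul (FGL.t q)) (Finset.univ.sort (· ≤ ·)) Finset.univ =
      tm n (FGL.det n q) (FGL.det n q) := by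
    rw [colMinor_matComul (FGL.isRLL n q) (FGL.t_mem q) hq0 hq1, Finset.sum_eq_single Finset.univ]
    · rw [← FGL.minor_eq]; rfl
    · intro K _ hK
      rw [colMinor_eq_zero, tm_zero_left]
      rw [Finset.length_sort]
      exact fun h => hK ((Finset.card_eq_iff_eq_univ K).1 (by rw [← h, Finset.card_univ]))
    · intro h; exact (h (Finset.mem_univ _)).elim
  refine FGL.hlift ((FGL.isRLL n q).matComul (FGL.t_mem q))
    (d := tm n (FGL.detInv n q) (FGL.detInv n q)) ?_
    (tm_mem_grade (FGL.detInv_mem n q) (FGL.detInv_mem n q)) ?_ ?_ ?_ ?_ ?_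
  · intro i j
    rw [matComul]
    exact sum_mem fun k _ => tm_mem_grade (FGL.t_mem q i k) (FGL.t_mem q k j)
  · rw [hdet, hDD.tm_mul hdd, FGL.det_mul_detInv, tm_one_one]
  · rw [hdet, hdd.tm_mul hDD, FGL.detInv_mul_det, tm_one_one]
  · intro i j
    simp only [matComul, Finset.sum_mul, Finset.mul_sum]
    refine Finset.sum_congr rfl fun k _ => ?_
    rw [(hm i k j).tm_mul hdd, hdd.tm_mul (hm i k j), FGL.t_mul_detInv, FGL.t_mul_detInv]
  · intro f
    rw [hdd.tm_ml_mul, hdd.tm_mul_ml, FGL.ml_mul_detInv]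
  · intro f
    rw [hdd.tm_mr_mul, hdd.tm_mul_mr, FGL.mr_mul_detInv]

theorem FGL.comul_t (hq0 : q ≠ 0) (hq1 : 2 ≤ n → q ≠ 1) (i j : Fin n) :
    (FGL.comul hq0 hq1).toAlgHom (FGL.t q i j) = ∑ k, tm n (FGL.t q i k) (FGL.t q k j) := by
  simp only [FGL.comul]
  rw [FGL.hlift_t]
  rfl

theorem FGL.comul_detInv (hq0 : q ≠ 0) (hq1 : 2 ≤ n → q ≠ 1) :
    (FGL.comul hq0 hq1).toAlgHom (FGL.detInv n q) =
      tm n (FGL.detInv n q) (FGL.detInv n q) := by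
  simp only [FGL.comul]
  rw [FGL.hlift_detInv]

/-- The images of the `t_{ij}` under the counit satisfy the `RLL` relations. -/
theorem isRLL_counit (n : ℕ) (q : ℂ) : IsRLL q (ml : M n →ₐ[ℂ] Dh n) mr
    (fun i j => if i = j then dOp 1 (-wt i) else 0) where
  comm f g := by
    change dMul n f * dMul n g = dMul n g * dMul n f
    rw [← map_mul, ← map_mul, mul_comm]
  l_t f i j := by
    change dMul n f * _ = _ * dMul n (T (wt i) f)
    split_ifs
    · rw [dMul_mul_dOp, dOp_mul_dMul, T_neg_T, mul_comm]
    · rw [mul_zero, zero_mul]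
  r_t f i j := by
    change dMul n f * _ = _ * dMul n (T (wt j) f)
    split_ifs with h
    · subst h; rw [dMul_mul_dOp, dOp_mul_dMul, T_neg_T, mul_comm]
    · rw [mul_zero, zero_mul]
  rll a b c d := by
    change (∑ x, ∑ y, dMul n (Rmat q x y a c) * _ * _) = ∑ x, ∑ y, dMul n (Rmat q b d x y) * _ * _
    -- For a diagonal matrix both sides reduce to the single coefficient `R^{bd}_{ac}`. It vanishes
    -- unless `{a,c} = {b,d}`, and then the two translations have the same total.
    rw [Finset.sum_eq_single b, Finset.sum_eq_single d, Finset.sum_eq_single a,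
      Finset.sum_eq_single c, if_pos rfl, if_pos rfl, if_pos rfl, if_pos rfl]
    · by_cases h : (a = b ∧ c = d) ∨ (a = d ∧ c = b)
      · simp only [mul_assoc, dOp_mul]
        rcases h with ⟨rfl, rfl⟩ | ⟨rfl, rfl⟩
        · rw [add_comm]; simp
        · simp
      · rw [not_or] at h
        rw [Rmat_eq_zero h.1 h.2]
        simp
    all_goals simp +contextual [Ne.symm, eq_comm]

/-- The counit. -/
def FGL.counit (n : ℕ) (q : ℂ) : HHom n (FGL n q) (Dh n) := by
  have hdet : colMinor (hfun q) (ml : M n →ₐ[ℂ] Dh n)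
      (fun i j => if i = j then dOp 1 (-wt i) else 0) (Finset.univ.sort (· ≤ ·)) Finset.univ =
      dOp 1 (-1) := by
    rw [colMinor_diagonal _ _ _ _ (Finset.sortedLT_sort _).pairwise,
      if_pos (Finset.sort_toFinset _ _).symm]
    have : ∀ L : List (Fin n), (L.map fun i => (dOp 1 (-wt i) : Dh n)).prod =
        dOp 1 (-(L.map wt).sum) := by
      intro L
      induction L with
      | nil => simp [dOp_one_zero]
      | cons c L ih =>
        rw [List.map_cons, List.prod_cons, ih, dOp_mul, map_one, mul_one, List.map_cons,
          List.sum_cons, neg_add]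
    rw [this, sum_map_sort, sum_wt_univ]
  refine FGL.hlift (isRLL_counit n q) (d := dOp 1 1) ?_ ?_ ?_ ?_ ?_ ?_ ?_
  · intro i j
    split_ifs with h
    · subst h; exact dOp_mem _ _
    · exact zero_mem _
  · have := dOp_mem (1 : M n) (-1)
    rwa [neg_neg] at this
  · rw [hdet, dOp_mul, map_one, mul_one, neg_add_cancel, dOp_one_zero]
  · rw [hdet, dOp_mul, map_one, mul_one, add_neg_cancel, dOp_one_zero]
  · intro i j
    split_ifs
    · rw [dOp_mul, dOp_mul, map_one, map_one, add_comm]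
    · rw [zero_mul, mul_zero]
  · intro f
    change dMul n f * _ = _ * dMul n _
    rw [dMul_mul_dOp, dOp_mul_dMul, T_T_neg, mul_comm]
  · intro f
    change dMul n f * _ = _ * dMul n _
    rw [dMul_mul_dOp, dOp_mul_dMul, T_T_neg, mul_comm]

theorem FGL.counit_t (i j : Fin n) :
    (FGL.counit n q).toAlgHom (FGL.t q i j) = if i = j then dOp 1 (-wt i) else 0 := by
  simp only [FGL.counit]
  rw [FGL.hlift_t]

theorem FGL.counit_detInv : (FGL.counit n q).toAlgHom (FGL.detInv n q) = dOp 1 1 := by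
  simp only [FGL.counit]
  rw [FGL.hlift_detInv]

theorem HHom.toAlgHom_ml {A B : Type} [Ring A] [Algebra ℂ A] [HPre n A] [Ring B] [Algebra ℂ B]
    [HPre n B] (φ : HHom n A B) (f : M n) : φ.toAlgHom (ml f) = ml f := φ.map_ml f

theorem HHom.toAlgHom_mr {A B : Type} [Ring A] [Algebra ℂ A] [HPre n A] [Ring B] [Algebra ℂ B]
    [HPre n B] (φ : HHom n A B) (f : M n) : φ.toAlgHom (mr f) = mr f := φ.map_mr f

theorem dMul_injective (n : ℕ) : Function.Injective (dMul n) := fun f g h => by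
  have := congrArg (fun x => Dh.toEnd n x 1) h
  simp only [dMul_eq_dOp, dOp_apply, map_one, mul_one] at this
  exact this

/-! The bigrading of `F_R(GL(n))` is internal. -/

/-- `x ↦ x ⊗ (degree)` on the free generators. -/
theorem isRLL_coaction (n : ℕ) (q : ℂ) : IsRLL q
    ((AddMonoidAlgebra.singleZeroAlgHom (R := ℂ) (A := FGL n q) (M := H n × H n)).comp
      (ml : M n →ₐ[ℂ] FGL n q))
    ((AddMonoidAlgebra.singleZeroAlgHom (R := ℂ) (A := FGL n q) (M := H n × H n)).comp mr)
    (fun i j => AddMonoidAlgebra.single (wt i, wt j) (FGL.t q i j)) where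
  comm f g := by
    simp only [AlgHom.comp_apply, AddMonoidAlgebra.singleZeroAlgHom_apply,
      AddMonoidAlgebra.single_mul_single]
    rw [(FGL.isRLL n q).comm]
  l_t f i j := by
    simp only [AlgHom.comp_apply, AddMonoidAlgebra.singleZeroAlgHom_apply,
      AddMonoidAlgebra.single_mul_single]
    rw [(FGL.isRLL n q).l_t, add_comm]
  r_t f i j := by
    simp only [AlgHom.comp_apply, AddMonoidAlgebra.singleZeroAlgHom_apply,
      AddMonoidAlgebra.single_mul_single]
    rw [(FGL.isRLL n q).r_t, add_comm]
  rll a b c d := by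
    simp only [AlgHom.comp_apply, AddMonoidAlgebra.singleZeroAlgHom_apply,
      AddMonoidAlgebra.single_mul_single, zero_add, Prod.mk_add_mk]
    have e1 : ∀ x y, AddMonoidAlgebra.single ((wt x + wt y, wt b + wt d) : H n × H n)
        (ml (Rmat q x y a c) * FGL.t q x b * FGL.t q y d) =
        AddMonoidAlgebra.single (wt a + wt c, wt b + wt d)
          (ml (Rmat q x y a c) * FGL.t q x b * FGL.t q y d) := by
      intro x y
      by_cases h : (a = x ∧ c = y) ∨ (a = y ∧ c = x)
      · rcases h with ⟨rfl, rfl⟩ | ⟨rfl, rfl⟩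
        · rfl
        · rw [add_comm (wt c)]
      · rw [not_or] at h
        rw [Rmat_eq_zero h.1 h.2]; simp
    have e2 : ∀ x y, AddMonoidAlgebra.single ((wt c + wt a, wt y + wt x) : H n × H n)
        (mr (Rmat q b d x y) * FGL.t q c y * FGL.t q a x) =
        AddMonoidAlgebra.single (wt a + wt c, wt b + wt d)
          (mr (Rmat q b d x y) * FGL.t q c y * FGL.t q a x) := by
      intro x y
      rw [add_comm (wt c)]
      by_cases h : (x = b ∧ y = d) ∨ (x = d ∧ y = b)
      · rcases h with ⟨rfl, rfl⟩ | ⟨rfl, rfl⟩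
        · rw [add_comm (wt x)]
        · rfl
      · rw [not_or] at h
        rw [Rmat_eq_zero h.1 h.2]; simp
    simp only [e1, e2, ← AddMonoidAlgebra.singleAddHom_apply, ← map_sum]
    rw [(FGL.isRLL n q).rll]

/-- The relations are homogeneous, so recording the degree of each generator defines a homomorphism
into the group algebra over `H n × H n`. Reading off its coefficients recovers the homogeneous
components, which shows that the spans of words of different degrees are independent. -/
theorem FGL.exists_coaction (n : ℕ) (q : ℂ) :
    ∃ φ : FGL n q →ₐ[ℂ] AddMonoidAlgebra (FGL n q) (H n × H n), ∀ δ : H n × H n,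
      ∀ a ∈ wordSpan (FGL.gen n q) (FGL.deg n) δ, φ a = AddMonoidAlgebra.single δ a := by
  set φ₀ := FM.lift (isRLL_coaction n q) with hφ₀
  have h0 : ∀ δ : H n × H n, ∀ a ∈ wordSpan (FM.gen n q) Gen.deg δ,
      φ₀ a = AddMonoidAlgebra.single δ (FGL.ofM n q a) := by
    intro δ a ha
    refine wordSpan_induction (p := fun a => φ₀ a = AddMonoidAlgebra.single δ (FGL.ofM n q a))
      (by simp) ?_ ?_ ?_ ha
    · intro a b h h'; rw [map_add, map_add, h, h', AddMonoidAlgebra.single_add]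
    · intro c a h; rw [map_smul, map_smul, h, AddMonoidAlgebra.smul_single]
    · rintro w rfl
      clear ha
      induction w with
      | nil => simp [AddMonoidAlgebra.one_def]
      | cons x w ih =>
        rw [List.map_cons, List.prod_cons, map_mul, ih, map_mul, List.map_cons, List.sum_cons,
          ← AddMonoidAlgebra.single_mul_single]
        congr 1
        rw [hφ₀, FM.lift_gen]
        cases x <;> rfl
  have hdet : φ₀ (FM.minor q Finset.univ Finset.univ) =
      AddMonoidAlgebra.single (1, 1) (FGL.det n q) := by
    have := FM.minor_mem_grade q (Finset.univ : Finset (Fin n)) Finset.univ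
    rw [sum_wt_univ] at this
    exact h0 (1, 1) _ this
  have hneg : ((1, 1) : H n × H n) + (-1, -1) = 0 := by
    rw [Prod.mk_add_mk, add_neg_cancel]; rfl
  refine ⟨FGL.lift φ₀ (AddMonoidAlgebra.single (-1, -1) (FGL.detInv n q)) ?_ ?_ ?_ ?_ ?_, ?_⟩
  · rw [hdet, AddMonoidAlgebra.single_mul_single, hneg, FGL.det_mul_detInv]; rfl
  · rw [hdet, AddMonoidAlgebra.single_mul_single, add_comm, hneg, FGL.detInv_mul_det]; rfl
  · intro i j
    rw [hφ₀, FM.lift_t, AddMonoidAlgebra.single_mul_single, AddMonoidAlgebra.single_mul_single,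
      add_comm, FGL.t_mul_detInv]
  · intro f
    rw [hφ₀, FM.lift_ml, FM.lift_ml]
    simp only [AlgHom.comp_apply, AddMonoidAlgebra.singleZeroAlgHom_apply,
      AddMonoidAlgebra.single_mul_single]
    rw [add_comm, FGL.ml_mul_detInv]
  · intro f
    rw [hφ₀, FM.lift_mr, FM.lift_mr]
    simp only [AlgHom.comp_apply, AddMonoidAlgebra.singleZeroAlgHom_apply,
      AddMonoidAlgebra.single_mul_single]
    rw [add_comm, FGL.mr_mul_detInv]
  · intro δ a ha
    set φ := FGL.lift φ₀ _ _ _ _ _ _ with hφ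
    refine wordSpan_induction (p := fun a => φ a = AddMonoidAlgebra.single δ a)
      (by simp) ?_ ?_ ?_ ha
    · intro a b h h'; rw [map_add, h, h', AddMonoidAlgebra.single_add]
    · intro c a h; rw [map_smul, h, AddMonoidAlgebra.smul_single]
    · rintro w rfl
      refine FGL.word_induction (p := fun a δ => φ a = AddMonoidAlgebra.single δ a) ?_ ?_ ?_ ?_ ?_
        ?_ w
      · rw [map_one]; rfl
      · intro f; exact (FGL.lift_ofM _).trans (FM.lift_ml _ f)
      · intro f; exact (FGL.lift_ofM _).trans (FM.lift_mr _ f)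
      · intro i j; exact (FGL.lift_ofM _).trans (FM.lift_t _ i j)
      · exact FGL.lift_detInv
      · intro a b α β ha hb
        rw [map_mul, ha, hb, AddMonoidAlgebra.single_mul_single]

theorem FGL.mem_iSup_grade (a : FGL n q) :
    a ∈ ⨆ p : H n × H n, (grade p.1 p.2 : Submodule ℂ (FGL n q)) := by
  have hmem : ∀ (δ : H n × H n) (a : FGL n q), a ∈ grade δ.1 δ.2 →
      a ∈ ⨆ p : H n × H n, (grade p.1 p.2 : Submodule ℂ (FGL n q)) := fun δ a ha =>
    Submodule.mem_iSup_of_mem (p := fun p : H n × H n => (grade p.1 p.2 : Submodule ℂ (FGL n q)))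
      δ ha
  refine FGL.induction ?_ (fun f => hmem 0 _ (ml_mem f)) (fun f => hmem 0 _ (mr_mem f))
    (fun i j => hmem (wt i, wt j) _ (FGL.t_mem q i j)) (hmem (-1, -1) _ (FGL.detInv_mem n q))
    (fun a b => add_mem) ?_ a
  · intro c
    rw [Algebra.algebraMap_eq_smul_one]
    exact hmem 0 _ (Submodule.smul_mem _ _ one_mem_grade)
  · intro a b ha hb
    exact iSup_grade_mul (fun p p' a b ha hb => hmem (p + p') _ (GradedMul.mul_mem ha hb)) ha hb

open Classical in
theorem FGL.isInternal (n : ℕ) (q : ℂ) : DirectSum.IsInternal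
    (fun p : H n × H n => (grade p.1 p.2 : Submodule ℂ (FGL n q))) := by
  obtain ⟨φ, hφ⟩ := FGL.exists_coaction n q
  have key : ∀ (x : DirectSum (H n × H n) fun p => (grade p.1 p.2 : Submodule ℂ (FGL n q))) δ,
      (φ (DirectSum.coeLinearMap
        (fun p : H n × H n => (grade p.1 p.2 : Submodule ℂ (FGL n q))) x)).coeff δ = x δ := by
    intro x δ
    induction x using DirectSum.induction_on with
    | zero => simp
    | of p a =>
      rw [← DirectSum.lof_eq_of ℂ, DirectSum.coeLinearMap_lof, hφ p a a.2, DirectSum.lof_eq_of]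
      by_cases h : p = δ
      · subst h; simp
      · rw [DirectSum.of_eq_of_ne _ _ _ (Ne.symm h)]
        simp [h]
    | add x y hx hy => simp [hx, hy]
  constructor
  · intro x y hxy
    refine DFinsupp.ext fun δ => Subtype.ext ?_
    have hxy' : DirectSum.coeLinearMap (fun p : H n × H n =>
        (grade p.1 p.2 : Submodule ℂ (FGL n q))) x = DirectSum.coeLinearMap _ y := hxy
    exact (key x δ).symm.trans ((congrArg (fun z => (φ z).coeff δ) hxy').trans (key y δ))
  · intro a
    have := FGL.mem_iSup_grade a
    rw [← DirectSum.range_coeLinearMap] at this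
    obtain ⟨x, hx⟩ := this
    exact ⟨x, hx⟩

theorem FGL.isHAlgebra (n : ℕ) (q : ℂ) : IsHAlgebra n (FGL n q) where
  internal := by
    classical
    convert FGL.isInternal n q
  mul_mem _ _ _ _ _ _ ha hb := GradedMul.mul_mem ha hb
  -- The counit carries both moment maps to the faithful action of `M` on itself by multiplication,
  -- so no collapse can occur in the quotient defining `FGL`.
  ml_injective f g h := by
    have := congrArg (FGL.counit n q).toAlgHom h
    rw [HHom.toAlgHom_ml, HHom.toAlgHom_ml] at this
    exact dMul_injective n this
  mr_injective f g h := by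
    have := congrArg (FGL.counit n q).toAlgHom h
    rw [HHom.toAlgHom_mr, HHom.toAlgHom_mr] at this
    exact dMul_injective n this
  ml_mul _ _ f _ ha := FGL.ml_mul f ha
  mr_mul _ _ f _ ha := FGL.mr_mul f ha

end GeneralLinear

/-! The inverse of the matrix of generators. -/

section Inverse

variable {n : ℕ} {q : ℂ}

theorem sgn_compl_singleton (q : ℂ) (j : Fin n) :
    sgn q {j}ᶜ {j} = signBack (hfun q) (Finset.univ.erase j) j := by
  rw [sgn, if_pos disjoint_compl_left, Finset.compl_singleton, signBack]
  exact Finset.prod_congr rfl fun k _ => Finset.prod_singleton _ _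

/-- Factor by factor this is `h(λ+1) h(-λ) = 1`. -/
theorem T_signBack_mul_signFrontOp (hq0 : q ≠ 0) (hq1 : 2 ≤ n → q ≠ 1) {k : Fin n}
    {J : Finset (Fin n)} (hk : k ∉ J) :
    T (-wt k) (signBack (hfun q) J k) * signFrontOp q k J = 1 := by
  rw [signBack, signFrontOp, map_prod, ← Finset.prod_mul_distrib]
  refine Finset.prod_eq_one fun m hm => ?_
  have hmk : m ≠ k := by rintro rfl; exact hk hm
  split_ifs with h
  · rw [map_neg, neg_mul_neg,
      hfun_neg_shift hq0 (hq1 (by have := Fin.val_ne_of_ne hmk; omega)) hmk]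
  · rw [map_one, one_mul]

/-- The entries of the inverse of the matrix `(t_{ij})`. -/
def FGL.tInv (q : ℂ) (i j : Fin n) : FGL n q :=
  FGL.detInv n q * (ml (sgn q {j}ᶜ {j}) * mr (sgn q {i}ᶜ {i})⁻¹) * FGL.minor q {j}ᶜ {i}ᶜ

theorem sum_wt_compl (j : Fin n) : ∑ i ∈ ({j}ᶜ : Finset (Fin n)), (wt i : H n) = 1 - wt j := by
  rw [eq_sub_iff_add_eq, Finset.compl_singleton, Finset.sum_erase_add _ _ (Finset.mem_univ _),
    sum_wt_univ]

theorem FGL.tInv_mem (q : ℂ) (i j : Fin n) : FGL.tInv q i j ∈ grade (-wt j) (-wt i) := by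
  have h := GradedMul.mul_mem (GradedMul.mul_mem (FGL.detInv_mem n q)
    (GradedMul.mul_mem (ml_mem (A := FGL n q) (sgn q {j}ᶜ {j}))
      (mr_mem (A := FGL n q) (sgn q {i}ᶜ {i})⁻¹))) (FGL.minor_mem_grade q {j}ᶜ {i}ᶜ)
  have e : ∀ j : Fin n, (-1 : H n) + (0 + 0) + ∑ i ∈ ({j}ᶜ : Finset (Fin n)), wt i = -wt j := by
    intro j; rw [sum_wt_compl]; abel
  rw [e, e] at h
  exact h

/-- Up to the normalization by `det⁻¹` and a sign, the sum is the expansion along its last column of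
the minor whose column word is the complement of `i` followed by `j`. For `j = i` the word sorts to
all columns, with the sign that was divided out; otherwise a column is repeated. -/
theorem FGL.sum_tInv_mul_t (hq0 : q ≠ 0) (hq1 : 2 ≤ n → q ≠ 1) (i j : Fin n) :
    ∑ k, FGL.tInv q i k * FGL.t q k j = if i = j then 1 else 0 := by
  have HD := (FGL.isRLL n q).isDynMatrix hq0 hq1
  have alt := HD.isAlternating Finset.univ
  have hmem : i ∉ Finset.univ.erase i := Finset.notMem_erase _ _
  have e : ∑ k, FGL.tInv q i k * FGL.t q k j =
      FGL.detInv n q * (mr (sgn q {i}ᶜ {i})⁻¹ * colMinor (hfun q) ml (FGL.t q)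
        ((Finset.univ.erase i).sort (· ≤ ·) ++ [j]) Finset.univ) := by
    rw [colMinor_append_singleton HD.toIsShifted, Finset.mul_sum, Finset.mul_sum]
    refine Finset.sum_congr rfl fun k _ => ?_
    rw [FGL.tInv, HD.comm, FGL.minor_eq, sgn_compl_singleton q k, Finset.compl_singleton,
      Finset.compl_singleton]
    simp only [mul_assoc]
  rw [e]
  split_ifs with h
  · subst h
    rw [alt.sort_append hmem, Finset.insert_erase (Finset.mem_univ _), ← FGL.minor_eq,
      sgn_compl_singleton, ← mul_assoc (mr _), ← map_mul, inv_mul_cancel₀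
      (signBack_ne_zero HD.h_ne _ _), map_one, one_mul]
    exact FGL.detInv_mul_det
  · rw [alt.sort_append_of_mem (Finset.mem_erase.2 ⟨Ne.symm h, Finset.mem_univ _⟩), mul_zero,
      mul_zero]

/-- Here the minors have to be expanded along rows, which `colMinor_eq_rowMinor` permits. Moving
`t_{ik}` past the signs translates them, and the translated inverse back sign is exactly the sign of
the row expansion. -/
theorem FGL.sum_t_mul_tInv (hq0 : q ≠ 0) (hq : ∀ k : ℕ, 1 ≤ k → k ≤ n → q ^ (2 * k) ≠ 1)
    (hq1 : 2 ≤ n → q ≠ 1) (i j : Fin n) :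
    ∑ k, FGL.t q i k * FGL.tInv q k j = if i = j then 1 else 0 := by
  have HR := FGL.isRLL n q
  have hne := (HR.isDynMatrix hq0 hq1).h_ne
  have hmem : ∀ k : Fin n, k ∉ Finset.univ.erase k := fun k => Finset.notMem_erase _ _
  have hinv : ∀ k : Fin n, T (-wt k) (signBack (hfun q) (Finset.univ.erase k) k)⁻¹ =
      signFrontOp q k (Finset.univ.erase k) := fun k => by
    rw [map_inv₀]
    exact inv_eq_of_mul_eq_one_right (T_signBack_mul_signFrontOp hq0 hq1 (hmem k))
  have hrow : ∀ I J : Finset (Fin n), I.card = J.card → FGL.minor q I J =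
      rowMinor q mr (FGL.t q) (I.sort (· ≥ ·)) J := fun I J h => by
    rw [FGL.minor_eq, colMinor_eq_rowMinor HR hq0 hq _ I J rfl h.symm]
  have e : ∑ k, FGL.t q i k * FGL.tInv q k j =
      FGL.detInv n q * (ml (T (-wt i) (signBack (hfun q) (Finset.univ.erase j) j)) *
        rowMinor q mr (FGL.t q) (i :: (Finset.univ.erase j).sort (· ≥ ·)) Finset.univ) := by
    rw [rowMinor_cons, Finset.mul_sum, Finset.mul_sum]
    refine Finset.sum_congr rfl fun k _ => ?_
    rw [FGL.tInv, hrow {j}ᶜ {k}ᶜ (by simp [Finset.card_compl]), sgn_compl_singleton, sgn_compl_singleton,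
      Finset.compl_singleton, Finset.compl_singleton, ← hinv k]
    calc _ = FGL.t q i k * FGL.detInv n q * (ml (signBack (hfun q) (Finset.univ.erase j) j) *
          mr (signBack (hfun q) (Finset.univ.erase k) k)⁻¹ * rowMinor q mr (FGL.t q)
            ((Finset.univ.erase j).sort (· ≥ ·)) (Finset.univ.erase k)) := by
          simp only [mul_assoc]
      _ = FGL.detInv n q * (FGL.t q i k * ml (signBack (hfun q) (Finset.univ.erase j) j) *
          mr (signBack (hfun q) (Finset.univ.erase k) k)⁻¹ * rowMinor q mr (FGL.t q)
            ((Finset.univ.erase j).sort (· ≥ ·)) (Finset.univ.erase k)) := by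
          rw [FGL.t_mul_detInv]; simp only [mul_assoc]
      _ = _ := by
          rw [HR.t_l, mul_assoc (ml _), HR.t_r]; simp only [mul_assoc]
  rw [e]
  split_ifs with h
  · subst h
    rw [rowMinor_cons_sort HR hq0 hq1 (hmem i), Finset.insert_erase (Finset.mem_univ _),
      ← hrow _ _ rfl, ← mul_assoc (ml _), ← map_mul, T_signBack_mul_signFrontOp hq0 hq1 (hmem i),
      map_one, one_mul]
    exact FGL.detInv_mul_det
  · rw [rowMinor_cons_sort_of_mem HR hq0 hq1 (Finset.mem_erase.2 ⟨h, Finset.mem_univ _⟩),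
      mul_zero, mul_zero]

theorem FGL.ml_mul_det (f : M n) :
    (ml f : FGL n q) * FGL.det n q = FGL.det n q * ml (T 1 f) := FGL.ml_mul f (FGL.det_mem_grade n q)

theorem FGL.mr_mul_det (f : M n) :
    (mr f : FGL n q) * FGL.det n q = FGL.det n q * mr (T 1 f) := FGL.mr_mul f (FGL.det_mem_grade n q)

theorem FGL.det_mul_t (i j : Fin n) :
    FGL.det n q * FGL.t q i j = FGL.t q i j * FGL.det n q := by
  calc FGL.det n q * FGL.t q i j
      = FGL.det n q * (FGL.t q i j * FGL.detInv n q) * FGL.det n q := by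
        rw [mul_assoc, mul_assoc, FGL.detInv_mul_det, mul_one]
    _ = _ := by
        rw [FGL.t_mul_detInv, ← mul_assoc, FGL.det_mul_detInv, one_mul]

/-- Since `det` commutes with the entries of a matrix, it commutes with those of its two-sided
inverse. This is needed for `S` to respect `t_{ij} det⁻¹ = det⁻¹ t_{ij}`. -/
theorem FGL.det_mul_tInv (hq0 : q ≠ 0) (hq : ∀ k : ℕ, 1 ≤ k → k ≤ n → q ^ (2 * k) ≠ 1)
    (hq1 : 2 ≤ n → q ≠ 1) (i j : Fin n) :
    FGL.det n q * FGL.tInv q i j = FGL.tInv q i j * FGL.det n q := by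
  calc FGL.det n q * FGL.tInv q i j
      = ∑ k, (∑ l, FGL.tInv q i l * FGL.t q l k) * (FGL.det n q * FGL.tInv q k j) := by
        simp [FGL.sum_tInv_mul_t hq0 hq1]
    _ = ∑ l, FGL.tInv q i l * FGL.det n q * ∑ k, FGL.t q l k * FGL.tInv q k j := by
        simp only [Finset.sum_mul, Finset.mul_sum]
        rw [Finset.sum_comm]
        refine Finset.sum_congr rfl fun l _ => Finset.sum_congr rfl fun k _ => ?_
        rw [mul_assoc, ← mul_assoc (FGL.t q l k), ← FGL.det_mul_t]
        simp only [mul_assoc]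
    _ = _ := by simp [FGL.sum_t_mul_tInv hq0 hq hq1]

end Inverse

/-! The inverse of a matrix satisfying the quadratic relations satisfies the opposite ones. -/

section OppositeRLL

variable {n : ℕ} {q : ℂ} {A : Type} [Ring A] [Algebra ℂ A] {l r : M n →ₐ[ℂ] A}
  {t u : Fin n → Fin n → A}

/-- Conjugation of the matrix identity `RLL` by the inverse matrices: insert `t u = 1` twice next to
`R`, apply `RLL` in the middle, and cancel `u t = 1` twice on the other side. The scalars have to be
carried past the entries of `u`, hence the hypothesis on their translation. -/
theorem IsRLL.sum_inverse (HR : IsRLL q l r t) (ht : ∀ i j, ∑ k, t i k * u k j = if i = j then 1 else 0)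
    (hu : ∀ i j, ∑ k, u i k * t k j = if i = j then 1 else 0)
    (hur : ∀ i j f, u i j * r f = r (T (wt i) f) * u i j) (a b c d : Fin n) :
    ∑ x, ∑ y, u a x * u c y * l (Rmat q b d x y) = ∑ x, ∑ y, u y d * u x b * r (Rmat q x y a c) := by
  have h1 : ∀ x y, l (Rmat q b d x y) =
      ∑ v, ∑ w, (∑ e, ∑ f, r (Rmat q v w e f) * t y f * t x e) * (u w d * u v b) := by
    intro x y
    calc l (Rmat q b d x y)
        = ∑ e, ∑ f, l (Rmat q e f x y) * ∑ v, t e v * (∑ w, t f w * u w d) * u v b := by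
          simp [ht]
      _ = ∑ v, ∑ w, (∑ e, ∑ f, l (Rmat q e f x y) * t e v * t f w) * (u w d * u v b) := by
          simp only [Finset.mul_sum, Finset.sum_mul]
          rw [sum_comm₂]
          simp only [mul_assoc]
      _ = _ := by simp only [HR.rll]
  have h2 : ∀ g e f, ∑ x, ∑ y, u a x * u c y * r g * t y f * t x e =
      if a = e ∧ c = f then r (T (wt a + wt c) g) else 0 := by
    intro g e f
    calc ∑ x, ∑ y, u a x * u c y * r g * t y f * t x e
        = r (T (wt a + wt c) g) * ∑ x, u a x * (∑ y, u c y * t y f) * t x e := by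
          simp only [Finset.mul_sum, Finset.sum_mul]
          refine Finset.sum_congr rfl fun x _ => Finset.sum_congr rfl fun y _ => ?_
          rw [mul_assoc (u a x), hur, ← mul_assoc (u a x), hur, T_T]
          simp only [mul_assoc]
      _ = _ := by
          rw [hu]
          split_ifs with h h' h'
          · simp [hu, h'.1]
          · rw [not_and'] at h'
            simp [hu, h' h]
          · exact (h h'.2).elim
          · simp
  -- The translation acquired on the left is undone on the right because `R` preserves weights: its
  -- entry vanishes unless `{v,w} = {a,c}`.
  have h3 : ∀ v w, r (T (wt a + wt c) (Rmat q v w a c)) * (u w d * u v b) =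
      u w d * u v b * r (Rmat q v w a c) := by
    intro v w
    rw [mul_assoc (u w d), hur, ← mul_assoc (u w d), hur, T_T, mul_assoc]
    by_cases h : (a = v ∧ c = w) ∨ (a = w ∧ c = v)
    · rcases h with ⟨rfl, rfl⟩ | ⟨rfl, rfl⟩
      · rw [add_comm]
      · rfl
    · rw [not_or] at h
      simp [Rmat_eq_zero h.1 h.2]
  calc ∑ x, ∑ y, u a x * u c y * l (Rmat q b d x y)
      = ∑ x, ∑ y, ∑ v, ∑ w, ∑ e, ∑ f,
          u a x * u c y * r (Rmat q v w e f) * t y f * t x e * (u w d * u v b) := by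
        simp only [h1, Finset.mul_sum, Finset.sum_mul, mul_assoc]
    _ = ∑ v, ∑ w, ∑ e, ∑ f,
          (∑ x, ∑ y, u a x * u c y * r (Rmat q v w e f) * t y f * t x e) * (u w d * u v b) := by
        rw [sum_comm₂]
        refine Finset.sum_congr rfl fun v _ => Finset.sum_congr rfl fun w _ => ?_
        rw [sum_comm₂]
        simp only [Finset.sum_mul]
    _ = ∑ v, ∑ w, r (T (wt a + wt c) (Rmat q v w a c)) * (u w d * u v b) := by
        refine Finset.sum_congr rfl fun v _ => Finset.sum_congr rfl fun w _ => ?_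
        simp only [h2, ite_and, ite_mul, zero_mul]
        simp
    _ = _ := by simp only [h3]

end OppositeRLL

/-! The antipode. -/

section Antipode

open MulOpposite

variable {n : ℕ} {q : ℂ}

/-- `f ↦ μ_r(f)` into the opposite algebra. -/
def FGL.mrOp (n : ℕ) (q : ℂ) : M n →ₐ[ℂ] (FGL n q)ᵐᵒᵖ :=
  (mr : M n →ₐ[ℂ] FGL n q).toOpposite fun f g => by
    rw [Commute, SemiconjBy, ← map_mul, ← map_mul, mul_comm]

/-- `f ↦ μ_l(f)` into the opposite algebra. -/
def FGL.mlOp (n : ℕ) (q : ℂ) : M n →ₐ[ℂ] (FGL n q)ᵐᵒᵖ :=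
  (ml : M n →ₐ[ℂ] FGL n q).toOpposite fun f g => by
    rw [Commute, SemiconjBy, ← map_mul, ← map_mul, mul_comm]

theorem FGL.mrOp_apply (f : M n) : FGL.mrOp n q f = op (mr f) := rfl

theorem FGL.mlOp_apply (f : M n) : FGL.mlOp n q f = op (ml f) := rfl

theorem FGL.tInv_mul_mr (i j : Fin n) (f : M n) :
    FGL.tInv q i j * mr f = mr (T (wt i) f) * FGL.tInv q i j := by
  rw [FGL.mr_mul _ (FGL.tInv_mem q i j), T_neg_T]

theorem FGL.tInv_mul_ml (i j : Fin n) (f : M n) :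
    FGL.tInv q i j * ml f = ml (T (wt j) f) * FGL.tInv q i j := by
  rw [FGL.ml_mul _ (FGL.tInv_mem q i j), T_neg_T]

/-- Passing to the opposite algebra reverses the products, so the inverted relations become `RLL`
again, with `μ_l` and `μ_r` interchanged. -/
theorem FGL.isRLL_tInv (hq0 : q ≠ 0) (hq : ∀ k : ℕ, 1 ≤ k → k ≤ n → q ^ (2 * k) ≠ 1)
    (hq1 : 2 ≤ n → q ≠ 1) :
    IsRLL q (FGL.mrOp n q) (FGL.mlOp n q) (fun i j => op (FGL.tInv q i j)) where
  comm f g := by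
    rw [FGL.mrOp_apply, FGL.mlOp_apply, ← op_mul, ← op_mul, (FGL.isRLL n q).comm]
  l_t f i j := by
    rw [FGL.mrOp_apply, FGL.mrOp_apply, ← op_mul, ← op_mul, FGL.tInv_mul_mr]
  r_t f i j := by
    rw [FGL.mlOp_apply, FGL.mlOp_apply, ← op_mul, ← op_mul, FGL.tInv_mul_ml]
  rll a b c d := by
    have := (FGL.isRLL n q).sum_inverse (FGL.sum_t_mul_tInv hq0 hq hq1)
      (FGL.sum_tInv_mul_t hq0 hq1) FGL.tInv_mul_mr a b c d
    simp only [FGL.mrOp_apply, FGL.mlOp_apply, ← op_mul, ← Finset.op_sum, ← mul_assoc]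
    rw [this]

/-- The minors of `(S(t_{ij}))`, in the order of multiplication of `F_R(GL(n))`. -/
def FGL.minorInv (q : ℂ) (L : List (Fin n)) (K : Finset (Fin n)) : FGL n q :=
  unop (colMinor (hfun q) (FGL.mrOp n q) (fun i j => op (FGL.tInv q i j)) L K)

theorem FGL.minorInv_cons (c : Fin n) (L : List (Fin n)) (K : Finset (Fin n)) :
    FGL.minorInv q (c :: L) K = ∑ k ∈ K, FGL.minorInv q L (K.erase k) * FGL.tInv q k c *
      mr (signFront (hfun q) k (K.erase k)) := by
  simp only [FGL.minorInv, colMinor_cons, Finset.unop_sum, unop_mul, unop_op, FGL.mrOp_apply,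
    mul_assoc]

theorem FGL.minorInv_mem (L : List (Fin n)) : ∀ K : Finset (Fin n),
    FGL.minorInv q L K ∈ grade (-(L.map wt).sum) (-∑ k ∈ K, wt k) := by
  induction L with
  | nil =>
    intro K
    rw [FGL.minorInv, colMinor_nil]
    split_ifs with h
    · subst h
      simpa using one_mem_grade (A := FGL n q) (n := n)
    · exact zero_mem _
  | cons c L ih =>
    intro K
    rw [FGL.minorInv_cons]
    refine sum_mem fun k hk => ?_
    have := GradedMul.mul_mem (GradedMul.mul_mem (ih (K.erase k)) (FGL.tInv_mem q k c))
      (mr_mem (A := FGL n q) (signFront (hfun q) k (K.erase k)))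
    rw [add_zero, add_zero, ← neg_add, ← neg_add, Finset.sum_erase_add _ _ hk, add_comm] at this
    exact this

/-- The Cauchy–Binet formula for the product of `(t_{ij})` with its inverse: minors of the inverse
matrix form an inverse of the matrix of minors. Only the case of full sets is used afterwards, but
the induction on the columns passes through all sizes. -/
theorem FGL.sum_colMinor_mul_minorInv (hq0 : q ≠ 0)
    (hq : ∀ k : ℕ, 1 ≤ k → k ≤ n → q ^ (2 * k) ≠ 1) (hq1 : 2 ≤ n → q ≠ 1) (L : List (Fin n))
    (hL : L.Pairwise (· < ·)) : ∀ I : Finset (Fin n),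
    ∑ K : Finset (Fin n), colMinor (hfun q) ml (FGL.t q) (K.sort (· ≤ ·)) I * FGL.minorInv q L K =
      if I = L.toFinset then 1 else 0 := by
  induction L with
  | nil =>
    intro I
    rw [Finset.sum_eq_single ∅]
    · rw [Finset.sort_empty, colMinor_nil, FGL.minorInv, colMinor_nil, if_pos rfl, unop_one,
        mul_one, List.toFinset_nil]
    · intro K _ hK
      rw [FGL.minorInv, colMinor_nil, if_neg hK, unop_zero, mul_zero]
    · intro h; exact (h (Finset.mem_univ _)).elim
  | cons c L ih =>
    intro I
    -- The right-hand side is written as a minor of the identity matrix, so that the inductive step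
    -- ends with its expansion along the column `c`.
    have hd := colMinor_diagonal (A := FGL n q) (hfun q) ml (fun _ => 1) (c :: L) hL I
    rw [List.pairwise_cons] at hL
    have alt := ((FGL.isRLL n q).isDynMatrix hq0 hq1).isAlternating I
    have e1 : ∀ (K : Finset (Fin n)), ∀ k ∈ K,
        colMinor (hfun q) ml (FGL.t q) (K.sort (· ≤ ·)) I * (FGL.minorInv q L (K.erase k) *
          FGL.tInv q k c * mr (signFront (hfun q) k (K.erase k))) =
        colMinor (hfun q) ml (FGL.t q) (k :: (K.erase k).sort (· ≤ ·)) I *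
          (FGL.minorInv q L (K.erase k) * FGL.tInv q k c) := by
      intro K k hk
      have h := alt.cons_sort (Finset.notMem_erase k K)
      rw [Finset.insert_erase hk] at h
      -- The whole product has right degree zero, so the sign can be moved from its left end to its
      -- right end without translation.
      have hg := GradedMul.mul_mem (colMinor_sort_mem_grade (q := q) (FGL.t_mem q) I K)
        (GradedMul.mul_mem (FGL.minorInv_mem (q := q) L (K.erase k)) (FGL.tInv_mem q k c))
      rw [← neg_add (∑ k ∈ _, _), Finset.sum_erase_add _ _ hk, add_neg_cancel] at hg
      rw [h, mul_assoc (mr _), FGL.mr_mul _ hg, T_zero]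
      simp only [mul_assoc]
    have e2 : ∀ i k, ∑ K : Finset (Fin n), ml (signFront (hfun q) i (I.erase i)) * FGL.t q i k *
        colMinor (hfun q) ml (FGL.t q) (K.sort (· ≤ ·)) (I.erase i) *
          (FGL.minorInv q L K * FGL.tInv q k c) =
        ml (signFront (hfun q) i (I.erase i)) * (if I.erase i = L.toFinset then 1 else 0) *
          (FGL.t q i k * FGL.tInv q k c) := by
      intro i k
      have : (if I.erase i = L.toFinset then 1 else 0 : FGL n q) * (FGL.t q i k * FGL.tInv q k c) =
          FGL.t q i k * (if I.erase i = L.toFinset then 1 else 0) * FGL.tInv q k c := by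
        split_ifs <;> simp
      rw [mul_assoc, this, ← ih hL.2 (I.erase i)]
      simp only [Finset.mul_sum, Finset.sum_mul, mul_assoc]
    simp only [List.map_const', List.prod_replicate, one_pow] at hd
    rw [← hd, colMinor_cons]
    calc ∑ K : Finset (Fin n), colMinor (hfun q) ml (FGL.t q) (K.sort (· ≤ ·)) I *
          FGL.minorInv q (c :: L) K
        = ∑ K : Finset (Fin n), ∑ k ∈ K,
            colMinor (hfun q) ml (FGL.t q) (k :: (K.erase k).sort (· ≤ ·)) I *
            (FGL.minorInv q L (K.erase k) * FGL.tInv q k c) := by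
          refine Finset.sum_congr rfl fun K _ => ?_
          rw [FGL.minorInv_cons, Finset.mul_sum]
          exact Finset.sum_congr rfl fun k hk => e1 K k hk
      _ = ∑ k, ∑ K : Finset (Fin n), colMinor (hfun q) ml (FGL.t q) (k :: K.sort (· ≤ ·)) I *
            (FGL.minorInv q L K * FGL.tInv q k c) := by
          refine (sum_sum_eq_sum_erase (fun k K => colMinor (hfun q) ml (FGL.t q)
            (k :: K.sort (· ≤ ·)) I * (FGL.minorInv q L K * FGL.tInv q k c)) ?_).symm
          intro k K hk
          rw [alt.cons_sort_of_mem hk, zero_mul]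
      _ = ∑ i ∈ I, ∑ k, ml (signFront (hfun q) i (I.erase i)) *
            (if I.erase i = L.toFinset then 1 else 0) * (FGL.t q i k * FGL.tInv q k c) := by
          simp only [colMinor_cons, Finset.sum_mul, ← e2]
          rw [Finset.sum_congr rfl fun k _ => Finset.sum_comm, Finset.sum_comm]
      _ = _ := by
          refine Finset.sum_congr rfl fun i _ => ?_
          rw [← Finset.mul_sum, FGL.sum_t_mul_tInv hq0 hq hq1, colMinor_diagonal _ _ _ _ hL.2]
          split_ifs <;> simp

/-- For full sets one term survives, so this minor is a right inverse of `det`. It gives the value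
of the antipode on `det` and hence allows its extension to `det⁻¹`. -/
theorem FGL.minorInv_univ (hq0 : q ≠ 0) (hq : ∀ k : ℕ, 1 ≤ k → k ≤ n → q ^ (2 * k) ≠ 1)
    (hq1 : 2 ≤ n → q ≠ 1) :
    FGL.minorInv q (Finset.univ.sort (· ≤ ·)) (Finset.univ : Finset (Fin n)) = FGL.detInv n q := by
  have h := FGL.sum_colMinor_mul_minorInv hq0 hq hq1 (Finset.univ.sort (· ≤ ·))
    (Finset.sortedLT_sort _).pairwise Finset.univ
  rw [if_pos (Finset.sort_toFinset _ _).symm, Finset.sum_eq_single Finset.univ,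
    ← FGL.minor_eq] at h
  · calc _ = FGL.detInv n q * FGL.det n q * FGL.minorInv q (Finset.univ.sort (· ≤ ·))
          Finset.univ := by rw [FGL.detInv_mul_det, one_mul]
      _ = _ := by rw [mul_assoc, FGL.det, h, mul_one]
  · intro K _ hK
    rw [FGL.minorInv, colMinor_eq_zero _ (FGL.mrOp n q), unop_zero, mul_zero]
    rw [Finset.length_sort]
    exact fun h => hK ((Finset.card_eq_iff_eq_univ K).1 (by rw [h, Finset.card_univ]))
  · intro h; exact (h (Finset.mem_univ _)).elim

/-- The values of the antipode on the generators. -/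
structure FGL.IsAntipodeHom (φ : FGL n q →ₐ[ℂ] (FGL n q)ᵐᵒᵖ) : Prop where
  map_ml : ∀ f : M n, φ (ml f) = op (mr f)
  map_mr : ∀ f : M n, φ (mr f) = op (ml f)
  map_t : ∀ i j, φ (FGL.t q i j) = op (FGL.tInv q i j)
  map_detInv : φ (FGL.detInv n q) = op (FGL.det n q)

theorem FGL.exists_antipode (hq0 : q ≠ 0) (hq : ∀ k : ℕ, 1 ≤ k → k ≤ n → q ^ (2 * k) ≠ 1)
    (hq1 : 2 ≤ n → q ≠ 1) :
    ∃ φ : FGL n q →ₐ[ℂ] (FGL n q)ᵐᵒᵖ, FGL.IsAntipodeHom φ := by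
  have HO := FGL.isRLL_tInv hq0 hq hq1
  have hdet : FM.lift HO (FM.minor q Finset.univ Finset.univ) = op (FGL.detInv n q) := by
    rw [FM.lift_minor, ← FGL.minorInv_univ hq0 hq hq1]; rfl
  refine ⟨FGL.lift (FM.lift HO) (op (FGL.det n q)) ?_ ?_ ?_ ?_ ?_, ⟨?_, ?_, ?_, ?_⟩⟩
  · rw [hdet, ← op_mul, FGL.det_mul_detInv, op_one]
  · rw [hdet, ← op_mul, FGL.detInv_mul_det, op_one]
  · intro i j
    rw [FM.lift_t, ← op_mul, ← op_mul, FGL.det_mul_tInv hq0 hq hq1]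
  · intro f
    rw [FM.lift_ml, FM.lift_ml, FGL.mrOp_apply, FGL.mrOp_apply, ← op_mul, ← op_mul,
      FGL.mr_mul_det, T_T_neg]
  · intro f
    rw [FM.lift_mr, FM.lift_mr, FGL.mlOp_apply, FGL.mlOp_apply, ← op_mul, ← op_mul,
      FGL.ml_mul_det, T_T_neg]
  · intro f; exact (FGL.lift_ofM _).trans (FM.lift_ml _ f)
  · intro f; exact (FGL.lift_ofM _).trans (FM.lift_mr _ f)
  · intro i j; exact (FGL.lift_ofM _).trans (FM.lift_t _ i j)
  · exact FGL.lift_detInv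

end Antipode

/-! The bialgebroid axioms. -/

section Bialgebroid

variable {n : ℕ} {q : ℂ} {A A' B B' C : Type} [Ring A] [Algebra ℂ A] [HPre n A]
  [Ring A'] [Algebra ℂ A'] [HPre n A'] [Ring B] [Algebra ℂ B] [HPre n B]
  [Ring B'] [Algebra ℂ B'] [HPre n B'] [Ring C] [Algebra ℂ C] [HPre n C]

theorem tmap_tm (f : HHom n A A') (g : HHom n B B') {α γ β : H n} {a : A} {b : B}
    (ha : a ∈ grade α γ) (hb : b ∈ grade γ β) :
    tmap f g (tm n a b) = tm n (f.toAlgHom a) (g.toAlgHom b) := by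
  rw [← tmul_eq_tm (mem_rgrade ha) (mem_lgrade hb), tmap_tmul, tmul_eq_tm]

theorem tm_tm_mem_assocGraph {α γ δ β : H n} {a : A} {b : B} {c : C} (ha : a ∈ grade α γ)
    (hb : b ∈ grade γ δ) (hc : c ∈ grade δ β) :
    (tm n (tm n a b) c, tm n a (tm n b c)) ∈ assocGraph n A B C := by
  refine Submodule.subset_span ⟨α, γ, δ, β, a, b, c, ha, hb, hc, ?_⟩
  simp only [tmul_eq_tm]

theorem assocGraph_induction {p : MTensor n (MTensor n A B) C × MTensor n A (MTensor n B C) → Prop}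
    (h0 : p 0) (hadd : ∀ x y, p x → p y → p (x + y)) (hsmul : ∀ (c : ℂ) x, p x → p (c • x))
    (h : ∀ (α γ δ β : H n) (a : A) (b : B) (c : C), a ∈ grade α γ → b ∈ grade γ δ →
      c ∈ grade δ β → p (tm n (tm n a b) c, tm n a (tm n b c))) {x}
    (hx : x ∈ assocGraph n A B C) : p x := by
  refine Submodule.span_induction ?_ h0 (fun a b _ _ => hadd a b) (fun c a _ => hsmul c a) hx
  rintro _ ⟨α, γ, δ, β, a, b, c, ha, hb, hc, rfl⟩
  simp only [tmul_eq_tm]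
  exact h α γ δ β a b c ha hb hc

/-- The associator is given only by its graph. Closure of the graph under products reduces
coassociativity to the generators. -/
theorem mul_mem_assocGraph [GradedMul n A] [GradedMul n B] [GradedMul n C]
    {x y : MTensor n (MTensor n A B) C × MTensor n A (MTensor n B C)}
    (hx : x ∈ assocGraph n A B C) (hy : y ∈ assocGraph n A B C) : x * y ∈ assocGraph n A B C := by
  refine assocGraph_induction (p := fun x => x * y ∈ assocGraph n A B C) ?_ ?_ ?_ ?_ hx
  · rw [zero_mul]; exact zero_mem _
  · intro a a' h h'; rw [add_mul]; exact add_mem h h'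
  · intro c a h; rw [smul_mul_assoc]; exact Submodule.smul_mem _ _ h
  · intro α γ δ β a b c ha hb hc
    refine assocGraph_induction (p := fun y => _ * y ∈ assocGraph n A B C) ?_ ?_ ?_ ?_ hy
    · rw [mul_zero]; exact zero_mem _
    · intro a a' h h'; rw [mul_add]; exact add_mem h h'
    · intro c a h; rw [mul_smul_comm]; exact Submodule.smul_mem _ _ h
    · intro α' γ' δ' β' a' b' c' ha' hb' hc'
      rw [Prod.mk_mul_mk, (Matching.of_grade (tm_mem_grade ha hb) hc).tm_mul
          (Matching.of_grade (tm_mem_grade ha' hb') hc'),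
        (Matching.of_grade ha (tm_mem_grade hb hc)).tm_mul
          (Matching.of_grade ha' (tm_mem_grade hb' hc')),
        (Matching.of_grade ha hb).tm_mul (Matching.of_grade ha' hb'),
        (Matching.of_grade hb hc).tm_mul (Matching.of_grade hb' hc')]
      exact tm_tm_mem_assocGraph (GradedMul.mul_mem ha ha') (GradedMul.mul_mem hb hb')
        (GradedMul.mul_mem hc hc')

theorem HHom.id_apply (a : A) : (HHom.id n A).toAlgHom a = a := rfl

theorem FGL.coassoc (hq0 : q ≠ 0) (hq1 : 2 ≤ n → q ≠ 1) (a : FGL n q) :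
    (tmap (FGL.comul hq0 hq1) (HHom.id n _) ((FGL.comul hq0 hq1).toAlgHom a),
      tmap (HHom.id n _) (FGL.comul hq0 hq1) ((FGL.comul hq0 hq1).toAlgHom a)) ∈
      assocGraph n (FGL n q) (FGL n q) (FGL n q) := by
  have h1 : (1 : FGL n q) ∈ grade (0 : H n) 0 := one_mem_grade
  refine FGL.induction (p := fun a => (tmap (FGL.comul hq0 hq1) (HHom.id n _)
    ((FGL.comul hq0 hq1).toAlgHom a), tmap (HHom.id n _) (FGL.comul hq0 hq1)
    ((FGL.comul hq0 hq1).toAlgHom a)) ∈ assocGraph n (FGL n q) (FGL n q) (FGL n q))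
    ?_ ?_ ?_ ?_ ?_ ?_ ?_ a
  · intro c
    rw [Algebra.algebraMap_eq_smul_one]
    simp only [map_smul, map_one]
    have := Submodule.smul_mem _ c (tm_tm_mem_assocGraph h1 h1 h1)
    simp only [tm_one_one] at this
    exact this
  · intro f
    have hf := ml_mem (A := FGL n q) f
    rw [HHom.toAlgHom_ml, ml_tensor, tmap_tm _ _ hf h1, tmap_tm _ _ hf h1, HHom.id_apply,
      HHom.id_apply, HHom.toAlgHom_ml, map_one, ml_tensor, ← tm_one_one]
    exact tm_tm_mem_assocGraph hf h1 h1
  · intro f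
    have hf := mr_mem (A := FGL n q) f
    rw [HHom.toAlgHom_mr, mr_tensor, tmap_tm _ _ h1 hf, tmap_tm _ _ h1 hf, HHom.id_apply,
      HHom.id_apply, HHom.toAlgHom_mr, map_one, mr_tensor, ← tm_one_one]
    exact tm_tm_mem_assocGraph h1 h1 hf
  · intro i j
    have ht := FGL.t_mem (n := n) q
    have e1 : tmap (FGL.comul hq0 hq1) (HHom.id n _)
        ((FGL.comul hq0 hq1).toAlgHom (FGL.t q i j)) =
        ∑ k, ∑ l, tm n (tm n (FGL.t q i l) (FGL.t q l k)) (FGL.t q k j) := by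
      rw [FGL.comul_t, map_sum]
      refine Finset.sum_congr rfl fun k _ => ?_
      rw [tmap_tm _ _ (ht i k) (ht k j), FGL.comul_t, HHom.id_apply, tm_sum_left]
      exact fun l _ => Matching.of_grade (tm_mem_grade (ht i l) (ht l k)) (ht k j)
    have e2 : tmap (HHom.id n _) (FGL.comul hq0 hq1)
        ((FGL.comul hq0 hq1).toAlgHom (FGL.t q i j)) =
        ∑ k, ∑ l, tm n (FGL.t q i l) (tm n (FGL.t q l k) (FGL.t q k j)) := by
      rw [FGL.comul_t, map_sum, Finset.sum_comm]
      refine Finset.sum_congr rfl fun k _ => ?_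
      rw [tmap_tm _ _ (ht i k) (ht k j), FGL.comul_t, HHom.id_apply, tm_sum_right]
      exact fun l _ => Matching.of_grade (ht i k) (tm_mem_grade (ht k l) (ht l j))
    rw [e1, e2]
    have e3 := sum_mem (S := assocGraph n (FGL n q) (FGL n q) (FGL n q)) (t := Finset.univ)
      fun k _ => sum_mem (t := Finset.univ) fun l _ =>
        tm_tm_mem_assocGraph (ht i l) (ht l k) (ht k j)
    convert e3
    · simp only [Prod.fst_sum]
    · simp only [Prod.snd_sum]
  · have hd := FGL.detInv_mem n q
    rw [FGL.comul_detInv, tmap_tm _ _ hd hd, tmap_tm _ _ hd hd, FGL.comul_detInv]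
    exact tm_tm_mem_assocGraph hd hd hd
  · intro a b ha hb
    simp only [map_add]
    exact add_mem ha hb
  · intro a b ha hb
    simp only [map_mul]
    exact mul_mem_assocGraph ha hb

theorem Dh.mem_grade (α : H n) : (dOp 1 (-α) : Dh n) ∈ grade α α := dOp_mem 1 α

/-- The degree occurs in the statement, so the induction runs over words and carries homogeneity
along, which makes the factors matching when products are formed. -/
theorem FGL.counit_comul_left (hq0 : q ≠ 0) (hq1 : 2 ≤ n → q ≠ 1) {α β : H n} {a : FGL n q}
    (ha : a ∈ grade α β) :
    tmap (FGL.counit n q) (HHom.id n _) ((FGL.comul hq0 hq1).toAlgHom a) =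
      tm n (dOp 1 (-α)) a := by
  have h1 : (1 : FGL n q) ∈ grade (0 : H n) 0 := one_mem_grade
  refine (wordSpan_induction (gen := FGL.gen n q) (deg := FGL.deg n) (δ := (α, β))
    (p := fun a => a ∈ grade α β ∧ tmap (FGL.counit n q) (HHom.id n _)
      ((FGL.comul hq0 hq1).toAlgHom a) = tm n (dOp 1 (-α)) a) ?_ ?_ ?_ ?_ ha).2
  · exact ⟨zero_mem _, by rw [map_zero, map_zero, tm_zero_right]⟩
  · rintro a b ⟨ha, h⟩ ⟨hb, h'⟩
    refine ⟨add_mem ha hb, ?_⟩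
    rw [map_add, map_add, h, h', (Matching.of_grade (Dh.mem_grade α) ha).tm_add_right
      (Matching.of_grade (Dh.mem_grade α) hb)]
  · rintro c a ⟨ha, h⟩
    refine ⟨Submodule.smul_mem _ c ha, ?_⟩
    rw [map_smul, map_smul, h, (Matching.of_grade (Dh.mem_grade α) ha).tm_smul_right]
  · intro w hw
    rw [show α = (w.map (FGL.deg n)).sum.1 by rw [hw], show β = (w.map (FGL.deg n)).sum.2 by rw [hw]]
    refine FGL.word_induction (p := fun a δ => a ∈ grade δ.1 δ.2 ∧ tmap (FGL.counit n q)
      (HHom.id n _) ((FGL.comul hq0 hq1).toAlgHom a) = tm n (dOp 1 (-δ.1)) a) ?_ ?_ ?_ ?_ ?_ ?_ w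
    · refine ⟨h1, ?_⟩
      rw [map_one, map_one, Prod.fst_zero, neg_zero, dOp_one_zero, tm_one_one]
    · intro f
      have hf := ml_mem (A := FGL n q) f
      refine ⟨hf, ?_⟩
      rw [HHom.toAlgHom_ml, ml_tensor, tmap_tm _ _ hf h1, HHom.toAlgHom_ml, HHom.id_apply,
        Prod.fst_zero, neg_zero, dOp_one_zero]
      exact tm_rmom_one f
    · intro f
      have hf := mr_mem (A := FGL n q) f
      refine ⟨hf, ?_⟩
      rw [HHom.toAlgHom_mr, mr_tensor, tmap_tm _ _ h1 hf, map_one, HHom.id_apply,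
        Prod.fst_zero, neg_zero, dOp_one_zero]
    · intro i j
      have ht := FGL.t_mem (n := n) q
      refine ⟨ht i j, ?_⟩
      rw [FGL.comul_t, map_sum, Finset.sum_eq_single i]
      · rw [tmap_tm _ _ (ht i i) (ht i j), FGL.counit_t, if_pos rfl, HHom.id_apply]
      · intro k _ hk
        rw [tmap_tm _ _ (ht i k) (ht k j), FGL.counit_t, if_neg hk.symm, tm_zero_left]
      · intro h; exact (h (Finset.mem_univ _)).elim
    · have hd := FGL.detInv_mem n q
      refine ⟨hd, ?_⟩
      rw [FGL.comul_detInv, tmap_tm _ _ hd hd, FGL.counit_detInv, neg_neg, HHom.id_apply]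
    · rintro a b δ ε ⟨ha, h⟩ ⟨hb, h'⟩
      refine ⟨GradedMul.mul_mem ha hb, ?_⟩
      rw [map_mul, map_mul, h, h', (Matching.of_grade (Dh.mem_grade _) ha).tm_mul
        (Matching.of_grade (Dh.mem_grade _) hb), dOp_mul, map_one, mul_one, Prod.fst_add, neg_add]

theorem FGL.counit_comul_right (hq0 : q ≠ 0) (hq1 : 2 ≤ n → q ≠ 1) {α β : H n} {a : FGL n q}
    (ha : a ∈ grade α β) :
    tmap (HHom.id n _) (FGL.counit n q) ((FGL.comul hq0 hq1).toAlgHom a) =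
      tm n a (dOp 1 (-β)) := by
  have h1 : (1 : FGL n q) ∈ grade (0 : H n) 0 := one_mem_grade
  refine (wordSpan_induction (gen := FGL.gen n q) (deg := FGL.deg n) (δ := (α, β))
    (p := fun a => a ∈ grade α β ∧ tmap (HHom.id n _) (FGL.counit n q)
      ((FGL.comul hq0 hq1).toAlgHom a) = tm n a (dOp 1 (-β))) ?_ ?_ ?_ ?_ ha).2
  · exact ⟨zero_mem _, by rw [map_zero, map_zero, tm_zero_left]⟩
  · rintro a b ⟨ha, h⟩ ⟨hb, h'⟩
    refine ⟨add_mem ha hb, ?_⟩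
    rw [map_add, map_add, h, h', (Matching.of_grade ha (Dh.mem_grade β)).tm_add_left
      (Matching.of_grade hb (Dh.mem_grade β))]
  · rintro c a ⟨ha, h⟩
    refine ⟨Submodule.smul_mem _ c ha, ?_⟩
    rw [map_smul, map_smul, h, (Matching.of_grade ha (Dh.mem_grade β)).tm_smul_left]
  · intro w hw
    rw [show α = (w.map (FGL.deg n)).sum.1 by rw [hw], show β = (w.map (FGL.deg n)).sum.2 by rw [hw]]
    refine FGL.word_induction (p := fun a δ => a ∈ grade δ.1 δ.2 ∧ tmap (HHom.id n _)
      (FGL.counit n q) ((FGL.comul hq0 hq1).toAlgHom a) = tm n a (dOp 1 (-δ.2))) ?_ ?_ ?_ ?_ ?_ ?_ w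
    · refine ⟨h1, ?_⟩
      rw [map_one, map_one, Prod.snd_zero, neg_zero, dOp_one_zero, tm_one_one]
    · intro f
      have hf := ml_mem (A := FGL n q) f
      refine ⟨hf, ?_⟩
      rw [HHom.toAlgHom_ml, ml_tensor, tmap_tm _ _ hf h1, map_one, HHom.id_apply,
        Prod.snd_zero, neg_zero, dOp_one_zero]
    · intro f
      have hf := mr_mem (A := FGL n q) f
      refine ⟨hf, ?_⟩
      rw [HHom.toAlgHom_mr, mr_tensor, tmap_tm _ _ h1 hf, HHom.toAlgHom_mr, HHom.id_apply,
        Prod.snd_zero, neg_zero, dOp_one_zero]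
      exact (tm_rmom_one f).symm
    · intro i j
      have ht := FGL.t_mem (n := n) q
      refine ⟨ht i j, ?_⟩
      rw [FGL.comul_t, map_sum, Finset.sum_eq_single j]
      · rw [tmap_tm _ _ (ht i j) (ht j j), FGL.counit_t, if_pos rfl, HHom.id_apply]
      · intro k _ hk
        rw [tmap_tm _ _ (ht i k) (ht k j), FGL.counit_t, if_neg hk, tm_zero_right]
      · intro h; exact (h (Finset.mem_univ _)).elim
    · have hd := FGL.detInv_mem n q
      refine ⟨hd, ?_⟩
      rw [FGL.comul_detInv, tmap_tm _ _ hd hd, FGL.counit_detInv, neg_neg, HHom.id_apply]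
    · rintro a b δ ε ⟨ha, h⟩ ⟨hb, h'⟩
      refine ⟨GradedMul.mul_mem ha hb, ?_⟩
      rw [map_mul, map_mul, h, h', (Matching.of_grade ha (Dh.mem_grade _)).tm_mul
        (Matching.of_grade hb (Dh.mem_grade _)), dOp_mul, map_one, mul_one, Prod.snd_add, neg_add]

theorem FGL.isHBialgebroid (hq0 : q ≠ 0) (hq1 : 2 ≤ n → q ≠ 1) :
    IsHBialgebroid (FGL.comul hq0 hq1) (FGL.counit n q) where
  isHAlgebra := FGL.isHAlgebra n q
  coassoc := FGL.coassoc hq0 hq1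
  counit_left _ _ _ ha := by rw [tmul_eq_tm, FGL.counit_comul_left hq0 hq1 ha]
  counit_right _ _ _ ha := by rw [tmul_eq_tm, FGL.counit_comul_right hq0 hq1 ha]

end Bialgebroid

/-! The antipode axioms. -/

/-- The quotient by a two-sided ideal containing the relations factors through `⊗̃`. This gives
control over all representatives of an element of `⊗̃`. -/
theorem sub_mem_of_mkT_eq {n : ℕ} {A B : Type} [Ring A] [Algebra ℂ A] [Ring B] [Algebra ℂ B]
    [RightGraded n A] [LeftGraded n B] (K : Ideal (matchSub n A B)) [K.IsTwoSided]
    (hK : ∀ x y, MRel n A B x y → x - y ∈ K) {x y : matchSub n A B}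
    (h : mkT n A B x = mkT n A B y) : x - y ∈ K := by
  let ψ : MTensor n A B →ₐ[ℂ] (matchSub n A B ⧸ K) := RingQuot.liftAlgHom ℂ
    ⟨Ideal.Quotient.mkₐ ℂ K, fun x y hxy => Ideal.Quotient.eq.2 (hK x y hxy)⟩
  have e : ∀ x, ψ (mkT n A B x) = Ideal.Quotient.mkₐ ℂ K x := fun x =>
    RingQuot.liftAlgHom_mkAlgHom_apply ..
  have := congrArg ψ h
  rw [e, e] at this
  exact Ideal.Quotient.eq.1 this

section Antipode

open MulOpposite

variable {n : ℕ} {q : ℂ} {φ : FGL n q →ₐ[ℂ] (FGL n q)ᵐᵒᵖ}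

theorem FGL.unop_map_mul (φ : FGL n q →ₐ[ℂ] (FGL n q)ᵐᵒᵖ) (a b : FGL n q) :
    unop (φ (a * b)) = unop (φ b) * unop (φ a) := by rw [map_mul, unop_mul]

theorem FGL.IsAntipodeHom.mem_grade (hφ : FGL.IsAntipodeHom φ) {α β : H n} {a : FGL n q}
    (ha : a ∈ grade α β) : unop (φ a) ∈ grade (-β) (-α) := by
  refine wordSpan_induction (gen := FGL.gen n q) (deg := FGL.deg n) (δ := (α, β))
    (p := fun a => unop (φ a) ∈ grade (-β) (-α)) ?_ ?_ ?_ ?_ ha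
  · rw [map_zero]; exact zero_mem _
  · intro a b h h'; rw [map_add]; exact add_mem h h'
  · intro c a h; rw [map_smul]; exact Submodule.smul_mem _ c h
  · intro w hw
    rw [show α = (w.map (FGL.deg n)).sum.1 by rw [hw], show β = (w.map (FGL.deg n)).sum.2 by rw [hw]]
    refine FGL.word_induction (p := fun a δ => unop (φ a) ∈ grade (-δ.2) (-δ.1)) ?_ ?_ ?_ ?_ ?_ ?_ w
    · rw [map_one, Prod.fst_zero, Prod.snd_zero, neg_zero]
      exact one_mem_grade
    · intro f
      rw [hφ.map_ml, Prod.fst_zero, Prod.snd_zero, neg_zero]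
      exact mr_mem f
    · intro f
      rw [hφ.map_mr, Prod.fst_zero, Prod.snd_zero, neg_zero]
      exact ml_mem f
    · intro i j
      rw [hφ.map_t]
      exact FGL.tInv_mem q i j
    · rw [hφ.map_detInv, neg_neg]
      exact FGL.det_mem_grade n q
    · intro a b δ ε ha hb
      rw [FGL.unop_map_mul, Prod.fst_add, Prod.snd_add, neg_add_rev, neg_add_rev]
      exact GradedMul.mul_mem hb ha

theorem FGL.IsAntipodeHom.mem_lgrade (hφ : FGL.IsAntipodeHom φ) {γ : H n} {a : FGL n q}
    (ha : a ∈ rgrade γ) : unop (φ a) ∈ lgrade (-γ) := by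
  refine Submodule.iSup_induction _ (motive := fun a => unop (φ a) ∈ lgrade (-γ)) ha ?_ ?_ ?_
  · intro _ a ha; exact DynGL.mem_lgrade (hφ.mem_grade ha)
  · rw [map_zero]; exact zero_mem _
  · intro a b h h'; rw [map_add]; exact add_mem h h'

theorem FGL.IsAntipodeHom.mem_rgrade (hφ : FGL.IsAntipodeHom φ) {γ : H n} {a : FGL n q}
    (ha : a ∈ lgrade γ) : unop (φ a) ∈ rgrade (-γ) := by
  refine Submodule.iSup_induction _ (motive := fun a => unop (φ a) ∈ rgrade (-γ)) ha ?_ ?_ ?_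
  · intro _ a ha; exact DynGL.mem_rgrade (hφ.mem_grade ha)
  · rw [map_zero]; exact zero_mem _
  · intro a b h h'; rw [map_add]; exact add_mem h h'

/-- `a ⊗ b ↦ (c ↦ a c S(b))`. -/
def FGL.actRight (φ : FGL n q →ₐ[ℂ] (FGL n q)ᵐᵒᵖ) :
    FGL n q ⊗[ℂ] FGL n q →ₐ[ℂ] Module.End ℂ (FGL n q) :=
  Algebra.TensorProduct.lift (Algebra.lmul ℂ (FGL n q))
    ((Algebra.lsmul ℂ ℂ (FGL n q) : (FGL n q)ᵐᵒᵖ →ₐ[ℂ] _).comp φ) fun a b =>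
      LinearMap.ext fun c => (mul_assoc a c (unop (φ b))).symm

theorem FGL.actRight_tmul (φ : FGL n q →ₐ[ℂ] (FGL n q)ᵐᵒᵖ) (a b c : FGL n q) :
    FGL.actRight φ (a ⊗ₜ b) c = a * c * unop (φ b) :=
  (DFunLike.congr_fun (Algebra.TensorProduct.lift_tmul _ _ _ a b) c).trans
    (mul_assoc a c (unop (φ b))).symm

/-- `a ⊗ b ↦ (c ↦ S(a) c b)`. -/
def FGL.actLeft (φ : FGL n q →ₐ[ℂ] (FGL n q)ᵐᵒᵖ) :
    FGL n q ⊗[ℂ] FGL n q →ₐ[ℂ] (Module.End ℂ (FGL n q))ᵐᵒᵖ :=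
  Algebra.TensorProduct.lift ((AlgHom.op (Algebra.lmul ℂ (FGL n q))).comp φ)
    (AlgHom.opComm.symm (Algebra.lsmul ℂ ℂ (FGL n q) : (FGL n q)ᵐᵒᵖ →ₐ[ℂ] _)) fun a b =>
      unop_injective (LinearMap.ext fun c => mul_assoc (unop (φ a)) c b)

theorem FGL.actLeft_tmul (φ : FGL n q →ₐ[ℂ] (FGL n q)ᵐᵒᵖ) (a b c : FGL n q) :
    unop (FGL.actLeft φ (a ⊗ₜ b)) c = unop (φ a) * c * b :=
  DFunLike.congr_fun (congrArg unop (Algebra.TensorProduct.lift_tmul _ _ _ a b)) c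

/-- Since `S` negates and interchanges the degrees, inserting `c` between matching factors leaves
the right degree zero intact. The relations of `⊗̃` act trivially only on such `c`, so this subspace
has to be stable. -/
theorem FGL.IsAntipodeHom.actRight_mem (hφ : FGL.IsAntipodeHom φ)
    {x : FGL n q ⊗[ℂ] FGL n q} (hx : x ∈ matchSub n (FGL n q) (FGL n q)) :
    ∀ c ∈ (rgrade (0 : H n) : Submodule ℂ (FGL n q)), FGL.actRight φ x c ∈ rgrade (0 : H n) := by
  refine Algebra.adjoin_induction (p := fun x _ => ∀ c ∈ (rgrade (0 : H n) : Submodule ℂ (FGL n q)),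
    FGL.actRight φ x c ∈ rgrade (0 : H n)) ?_ ?_ ?_ ?_ hx
  · rintro _ ⟨γ, a, b, ha, hb, rfl⟩ c hc
    rw [FGL.actRight_tmul]
    have := rgrade_mul_mem (rgrade_mul_mem ha hc) (hφ.mem_rgrade hb)
    rwa [add_zero, add_neg_cancel] at this
  · intro z c hc
    rw [AlgHom.commutes, Module.algebraMap_end_apply]
    exact Submodule.smul_mem _ z hc
  · intro x y _ _ h h' c hc
    rw [map_add]
    exact add_mem (h c hc) (h' c hc)
  · intro x y _ _ h h' c hc
    rw [map_mul]
    exact h _ (h' c hc)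

theorem FGL.IsAntipodeHom.actLeft_mem (hφ : FGL.IsAntipodeHom φ)
    {x : FGL n q ⊗[ℂ] FGL n q} (hx : x ∈ matchSub n (FGL n q) (FGL n q)) :
    ∀ c ∈ (lgrade (0 : H n) : Submodule ℂ (FGL n q)),
      unop (FGL.actLeft φ x) c ∈ lgrade (0 : H n) := by
  refine Algebra.adjoin_induction (p := fun x _ => ∀ c ∈ (lgrade (0 : H n) : Submodule ℂ (FGL n q)),
    unop (FGL.actLeft φ x) c ∈ lgrade (0 : H n)) ?_ ?_ ?_ ?_ hx
  · rintro _ ⟨γ, a, b, ha, hb, rfl⟩ c hc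
    rw [FGL.actLeft_tmul]
    have := lgrade_mul_mem (lgrade_mul_mem (hφ.mem_lgrade ha) hc) hb
    rwa [add_zero, neg_add_cancel] at this
  · intro z c hc
    rw [AlgHom.commutes, MulOpposite.algebraMap_apply, unop_op, Module.algebraMap_end_apply]
    exact Submodule.smul_mem _ z hc
  · intro x y _ _ h h' c hc
    rw [map_add]
    exact add_mem (h c hc) (h' c hc)
  · intro x y _ _ h h' c hc
    rw [map_mul, unop_mul]
    exact h' _ (h c hc)

/-- `m (id ⊗ S)` is well defined on the matrix tensor product. -/
theorem FGL.IsAntipodeHom.actRight_eq (hφ : FGL.IsAntipodeHom φ)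
    {x y : matchSub n (FGL n q) (FGL n q)} (h : mkT n _ _ x = mkT n _ _ y) {c : FGL n q}
    (hc : c ∈ rgrade (0 : H n)) : FGL.actRight φ x c = FGL.actRight φ y c := by
  -- The annihilator of the right-degree-zero part is a left ideal at once; it is two-sided because
  -- that part is stable under the action.
  let K : Ideal (matchSub n (FGL n q) (FGL n q)) :=
    { carrier := {x | ∀ c ∈ (rgrade (0 : H n) : Submodule ℂ (FGL n q)),
        FGL.actRight φ (x : FGL n q ⊗[ℂ] FGL n q) c = 0}
      zero_mem' := fun c _ => by
        change FGL.actRight φ 0 c = 0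
        rw [map_zero]; rfl
      add_mem' := fun {x y} hx hy c hc => by
        change FGL.actRight φ (x + y : FGL n q ⊗[ℂ] FGL n q) c = 0
        rw [map_add, LinearMap.add_apply, hx c hc, hy c hc, add_zero]
      smul_mem' := fun y x hx c hc => by
        change FGL.actRight φ (y * x : FGL n q ⊗[ℂ] FGL n q) c = 0
        rw [map_mul, Module.End.mul_apply, hx c hc, map_zero] }
  have : K.IsTwoSided := ⟨fun {x} y hx c hc => by
    change FGL.actRight φ (x * y : FGL n q ⊗[ℂ] FGL n q) c = 0
    rw [map_mul, Module.End.mul_apply]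
    exact hx _ (hφ.actRight_mem y.2 c hc)⟩
  have h1 : x - y ∈ K := by
    refine sub_mem_of_mkT_eq K ?_ h
    rintro x y ⟨f, γ, a, b, ha, hb, hx, hy⟩ c hc
    change FGL.actRight φ (x - y : FGL n q ⊗[ℂ] FGL n q) c = 0
    rw [map_sub, LinearMap.sub_apply, hx, hy, FGL.actRight_tmul, FGL.actRight_tmul,
      FGL.unop_map_mul, sub_eq_zero]
    change mr f * a * c * unop (φ b) = a * c * (unop (φ b) * unop (φ (ml f)))
    -- The product `a c S(b)` has right degree zero, so `μ_r(f)` passes from its left to its right,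
    -- where it is absorbed as `S(μ_l(f))`.
    have h2 := rgrade_mul_mem (rgrade_mul_mem ha hc) (hφ.mem_rgrade hb)
    rw [add_zero, add_neg_cancel] at h2
    have h3 := FGL.mr_mul_of_rgrade f h2
    rw [T_zero] at h3
    rw [hφ.map_ml, unop_op, ← mul_assoc (a * c), ← h3]
    simp only [mul_assoc]
  have h2 : FGL.actRight φ (x - y : FGL n q ⊗[ℂ] FGL n q) c = 0 := h1 c hc
  rwa [map_sub, LinearMap.sub_apply, sub_eq_zero] at h2

/-- `m (S ⊗ id)` is well defined on the matrix tensor product. -/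
theorem FGL.IsAntipodeHom.actLeft_eq (hφ : FGL.IsAntipodeHom φ)
    {x y : matchSub n (FGL n q) (FGL n q)} (h : mkT n _ _ x = mkT n _ _ y) {c : FGL n q}
    (hc : c ∈ lgrade (0 : H n)) : unop (FGL.actLeft φ x) c = unop (FGL.actLeft φ y) c := by
  let K : Ideal (matchSub n (FGL n q) (FGL n q)) :=
    { carrier := {x | ∀ c ∈ (lgrade (0 : H n) : Submodule ℂ (FGL n q)),
        unop (FGL.actLeft φ (x : FGL n q ⊗[ℂ] FGL n q)) c = 0}
      zero_mem' := fun c _ => by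
        change unop (FGL.actLeft φ 0) c = 0
        rw [map_zero]; rfl
      add_mem' := fun {x y} hx hy c hc => by
        change unop (FGL.actLeft φ (x + y : FGL n q ⊗[ℂ] FGL n q)) c = 0
        rw [map_add, unop_add, LinearMap.add_apply, hx c hc, hy c hc, add_zero]
      smul_mem' := fun y x hx c hc => by
        change unop (FGL.actLeft φ (y * x : FGL n q ⊗[ℂ] FGL n q)) c = 0
        rw [map_mul, unop_mul, Module.End.mul_apply]
        exact hx _ (hφ.actLeft_mem y.2 c hc) }
  have : K.IsTwoSided := ⟨fun {x} y hx c hc => by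
    change unop (FGL.actLeft φ (x * y : FGL n q ⊗[ℂ] FGL n q)) c = 0
    rw [map_mul, unop_mul, Module.End.mul_apply, hx c hc, map_zero]⟩
  have h1 : x - y ∈ K := by
    refine sub_mem_of_mkT_eq K ?_ h
    rintro x y ⟨f, γ, a, b, ha, hb, hx, hy⟩ c hc
    change unop (FGL.actLeft φ (x - y : FGL n q ⊗[ℂ] FGL n q)) c = 0
    rw [map_sub, unop_sub, LinearMap.sub_apply, hx, hy, FGL.actLeft_tmul, FGL.actLeft_tmul,
      FGL.unop_map_mul, sub_eq_zero]
    change unop (φ a) * unop (φ (mr f)) * c * b = unop (φ a) * c * (ml f * b)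
    -- Here `c` itself has left degree zero, so `S(μ_r(f)) = μ_l(f)` passes through it to `b`.
    have h3 := FGL.ml_mul_of_lgrade f hc
    rw [T_zero] at h3
    rw [hφ.map_mr, unop_op, mul_assoc (unop (φ a)), h3]
    simp only [mul_assoc]
  have h2 : unop (FGL.actLeft φ (x - y : FGL n q ⊗[ℂ] FGL n q)) c = 0 := h1 c hc
  rwa [map_sub, unop_sub, LinearMap.sub_apply, sub_eq_zero] at h2

theorem exists_mkT_tm {A B : Type} [Ring A] [Algebra ℂ A] [Ring B] [Algebra ℂ B]
    [RightGraded n A] [LeftGraded n B] {a : A} {b : B} (h : Matching n a b) :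
    ∃ x : matchSub n A B, mkT n A B x = tm n a b ∧ (x : A ⊗[ℂ] B) = a ⊗ₜ b :=
  ⟨⟨_, h⟩, h.tm_eq.symm, rfl⟩

theorem FGL.exists_mkT_comul_t (hq0 : q ≠ 0) (hq1 : 2 ≤ n → q ≠ 1) (i j : Fin n) :
    ∃ x : matchSub n (FGL n q) (FGL n q),
      mkT n _ _ x = (FGL.comul hq0 hq1).toAlgHom (FGL.t q i j) ∧
      (x : FGL n q ⊗[ℂ] FGL n q) = ∑ k, FGL.t q i k ⊗ₜ FGL.t q k j := by
  choose x hx hx' using fun k => exists_mkT_tm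
    (Matching.of_grade (FGL.t_mem (n := n) q i k) (FGL.t_mem q k j))
  refine ⟨∑ k, x k, ?_, ?_⟩
  · rw [map_sum, FGL.comul_t]; exact Finset.sum_congr rfl fun k _ => hx k
  · rw [AddSubmonoidClass.coe_finsetSum]; exact Finset.sum_congr rfl fun k _ => hx' k

/-- On `μ_l(M)` the element `Δ(a)` acts as the difference operator `ε(a)`. Both sides are
multiplicative in `a`, so generators suffice; for `t_{ij}` this is the right inverse property. The
argument `1` gives the antipode axiom. -/
theorem FGL.IsAntipodeHom.exists_actRight (hφ : FGL.IsAntipodeHom φ) (hq0 : q ≠ 0)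
    (hq : ∀ k : ℕ, 1 ≤ k → k ≤ n → q ^ (2 * k) ≠ 1) (hq1 : 2 ≤ n → q ≠ 1) (a : FGL n q) :
    ∃ x : matchSub n (FGL n q) (FGL n q), mkT n _ _ x = (FGL.comul hq0 hq1).toAlgHom a ∧
      ∀ g : M n, FGL.actRight φ x (ml g) =
        ml (Dh.toEnd n ((FGL.counit n q).toAlgHom a) g) := by
  have h1 : (1 : FGL n q) ∈ grade (0 : H n) 0 := one_mem_grade
  refine FGL.induction (p := fun a => ∃ x : matchSub n (FGL n q) (FGL n q),
    mkT n _ _ x = (FGL.comul hq0 hq1).toAlgHom a ∧ ∀ g : M n, FGL.actRight φ x (ml g) =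
        ml (Dh.toEnd n ((FGL.counit n q).toAlgHom a) g)) ?_ ?_ ?_ ?_ ?_ ?_ ?_ a
  · intro c
    refine ⟨algebraMap ℂ _ c, by rw [AlgHom.commutes, AlgHom.commutes], fun g => ?_⟩
    rw [AlgHom.commutes, AlgHom.commutes, Subalgebra.coe_algebraMap, AlgHom.commutes,
      Module.algebraMap_end_apply, Module.algebraMap_end_apply, map_smul]
  · intro f
    obtain ⟨x, hx, hx'⟩ := exists_mkT_tm (Matching.ml_one (A := FGL n q) (B := FGL n q) f)
    refine ⟨x, by rw [hx, HHom.toAlgHom_ml, ml_tensor], fun g => ?_⟩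
    rw [hx', FGL.actRight_tmul, map_one, unop_one, mul_one, HHom.toAlgHom_ml, ← map_mul]
    rfl
  · intro f
    obtain ⟨x, hx, hx'⟩ := exists_mkT_tm (Matching.one_mr (A := FGL n q) (B := FGL n q) f)
    refine ⟨x, by rw [hx, HHom.toAlgHom_mr, mr_tensor], fun g => ?_⟩
    rw [hx', FGL.actRight_tmul, hφ.map_mr, unop_op, one_mul, HHom.toAlgHom_mr, ← map_mul, mul_comm]
    rfl
  · intro i j
    obtain ⟨x, hx, hx'⟩ := FGL.exists_mkT_comul_t hq0 hq1 i j
    refine ⟨x, hx, fun g => ?_⟩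
    have h2 : ∀ k, FGL.actRight φ (FGL.t q i k ⊗ₜ FGL.t q k j) (ml g) =
        ml (T (-wt i) g) * (FGL.t q i k * FGL.tInv q k j) := fun k => by
      rw [FGL.actRight_tmul, hφ.map_t, unop_op, (FGL.isRLL n q).t_l, mul_assoc]
    rw [hx', map_sum, LinearMap.sum_apply, Finset.sum_congr rfl fun k _ => h2 k,
      ← Finset.mul_sum, FGL.sum_t_mul_tInv hq0 hq hq1, FGL.counit_t]
    split_ifs with h
    · rw [mul_one, dOp_apply, one_mul]
    · rw [mul_zero, map_zero, LinearMap.zero_apply, map_zero]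
  · obtain ⟨x, hx, hx'⟩ := exists_mkT_tm
      (Matching.of_grade (FGL.detInv_mem n q) (FGL.detInv_mem n q))
    refine ⟨x, by rw [hx, FGL.comul_detInv], fun g => ?_⟩
    rw [hx', FGL.actRight_tmul, hφ.map_detInv, unop_op, FGL.counit_detInv, dOp_apply, one_mul,
      mul_assoc, FGL.ml_mul_det, ← mul_assoc, FGL.detInv_mul_det, one_mul]
  · rintro a b ⟨x, hx, hx'⟩ ⟨y, hy, hy'⟩
    refine ⟨x + y, by rw [map_add, map_add, hx, hy], fun g => ?_⟩
    rw [Subalgebra.coe_add, map_add, LinearMap.add_apply, hx', hy', map_add, map_add,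
      LinearMap.add_apply, map_add]
  · rintro a b ⟨x, hx, hx'⟩ ⟨y, hy, hy'⟩
    refine ⟨x * y, by rw [map_mul, map_mul, hx, hy], fun g => ?_⟩
    rw [Subalgebra.coe_mul, map_mul, Module.End.mul_apply, hy', hx', map_mul, map_mul,
      Module.End.mul_apply]

/-- The action `c ↦ S(a) c b` reverses the order of composition, so on `μ_r(M)` it gives a
transposed form of the counit: `ε(a) = f T_{-α}` acts by `g ↦ T_α(g f)`. This form depends on `α`,
hence the restriction to homogeneous `a`. -/
theorem FGL.IsAntipodeHom.exists_actLeft (hφ : FGL.IsAntipodeHom φ) (hq0 : q ≠ 0)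
    (hq1 : 2 ≤ n → q ≠ 1) {α β : H n} {a : FGL n q} (ha : a ∈ grade α β) :
    ∃ x : matchSub n (FGL n q) (FGL n q), mkT n _ _ x = (FGL.comul hq0 hq1).toAlgHom a ∧
      ∃ f : M n, (FGL.counit n q).toAlgHom a = dOp f (-α) ∧
      ∀ g : M n, unop (FGL.actLeft φ x) (mr g) = mr (T α (g * f)) := by
  have h1 : (1 : FGL n q) ∈ grade (0 : H n) 0 := one_mem_grade
  refine wordSpan_induction (gen := FGL.gen n q) (deg := FGL.deg n) (δ := (α, β))
    (p := fun a => ∃ x : matchSub n (FGL n q) (FGL n q),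
      mkT n _ _ x = (FGL.comul hq0 hq1).toAlgHom a ∧
      ∃ f : M n, (FGL.counit n q).toAlgHom a = dOp f (-α) ∧
      ∀ g : M n, unop (FGL.actLeft φ x) (mr g) = mr (T α (g * f))) ?_ ?_ ?_ ?_ ha
  · refine ⟨0, by rw [map_zero, map_zero], 0, by rw [map_zero, dOp_zero], fun g => ?_⟩
    rw [Subalgebra.coe_zero, map_zero, mul_zero, map_zero, map_zero]
    rfl
  · rintro a b ⟨x, hx, f, hf, hx'⟩ ⟨y, hy, f', hf', hy'⟩
    refine ⟨x + y, by rw [map_add, map_add, hx, hy], f + f', by rw [map_add, hf, hf', dOp_add],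
      fun g => ?_⟩
    rw [Subalgebra.coe_add, map_add, unop_add, LinearMap.add_apply, hx', hy', mul_add, map_add,
      map_add]
  · rintro c a ⟨x, hx, f, hf, hx'⟩
    refine ⟨c • x, by rw [map_smul, map_smul, hx], c • f, by rw [map_smul, hf, smul_dOp],
      fun g => ?_⟩
    rw [Subalgebra.coe_smul, map_smul, unop_smul, LinearMap.smul_apply, hx', mul_smul_comm,
      map_smul, map_smul]
  · intro w hw
    rw [show α = (w.map (FGL.deg n)).sum.1 by rw [hw]]
    refine FGL.word_induction (p := fun a δ => ∃ x : matchSub n (FGL n q) (FGL n q),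
      mkT n _ _ x = (FGL.comul hq0 hq1).toAlgHom a ∧
      ∃ f : M n, (FGL.counit n q).toAlgHom a = dOp f (-δ.1) ∧
      ∀ g : M n, unop (FGL.actLeft φ x) (mr g) = mr (T δ.1 (g * f))) ?_ ?_ ?_ ?_ ?_ ?_ w
    · refine ⟨1, by rw [map_one, map_one], 1, ?_, fun g => ?_⟩
      · rw [map_one, Prod.fst_zero, neg_zero, dOp_one_zero]
      · rw [Subalgebra.coe_one, map_one, unop_one, mul_one, Prod.fst_zero, T_zero]
        rfl
    · intro f
      obtain ⟨x, hx, hx'⟩ := exists_mkT_tm (Matching.ml_one (A := FGL n q) (B := FGL n q) f)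
      refine ⟨x, by rw [hx, HHom.toAlgHom_ml, ml_tensor], f, ?_, fun g => ?_⟩
      · rw [HHom.toAlgHom_ml]; exact dMul_eq f
      · rw [hx', FGL.actLeft_tmul, hφ.map_ml, unop_op, mul_one, Prod.fst_zero, T_zero, ← map_mul,
          mul_comm]
    · intro f
      obtain ⟨x, hx, hx'⟩ := exists_mkT_tm (Matching.one_mr (A := FGL n q) (B := FGL n q) f)
      refine ⟨x, by rw [hx, HHom.toAlgHom_mr, mr_tensor], f, ?_, fun g => ?_⟩
      · rw [HHom.toAlgHom_mr]; exact dMul_eq f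
      · rw [hx', FGL.actLeft_tmul, map_one, unop_one, one_mul, Prod.fst_zero, T_zero, ← map_mul]
    · intro i j
      obtain ⟨x, hx, hx'⟩ := FGL.exists_mkT_comul_t hq0 hq1 i j
      refine ⟨x, hx, if i = j then 1 else 0, ?_, fun g => ?_⟩
      · rw [FGL.counit_t]
        split_ifs
        · rfl
        · rw [dOp_zero]
      · have h2 : ∀ k, unop (FGL.actLeft φ (FGL.t q i k ⊗ₜ FGL.t q k j)) (mr g) =
            mr (T (wt i) g) * (FGL.tInv q i k * FGL.t q k j) := fun k => by
          rw [FGL.actLeft_tmul, hφ.map_t, unop_op, FGL.tInv_mul_mr, mul_assoc]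
        rw [hx', map_sum, Finset.unop_sum, LinearMap.sum_apply,
          Finset.sum_congr rfl fun k _ => h2 k, ← Finset.mul_sum, FGL.sum_tInv_mul_t hq0 hq1]
        split_ifs with h
        · rw [mul_one, mul_one]
        · rw [mul_zero, mul_zero, map_zero, map_zero]
    · obtain ⟨x, hx, hx'⟩ := exists_mkT_tm
        (Matching.of_grade (FGL.detInv_mem n q) (FGL.detInv_mem n q))
      refine ⟨x, by rw [hx, FGL.comul_detInv], 1, by rw [FGL.counit_detInv, neg_neg],
        fun g => ?_⟩
      rw [hx', FGL.actLeft_tmul, hφ.map_detInv, unop_op, mul_assoc, FGL.mr_mul_detInv, ← mul_assoc,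
        FGL.det_mul_detInv, one_mul, mul_one]
    · rintro a b δ ε ⟨x, hx, f, hf, hx'⟩ ⟨y, hy, f', hf', hy'⟩
      refine ⟨x * y, by rw [map_mul, map_mul, hx, hy], f * T (-δ.1) f', ?_, fun g => ?_⟩
      · rw [map_mul, hf, hf', dOp_mul, Prod.fst_add, neg_add]
      · rw [Subalgebra.coe_mul, map_mul, unop_mul, Module.End.mul_apply, hx', hy', Prod.fst_add,
          ← mul_assoc, map_mul, map_mul _ (g * f), T_T, T_T, add_comm δ.1 ε.1,
          add_neg_cancel_right]

/-- The linear map underlying an anti-homomorphism. -/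
def FGL.antipode (φ : FGL n q →ₐ[ℂ] (FGL n q)ᵐᵒᵖ) : FGL n q →ₗ[ℂ] FGL n q :=
  (opLinearEquiv ℂ).symm.toLinearMap ∘ₗ φ.toLinearMap

theorem FGL.antipode_apply (a : FGL n q) : FGL.antipode φ a = unop (φ a) := rfl

theorem FGL.mul'_map_id_antipode (x : FGL n q ⊗[ℂ] FGL n q) :
    LinearMap.mul' ℂ _ (TensorProduct.map LinearMap.id (FGL.antipode φ) x) =
      FGL.actRight φ x 1 := by
  induction x using TensorProduct.induction_on with
  | zero => simp
  | tmul a b =>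
    rw [TensorProduct.map_tmul, LinearMap.mul'_apply, FGL.actRight_tmul, mul_one]; rfl
  | add x y hx hy => rw [map_add, map_add, map_add, hx, hy, LinearMap.add_apply]

theorem FGL.mul'_map_antipode_id (x : FGL n q ⊗[ℂ] FGL n q) :
    LinearMap.mul' ℂ _ (TensorProduct.map (FGL.antipode φ) LinearMap.id x) =
      unop (FGL.actLeft φ x) 1 := by
  induction x using TensorProduct.induction_on with
  | zero => simp
  | tmul a b =>
    rw [TensorProduct.map_tmul, LinearMap.mul'_apply, FGL.actLeft_tmul, mul_one]; rfl
  | add x y hx hy => rw [map_add, map_add, map_add, hx, hy, unop_add, LinearMap.add_apply]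

theorem FGL.IsAntipodeHom.isAntipode (hφ : FGL.IsAntipodeHom φ) (hq0 : q ≠ 0)
    (hq : ∀ k : ℕ, 1 ≤ k → k ≤ n → q ^ (2 * k) ≠ 1) (hq1 : 2 ≤ n → q ≠ 1) :
    IsAntipode (FGL.comul hq0 hq1) (FGL.counit n q) (FGL.antipode φ) where
  map_mr_mul f a := by
    rw [FGL.antipode_apply, FGL.unop_map_mul, hφ.map_mr]; rfl
  map_mul_ml f a := by
    rw [FGL.antipode_apply, FGL.unop_map_mul, hφ.map_ml]; rfl
  mul_id_S a x hx := by
    obtain ⟨y, hy, hy'⟩ := hφ.exists_actRight hq0 hq hq1 a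
    have := hy' 1
    rw [map_one] at this
    rw [FGL.mul'_map_id_antipode, hφ.actRight_eq (hx.trans hy.symm)
      (DynGL.mem_rgrade one_mem_grade), this]
    rfl
  mul_S_id α β a ha x hx := by
    obtain ⟨y, hy, f, hf, hy'⟩ := hφ.exists_actLeft hq0 hq1 ha
    have := hy' 1
    rw [map_one, one_mul] at this
    rw [FGL.mul'_map_antipode_id, hφ.actLeft_eq (hx.trans hy.symm)
      (DynGL.mem_lgrade one_mem_grade), this, counitOne, hf, dOp_apply, map_one, mul_one]

end Antipode

end DynGL
end

/-! ### The proposition. -/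

open DynGL DynGL.HPre in
theorem proposition5p2 (n : ℕ) (q : ℂ) (hq0 : q ≠ 0)
    (hq : ∀ k : ℕ, 1 ≤ k → k ≤ n → q ^ (2 * k) ≠ 1) :
    IsMatrixElements (n := n) q (FM.minor q) ∧
    ∃ (Δ : HHom n (FGL n q) (MTensor n (FGL n q) (FGL n q))) (ε : HHom n (FGL n q) (Dh n))
      (S : FGL n q →ₗ[ℂ] FGL n q),
      (∀ i j, Δ.toAlgHom (FGL.t q i j) = ∑ k, tmul (FGL.t q i k) (FGL.t q k j)
        (mem_rgrade (FGL.t_mem q i k)) (mem_lgrade (FGL.t_mem q k j))) ∧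
      Δ.toAlgHom (FGL.detInv n q) = tmul (FGL.detInv n q) (FGL.detInv n q)
        (mem_rgrade (FGL.detInv_mem n q)) (mem_lgrade (FGL.detInv_mem n q)) ∧
      (∀ i j, ε.toAlgHom (FGL.t q i j) = if i = j then dOp 1 (-wt i) else 0) ∧
      ε.toAlgHom (FGL.detInv n q) = dOp 1 1 ∧
      IsHHopfAlgebroid Δ ε S ∧
      S 1 = 1 ∧
      (∀ a b, S (a * b) = S b * S a) ∧
      (∀ f : M n, S (ml f) = mr f) ∧
      (∀ f : M n, S (mr f) = ml f) ∧
      S (FGL.detInv n q) = FGL.det n q ∧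
      ∀ i j, S (FGL.t q i j) = FGL.detInv n q *
        (ml (sgn q {j}ᶜ {j}) * mr (sgn q {i}ᶜ {i})⁻¹) * FGL.minor q {j}ᶜ {i}ᶜ := by
  have hq1 : 2 ≤ n → q ≠ 1 := fun h h1 => hq 1 le_rfl (by omega) (by rw [h1, one_pow])
  obtain ⟨φ, hφ⟩ := FGL.exists_antipode hq0 hq hq1
  refine ⟨isMatrixElements_minor hq0 hq1, FGL.comul hq0 hq1, FGL.counit n q, FGL.antipode φ,
    fun i j => ?_, ?_, FGL.counit_t, FGL.counit_detInv,
    ⟨FGL.isHBialgebroid hq0 hq1, hφ.isAntipode hq0 hq hq1⟩, ?_, FGL.unop_map_mul φ, fun f => ?_,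
    fun f => ?_, ?_, fun i j => ?_⟩
  · rw [FGL.comul_t]
    exact Finset.sum_congr rfl fun k _ => (tmul_eq_tm _ _).symm
  · rw [FGL.comul_detInv, tmul_eq_tm]
  · rw [FGL.antipode_apply, map_one]; rfl
  · rw [FGL.antipode_apply, hφ.map_ml]; rfl
  · rw [FGL.antipode_apply, hφ.map_mr]; rfl
  · rw [FGL.antipode_apply, hφ.map_detInv]; rfl
  · rw [FGL.antipode_apply, hφ.map_t]; rfl
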